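/- **Theorem (Time-adiabatic theorem).** Let $\mathcal H$ be a complex Hilbert space. Let $C_{\rm b}^\infty(\mathbb R,\mathcal B(\mathcal H))$ be the space of norm-smooth functions with bounded derivatives of all orders. For a family $A^\varepsilon\in C^\infty_{\rm b}(\mathbb R,\mathcal B(\mathcal H))$, $\varepsilon\in[0,\varepsilon_0)$, and $A_j\in C^\infty_{\rm b}(\mathbb R,\mathcal B(\mathcal H))$ write $A\asymp\sum_j\varepsilon^jA_j$ if for all $n,k\in\mathbb N_0$ there is a constant $C_{n,k}$ with $\sup_t\|\partial_t^k(A^\varepsilon-\sum_{j<n}\varepsilon^jA_j)(t)\|\le C_{n,k}\,\varepsilon^n$ for all $\varepsilon\in[0,\varepsilon_0)$; write $A\in S^0(\varepsilon)$ if such $A_j$ exist. Write $R(t)=\mathcal O_0(\varepsilon)$ if $\|R^\varepsilon(t)\|\le C\varepsilon$ for all $t\in\mathbb R$ and $\varepsilon\in[0,\varepsilon_0)$, and $R(t,s)=\mathcal O_0(\varepsilon^\infty|t-s|)$ if for each $n\in\mathbb N_0$ there is a $C_n$ with $\|R^\varepsilon(t,s)\|\le C_n\varepsilon^n|t-s|$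 for all $t,s\in\mathbb R$ and $\varepsilon\in(0,\varepsilon_0)$. Let $\varepsilon_0>0$, let $H^\varepsilon(t)$ be bounded and self-adjoint for $t\in\mathbb R$, $\varepsilon\in[0,\varepsilon_0)$, and let $H\asymp\sum_j\varepsilon^jH_j$ in $S^0(\varepsilon)$. For each $t$ let $\sigma_{\rm r}(t)$ be a subset of the spectrum $\sigma(t)$ of $H_0(t)$, and suppose that there are continuous $\gamma_-\le\gamma_+$ on $\mathbb R$ with $\sup_t|\gamma_+(t)-\gamma_-(t)|<\infty$ and a $g>0$ such that for all $t$: $\sigma_{\rm r}(t)\subset[\gamma_-(t),\gamma_+(t)]$ and every point of $\sigma(t)\setminus\sigma_{\rm r}(t)$ has distance at least $g$ from $[\gamma_-(t),\gamma_+(t)]$. Let $\pi_0(t)$ be the spectral projection of $H_0(t)$ onto $\sigma_{\rm r}(t)$ and $\pi_{\rm r}:=\pi_0(0)$. For each $\varepsilon\in(0,\varepsilon_0)$ the problem $i\varepsilon\partial_tU(t,s)=H^\varepsilon(t)U(t,s)$, $U(s,s)=\mathbf 1$, has a unique (strong) solution, and it is a unitary propagator: it is unitary, jointly strongly continuous,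 and $U(t,t)=\mathbf 1$, $U(t,r)U(r,s)=U(t,s)$. Moreover: (i) There are orthogonal projectors $\Pi(t)=\Pi^\varepsilon(t)$ with $\Pi(\cdot)\in S^0(\varepsilon)$, $\Pi(t)-\pi_0(t)=\mathcal O_0(\varepsilon)$ and $$U(t,s)^*\,\Pi(t)\,U(t,s)=\Pi(s)+\mathcal O_0(\varepsilon^\infty|t-s|).$$ If $t\in\mathbb R$ is such that, for all $\varepsilon\in[0,\varepsilon_0)$, $\partial_t^\alpha H^\varepsilon(t)=0$ for all $\alpha\ge1$ and $[H^\varepsilon(t),\pi_0(t)]=0$, then $\Pi^\varepsilon(t)=\pi_0(t)$ for all $\varepsilon\in[0,\varepsilon_0)$. (The commutation condition holds in particular if $H$ does not depend on $\varepsilon$.) (ii) There are unitaries $u_0(t)$ with $u_0(\cdot)\in C_{\rm b}^\infty(\mathbb R,\mathcal B(\mathcal H))$ and $u_0(t)\pi_0(t)u_0^*(t)=\pi_{\rm r}$, and unitaries $\mathcal U(t)=\mathcal U^\varepsilon(t)$ with $\mathcal U\asymp\sum_n\varepsilon^nu_n$ in $S^0(\varepsilon)$, such that $\mathcal U(t)\Pi(t)\mathcal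 U^*(t)=\pi_{\rm r}$ and $\mathcal U(t)-u_0(t)=\mathcal O_0(\varepsilon)$. (iii) There are self-adjoint $h(t)=h^\varepsilon(t)$ with $h(\cdot)\in S^0(\varepsilon)$ and $[h(t),\pi_{\rm r}]=0$ for all $t$, with asymptotic expansion $$h(t)\asymp\sum_{n\ge0}\varepsilon^n\Big(\sum_{j+k+l=n}u_j(t)H_k(t)u_l^*(t)+\frac i2\sum_{j+k+1=n}\big(\dot u_j(t)u_k^*(t)-u_j(t)\dot u_k^*(t)\big)\Big),$$ such that for $\varepsilon\in(0,\varepsilon_0)$ the problem $i\varepsilon\partial_tU_{\rm eff}(t,s)=h(t)U_{\rm eff}(t,s)$, $U_{\rm eff}(s,s)=\mathbf 1$, has a unique solution, which is a unitary propagator and satisfies $$U(t,s)=\mathcal U^*(t)\,U_{\rm eff}(t,s)\,\mathcal U(s)+\mathcal O_0(\varepsilon^\infty|t-s|).$$ -/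

import Mathlib

open scoped ContDiff

/-- `C_b^∞(ℝ, E)`: smooth functions of time all of whose derivatives are bounded. This is the
space of those symbols in `S^0` on the phase space `ℝ_t × ℝ_η` that do not depend on `η`. -/
structure IsSymbol {E : Type*} [NormedAddCommGroup E] [NormedSpace ℝ E] (A : ℝ → E) : Prop where
  smooth : ContDiff ℝ ∞ A
  bounded : ∀ k : ℕ, ∃ C : ℝ, ∀ t : ℝ, ‖iteratedDeriv k A t‖ ≤ C

/-- `A ≍ ∑ ε^j A_j` in `S^0(ε)`, for `ε ∈ [0, ε₀)`: the maps `A ε` and the coefficients `Ac j` are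
symbols, and for all `n`, `k` the `k`-th derivative of `A ε - ∑_{j < n} ε^j A_j` is bounded by
`C_{n,k} ε^n`, uniformly in time. -/
structure HasSymbolExpansion {E : Type*} [NormedAddCommGroup E] [NormedSpace ℝ E]
    (ε₀ : ℝ) (A : ℝ → ℝ → E) (Ac : ℕ → ℝ → E) : Prop where
  symbol : ∀ ε ∈ Set.Ico 0 ε₀, IsSymbol (A ε)
  coeff : ∀ j : ℕ, IsSymbol (Ac j)
  remainder : ∀ n k : ℕ, ∃ C : ℝ, ∀ ε ∈ Set.Ico 0 ε₀, ∀ t : ℝ,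
    ‖iteratedDeriv k (fun τ => A ε τ - ∑ j ∈ Finset.range n, ε ^ j • Ac j τ) t‖ ≤ C * ε ^ n

/-- Semiclassical symbols `S^0(ε)`. -/
def IsSemiclassicalSymbol {E : Type*} [NormedAddCommGroup E] [NormedSpace ℝ E]
    (ε₀ : ℝ) (A : ℝ → ℝ → E) : Prop :=
  ∃ Ac : ℕ → ℝ → E, HasSymbolExpansion ε₀ A Ac

section Operators

variable {𝓗 : Type*} [NormedAddCommGroup 𝓗] [InnerProductSpace ℂ 𝓗]

/-- A unitary propagator: unitary, jointly strongly continuous, with `U(t,t) = 1` and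
`U(t,r) U(r,s) = U(t,s)`. -/
structure IsUnitaryPropagator [CompleteSpace 𝓗] (U : ℝ → ℝ → 𝓗 →L[ℂ] 𝓗) : Prop where
  isUnitary : ∀ t s, U t s ∈ unitary (𝓗 →L[ℂ] 𝓗)
  strongContinuous : ∀ ψ : 𝓗, Continuous fun p : ℝ × ℝ => U p.1 p.2 ψ
  diag : ∀ t, U t t = 1
  comp : ∀ t r s, U t r * U r s = U t s

/-- The initial value problem `i ε ∂_t U(t,s) = A(t) U(t,s)`, `U(s,s) = 1`, in the strong sense
(used for `ε > 0`). -/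
def SolvesSchrodinger (ε : ℝ) (A : ℝ → 𝓗 →L[ℂ] 𝓗) (U : ℝ → ℝ → 𝓗 →L[ℂ] 𝓗) : Prop :=
  (∀ s, U s s = 1) ∧
    ∀ s t : ℝ, ∀ ψ : 𝓗,
      HasDerivAt (fun τ => U τ s ψ) ((Complex.I * (ε : ℂ))⁻¹ • A t (U t s ψ)) t

/-- `U` is the unique solution of `i ε ∂_t U(t,s) = A(t) U(t,s)`, `U(s,s) = 1`, and it is a unitary
propagator. -/
structure IsPropagatorOf [CompleteSpace 𝓗] (ε : ℝ) (A : ℝ → 𝓗 →L[ℂ] 𝓗)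
    (U : ℝ → ℝ → 𝓗 →L[ℂ] 𝓗) : Prop where
  propagator : IsUnitaryPropagator U
  solves : SolvesSchrodinger ε A U
  unique : ∀ V : ℝ → ℝ → 𝓗 →L[ℂ] 𝓗, SolvesSchrodinger ε A V → V = U

/-- The relevant part `σr t` of the spectrum of `A t` lies in an interval `[γ₋(t), γ₊(t)]` with
continuous end points and bounded width, at distance at least `g > 0`, uniformly in time, from the
rest of the spectrum. -/
def UniformGap (A : ℝ → 𝓗 →L[ℂ] 𝓗) (σr : ℝ → Set ℝ) : Prop :=
  (∀ t, σr t ⊆ spectrum ℝ (A t)) ∧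
    ∃ γm γp : ℝ → ℝ, Continuous γm ∧ Continuous γp ∧ (∀ t, γm t ≤ γp t) ∧
      (∀ t, σr t ⊆ Set.Icc (γm t) (γp t)) ∧
      (∃ g > 0, ∀ t, ∀ x ∈ spectrum ℝ (A t) \ σr t, ∀ y ∈ Set.Icc (γm t) (γp t), g ≤ |x - y|) ∧
      ∃ C : ℝ, ∀ t, |γp t - γm t| ≤ C

/-- The spectral projection of a bounded self-adjoint operator `A` onto the part `S` of its
spectrum, for `S` open and closed in the spectrum: the indicator function of `S`, applied to `A` by
the (continuous) functional calculus. -/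
noncomputable def spectralProjection [CompleteSpace 𝓗] (A : 𝓗 →L[ℂ] 𝓗) (S : Set ℝ) :
    𝓗 →L[ℂ] 𝓗 :=
  cfc (S.indicator fun _ => (1 : ℝ)) A

/-- `R = O₀(ε)`, uniformly in time. -/
def IsOrderEps (ε₀ : ℝ) (R : ℝ → ℝ → 𝓗 →L[ℂ] 𝓗) : Prop :=
  ∃ C : ℝ, ∀ ε ∈ Set.Ico 0 ε₀, ∀ t : ℝ, ‖R ε t‖ ≤ C * ε

/-- `R(t,s) = O₀(ε^∞ |t - s|)`, uniformly in `t` and `s`. -/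
def IsOrderEpsInfty (ε₀ : ℝ) (R : ℝ → ℝ → ℝ → 𝓗 →L[ℂ] 𝓗) : Prop :=
  ∀ n : ℕ, ∃ C : ℝ, ∀ ε ∈ Set.Ioo 0 ε₀, ∀ t s : ℝ, ‖R ε t s‖ ≤ C * ε ^ n * |t - s|

/-- The coefficient of `ε^n` in the effective Hamiltonian,
`∑_{j+k+l=n} u_j H_k u_l^* + (i/2) ∑_{j+k+1=n} (u̇_j u_k^* - u_j u̇_k^*)`. -/
noncomputable def effectiveCoeff [CompleteSpace 𝓗] (Hc uc : ℕ → ℝ → 𝓗 →L[ℂ] 𝓗) (n : ℕ) (t : ℝ) :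
    𝓗 →L[ℂ] 𝓗 :=
  (∑ p ∈ Finset.HasAntidiagonal.antidiagonal n, ∑ q ∈ Finset.HasAntidiagonal.antidiagonal p.2,
      uc p.1 t * Hc q.1 t * star (uc q.2 t)) +
    (Complex.I / 2) •
      ∑ p ∈ (Finset.range n ×ˢ Finset.range n) with p.1 + p.2 + 1 = n,
        (deriv (uc p.1) t * star (uc p.2 t) - uc p.1 t * deriv (fun τ => star (uc p.2 τ)) t)

end Operators

/-! A unitary frame `V(t)` turns `i ε ∂_t U = H U` into the same equation with `K = V H V* + i ε V'
V*` in place of `H`. If `V` is chosen so that `K` commutes with the fixed projection `q = π₀(0)` up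
to `O(ε^∞)`, the theorem follows: the decoupled projection is `V* q V`, the effective Hamiltonian
`h` is the diagonal part of `K` with respect to `q`, which differs from `K` by `O(ε^∞)`, and
Duhamel's formula (`norm_duhamel_le`), at the cost of a factor `ε⁻¹`, turns these errors into errors
`O(ε^∞ |t - s|)` of the propagators.

The frame is a product `V = u W`. Here `u` is Kato's parallel transport, `u' = u [π₀, π₀']`, which
carries `π₀(t)` to `π₀(0)`. After conjugation by `u`, it remains to find unitaries `W = 1 + O(ε)`
for which the frame Hamiltonian, with `[π₀, π₀']` as connection form, commutes with `π₀(t)` to all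
orders. They are built one order at a time (`AdiabaticData.exists_next`): if the off-diagonal part
of the frame Hamiltonian is `ε^(m+1) d` to leading order, one solves `[H₀, T] = d/2` and multiplies
`W` by the Cayley transform of `ε^(m+1) T`, which is exactly unitary and cancels `d`. Borel's lemma
(`exists_borel_index`) lets the number of such steps depend on `ε`. Each value of the resulting
family is one of the frames already built, so unitarity stays exact.

The gap enters through the Sylvester equation. If one part of the spectrum lies in a ball of radius
`r` and the other outside the concentric ball of radius `r + g`, then `x ↦ h₁ x - x h₂` is bounded
below by `g` on the corresponding corner (`GapBound.norm_le`), and for `h₁ = h₂` it is onto. The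
same estimate across two times makes `π₀` Lipschitz; a derivative formula and a bootstrap then give
smoothness with uniform bounds, without contour integrals.

For the last assertion of (i), the symbol classes carry a set `Z` of times at which all derivatives
of positive order vanish. At these times `H` commutes with `π₀`, so every correction `d`, and with
it `T`, is zero and `W = 1`. The construction is done for `ε > 0`; at `ε = 0` the leading
coefficients are inserted. -/

open scoped ContDiff
open Filter Topology

/-! ### Symbols with bounds uniform in a parameter -/

section UniformSymbols

variable {ι : Type*} {E F : Type*} [NormedAddCommGroup E] [NormedSpace ℝ E]
  [NormedAddCommGroup F] [NormedSpace ℝ F] {Z : Set ℝ} {n : ℕ}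

/-- A family of functions of time, all of whose derivatives up to order `n` are bounded uniformly
in the family, and whose derivatives of orders `1, …, n` vanish on `Z`. -/
def UnifCb (Z : Set ℝ) : ℕ → (ι → ℝ → E) → Prop
  | 0, A => ∃ C : ℝ, ∀ i t, ‖A i t‖ ≤ C
  | n + 1, A => (∃ C : ℝ, ∀ i t, ‖A i t‖ ≤ C) ∧ (∀ i, Differentiable ℝ (A i)) ∧
      (∀ i, ∀ t ∈ Z, deriv (A i) t = 0) ∧ UnifCb Z n fun i => deriv (A i)

/-- A family of functions of time, all of whose derivatives are bounded uniformly in the family,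
and whose derivatives of positive order vanish on `Z`. -/
def UnifSymbol (Z : Set ℝ) (A : ι → ℝ → E) : Prop := ∀ n, UnifCb Z n A

namespace UnifCb

theorem bdd {A : ι → ℝ → E} (h : UnifCb Z n A) : ∃ C : ℝ, 0 ≤ C ∧ ∀ i t, ‖A i t‖ ≤ C := by
  have : ∃ C : ℝ, ∀ i t, ‖A i t‖ ≤ C := by
    cases n with
    | zero => exact h
    | succ n => exact h.1
  obtain ⟨C, hC⟩ := this
  exact ⟨max C 0, le_max_right _ _, fun i t => (hC i t).trans (le_max_left _ _)⟩

theorem pred {A : ι → ℝ → E} (h : UnifCb Z (n + 1) A) : UnifCb Z n A := by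
  induction n generalizing A with
  | zero => exact h.1
  | succ n ih => exact ⟨h.1, h.2.1, h.2.2.1, ih h.2.2.2⟩

/-- The induction step behind the closure properties: an explicit formula for the derivative reduces
order `n + 1` to order `n` of that formula. -/
theorem of_deriv {A A' : ι → ℝ → E} (hb : ∃ C : ℝ, ∀ i t, ‖A i t‖ ≤ C)
    (hd : ∀ i t, HasDerivAt (A i) (A' i t) t) (hZ : ∀ i, ∀ t ∈ Z, A' i t = 0)
    (h : UnifCb Z n A') : UnifCb Z (n + 1) A := by
  have hA : (fun i => deriv (A i)) = A' := funext fun i => funext fun t => (hd i t).deriv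
  refine ⟨hb, fun i t => (hd i t).differentiableAt, fun i t ht => ?_, hA ▸ h⟩
  rw [(hd i t).deriv, hZ i t ht]

theorem const (c : E) : UnifCb Z n fun (_ : ι) (_ : ℝ) => c := by
  induction n generalizing c with
  | zero => exact ⟨‖c‖, fun _ _ => le_rfl⟩
  | succ n ih =>
    exact of_deriv ⟨‖c‖, fun _ _ => le_rfl⟩ (fun _ t => hasDerivAt_const t c) (fun _ _ _ => rfl)
      (ih 0)

theorem add {A B : ι → ℝ → E} (hA : UnifCb Z n A) (hB : UnifCb Z n B) :
    UnifCb Z n fun i t => A i t + B i t := by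
  have hb : ∃ C : ℝ, ∀ i t, ‖A i t + B i t‖ ≤ C := by
    obtain ⟨C, -, hC⟩ := hA.bdd
    obtain ⟨D, -, hD⟩ := hB.bdd
    exact ⟨C + D, fun i t => (norm_add_le _ _).trans (add_le_add (hC i t) (hD i t))⟩
  induction n generalizing A B with
  | zero => exact hb
  | succ n ih =>
    refine of_deriv hb (fun i t => (hA.2.1 i t).hasDerivAt.add (hB.2.1 i t).hasDerivAt)
      (fun i t ht => by rw [hA.2.2.1 i t ht, hB.2.2.1 i t ht, add_zero])
      (ih hA.2.2.2 hB.2.2.2 ?_)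
    obtain ⟨C, -, hC⟩ := hA.2.2.2.bdd
    obtain ⟨D, -, hD⟩ := hB.2.2.2.bdd
    exact ⟨C + D, fun i t => (norm_add_le _ _).trans (add_le_add (hC i t) (hD i t))⟩

/-- Uniformly bounded families of continuous linear maps preserve symbol families. -/
theorem clm_family {A : ι → ℝ → E} (L : ι → E →L[ℝ] F) (hL : ∃ C : ℝ, ∀ i, ‖L i‖ ≤ C)
    (hA : UnifCb Z n A) : UnifCb Z n fun i t => L i (A i t) := by
  have key : ∀ {A : ι → ℝ → E}, (∃ C : ℝ, 0 ≤ C ∧ ∀ i t, ‖A i t‖ ≤ C) →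
      ∃ C : ℝ, ∀ i t, ‖L i (A i t)‖ ≤ C := by
    rintro A ⟨C, hC0, hC⟩
    obtain ⟨D, hD⟩ := hL
    refine ⟨|D| * C, fun i t => ((L i).le_opNorm _).trans ?_⟩
    exact mul_le_mul ((hD i).trans (le_abs_self D)) (hC i t) (norm_nonneg _) (abs_nonneg D)
  induction n generalizing A with
  | zero => exact key hA.bdd
  | succ n ih =>
    refine of_deriv (key hA.bdd)
      (fun i t => (L i).hasFDerivAt.comp_hasDerivAt t (hA.2.1 i t).hasDerivAt)
      (fun i t ht => by rw [hA.2.2.1 i t ht, map_zero]) (ih hA.2.2.2)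

theorem clm {A : ι → ℝ → E} (L : E →L[ℝ] F) (hA : UnifCb Z n A) :
    UnifCb Z n fun i t => L (A i t) :=
  hA.clm_family (fun _ => L) ⟨‖L‖, fun _ => le_rfl⟩

theorem smul_family {A : ι → ℝ → E} (c : ι → ℝ) (hc : ∃ C : ℝ, ∀ i, |c i| ≤ C)
    (hA : UnifCb Z n A) : UnifCb Z n fun i t => c i • A i t := by
  refine hA.clm_family (fun i => c i • ContinuousLinearMap.id ℝ E) ?_
  obtain ⟨C, hC⟩ := hc
  refine ⟨C, fun i => ContinuousLinearMap.opNorm_le_bound _ ((abs_nonneg _).trans (hC i)) fun x => ?_⟩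
  rw [smul_apply, ContinuousLinearMap.id_apply, norm_smul, Real.norm_eq_abs]
  exact mul_le_mul_of_nonneg_right (hC i) (norm_nonneg x)

theorem const_smul {A : ι → ℝ → E} (c : ℝ) (hA : UnifCb Z n A) :
    UnifCb Z n fun i t => c • A i t :=
  hA.smul_family (fun _ => c) ⟨|c|, fun _ => le_rfl⟩

theorem neg {A : ι → ℝ → E} (hA : UnifCb Z n A) : UnifCb Z n fun i t => -A i t := by
  simpa using hA.const_smul (-1)

theorem sub {A B : ι → ℝ → E} (hA : UnifCb Z n A) (hB : UnifCb Z n B) :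
    UnifCb Z n fun i t => A i t - B i t := by
  simpa only [sub_eq_add_neg] using hA.add hB.neg

theorem bilin {G : Type*} [NormedAddCommGroup G] [NormedSpace ℝ G] (L : E →L[ℝ] F →L[ℝ] G)
    {A : ι → ℝ → E} {B : ι → ℝ → F} (hA : UnifCb Z n A) (hB : UnifCb Z n B) :
    UnifCb Z n fun i t => L (A i t) (B i t) := by
  have key : ∀ {m : ℕ} {A : ι → ℝ → E} {B : ι → ℝ → F}, UnifCb Z m A → UnifCb Z m B →
      ∃ C : ℝ, ∀ i t, ‖L (A i t) (B i t)‖ ≤ C := by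
    intro m A B hA hB
    obtain ⟨C, hC0, hC⟩ := hA.bdd
    obtain ⟨D, -, hD⟩ := hB.bdd
    exact ⟨‖L‖ * C * D, fun i t => (L.le_opNorm₂ _ _).trans (mul_le_mul
      (mul_le_mul_of_nonneg_left (hC i t) (norm_nonneg L)) (hD i t) (norm_nonneg _)
      (by positivity))⟩
  induction n generalizing A B with
  | zero => exact key hA hB
  | succ n ih =>
    refine of_deriv (key hA hB) (fun i t => L.hasDerivAt_of_bilinear (fun _ => (hA.2.1 i t).hasDerivAt)
        fun _ => (hB.2.1 i t).hasDerivAt)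
      (fun i t ht => by rw [hA.2.2.1 i t ht, hB.2.2.1 i t ht]; simp)
      ((ih hA.pred hB.2.2.2).add (ih hA.2.2.2 hB.pred))

theorem mul {R : Type*} [NormedRing R] [NormedAlgebra ℝ R] {A B : ι → ℝ → R}
    (hA : UnifCb Z n A) (hB : UnifCb Z n B) : UnifCb Z n fun i t => A i t * B i t :=
  hA.bilin (ContinuousLinearMap.mul ℝ R) hB

/-- The pointwise inverse of a symbol family is a symbol family as soon as it is bounded. -/
theorem inverse {R : Type*} [NormedRing R] [NormedAlgebra ℝ R] [CompleteSpace R]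
    {X Y : ι → ℝ → R} (hXY : ∀ i t, X i t * Y i t = 1) (hYX : ∀ i t, Y i t * X i t = 1)
    (hY : ∃ C : ℝ, ∀ i t, ‖Y i t‖ ≤ C) (hX : UnifCb Z n X) : UnifCb Z n Y := by
  induction n with
  | zero => exact hY
  | succ n ih =>
    have hYn := ih hX.pred
    -- The derivative `-Y X' Y` involves `Y` itself only to order `n`, so the induction closes.
    refine of_deriv (A' := fun i t => -(Y i t * deriv (X i) t * Y i t)) hY (fun i t => ?_)
      (fun i t ht => by rw [hX.2.2.1 i t ht, mul_zero, zero_mul, neg_zero])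
      ((hYn.mul hX.2.2.2).mul hYn).neg
    have hY' : Y i = fun τ => Ring.inverse (X i τ) := funext fun τ =>
      (Ring.inverse_unit ⟨X i τ, Y i τ, hXY i τ, hYX i τ⟩).symm
    have h := (hasFDerivAt_ringInverse (𝕜 := ℝ)
      (⟨X i t, Y i t, hXY i t, hYX i t⟩ : Rˣ)).comp_hasDerivAt t (hX.2.1 i t).hasDerivAt
    have hv : (-((ContinuousLinearMap.mulLeftRight ℝ R) (Y i t)) (Y i t)) (deriv (X i) t) =
        -(Y i t * deriv (X i) t * Y i t) := by simp
    rw [← hv]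
    exact h.congr_of_eventuallyEq (Filter.Eventually.of_forall fun τ => congrFun hY' τ)

theorem iteratedDeriv {A : ι → ℝ → E} (k : ℕ) (hA : UnifCb Z (n + k) A) :
    UnifCb Z n fun i => iteratedDeriv k (A i) := by
  induction k generalizing A with
  | zero =>
    simp only [iteratedDeriv_zero]
    exact hA
  | succ k ih =>
    simp only [iteratedDeriv_succ']
    exact ih hA.2.2.2

end UnifCb

theorem unifCb_of_iteratedDeriv {A : ι → ℝ → E} (hs : ∀ i, ContDiff ℝ ∞ (A i))
    (hb : ∀ k, ∃ C : ℝ, ∀ i t, ‖iteratedDeriv k (A i) t‖ ≤ C)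
    (hZ : ∀ i, ∀ t ∈ Z, ∀ k, 1 ≤ k → iteratedDeriv k (A i) t = 0) : UnifSymbol Z A := by
  intro n
  induction n generalizing A with
  | zero =>
    have := hb 0
    simp only [iteratedDeriv_zero] at this
    exact this
  | succ n ih =>
    refine ⟨by simpa using hb 0, fun i => (contDiff_infty_iff_deriv.1 (hs i)).1,
      fun i t ht => by simpa using hZ i t ht 1 le_rfl,
      ih (fun i => (contDiff_infty_iff_deriv.1 (hs i)).2) (fun k => ?_) fun i t ht k _ => ?_⟩
    · simpa only [iteratedDeriv_succ'] using hb (k + 1)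
    · simpa only [iteratedDeriv_succ'] using hZ i t ht (k + 1) (by omega)

namespace UnifSymbol

theorem bdd {A : ι → ℝ → E} (h : UnifSymbol Z A) : ∃ C : ℝ, 0 ≤ C ∧ ∀ i t, ‖A i t‖ ≤ C :=
  (h 0).bdd

theorem differentiable {A : ι → ℝ → E} (h : UnifSymbol Z A) (i : ι) : Differentiable ℝ (A i) :=
  (h 1).2.1 i

theorem hasDerivAt {A : ι → ℝ → E} (h : UnifSymbol Z A) (i : ι) (t : ℝ) :
    HasDerivAt (A i) (_root_.deriv (A i) t) t :=
  (h.differentiable i t).hasDerivAt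

theorem continuous {A : ι → ℝ → E} (h : UnifSymbol Z A) (i : ι) : Continuous (A i) :=
  (h.differentiable i).continuous

theorem deriv_eq_zero {A : ι → ℝ → E} (h : UnifSymbol Z A) (i : ι) {t : ℝ} (ht : t ∈ Z) :
    _root_.deriv (A i) t = 0 :=
  (h 1).2.2.1 i t ht

theorem deriv {A : ι → ℝ → E} (h : UnifSymbol Z A) : UnifSymbol Z fun i => deriv (A i) :=
  fun n => (h (n + 1)).2.2.2

theorem iteratedDeriv_bdd {A : ι → ℝ → E} (h : UnifSymbol Z A) (k : ℕ) :
    ∃ C : ℝ, 0 ≤ C ∧ ∀ i t, ‖iteratedDeriv k (A i) t‖ ≤ C :=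
  ((h (0 + k)).iteratedDeriv k).bdd

theorem iteratedDeriv_eq_zero {A : ι → ℝ → E} (h : UnifSymbol Z A) (i : ι) {t : ℝ} (ht : t ∈ Z)
    {k : ℕ} (hk : 1 ≤ k) : iteratedDeriv k (A i) t = 0 := by
  obtain ⟨k, rfl⟩ := Nat.exists_eq_add_of_le' hk
  rw [iteratedDeriv_succ]
  exact ((h (1 + k)).iteratedDeriv k).2.2.1 i t ht

theorem contDiff {A : ι → ℝ → E} (h : UnifSymbol Z A) (i : ι) : ContDiff ℝ ∞ (A i) := by
  rw [contDiff_infty]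
  intro n
  induction n generalizing A with
  | zero => exact contDiff_zero.2 (h.continuous i)
  | succ n ih =>
    push_cast
    exact contDiff_succ_iff_deriv.2 ⟨h.differentiable i, by simp, ih h.deriv⟩

theorem isSymbol {A : ι → ℝ → E} (h : UnifSymbol Z A) (i : ι) : IsSymbol (A i) :=
  ⟨h.contDiff i, fun k => (h.iteratedDeriv_bdd k).imp fun _ hC => hC.2 i⟩

theorem const (c : E) : UnifSymbol Z fun (_ : ι) (_ : ℝ) => c := fun _ => UnifCb.const c

theorem add {A B : ι → ℝ → E} (hA : UnifSymbol Z A) (hB : UnifSymbol Z B) :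
    UnifSymbol Z fun i t => A i t + B i t := fun n => (hA n).add (hB n)

theorem sub {A B : ι → ℝ → E} (hA : UnifSymbol Z A) (hB : UnifSymbol Z B) :
    UnifSymbol Z fun i t => A i t - B i t := fun n => (hA n).sub (hB n)

theorem neg {A : ι → ℝ → E} (hA : UnifSymbol Z A) : UnifSymbol Z fun i t => -A i t :=
  fun n => (hA n).neg

theorem clm {A : ι → ℝ → E} (L : E →L[ℝ] F) (hA : UnifSymbol Z A) :
    UnifSymbol Z fun i t => L (A i t) := fun n => (hA n).clm L

theorem const_smul {A : ι → ℝ → E} (c : ℝ) (hA : UnifSymbol Z A) :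
    UnifSymbol Z fun i t => c • A i t := fun n => (hA n).const_smul c

theorem smul_family {A : ι → ℝ → E} (c : ι → ℝ) (hc : ∃ C : ℝ, ∀ i, |c i| ≤ C)
    (hA : UnifSymbol Z A) : UnifSymbol Z fun i t => c i • A i t :=
  fun n => (hA n).smul_family c hc

theorem mul {R : Type*} [NormedRing R] [NormedAlgebra ℝ R] {A B : ι → ℝ → R}
    (hA : UnifSymbol Z A) (hB : UnifSymbol Z B) : UnifSymbol Z fun i t => A i t * B i t :=
  fun n => (hA n).mul (hB n)

theorem inverse {R : Type*} [NormedRing R] [NormedAlgebra ℝ R] [CompleteSpace R]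
    {X Y : ι → ℝ → R} (hXY : ∀ i t, X i t * Y i t = 1) (hYX : ∀ i t, Y i t * X i t = 1)
    (hY : ∃ C : ℝ, ∀ i t, ‖Y i t‖ ≤ C) (hX : UnifSymbol Z X) : UnifSymbol Z Y :=
  fun n => (hX n).inverse hXY hYX hY

theorem star {R : Type*} [NormedRing R] [NormedAlgebra ℝ R] [StarRing R] [NormedStarGroup R]
    [StarModule ℝ R] {A : ι → ℝ → R} (hA : UnifSymbol Z A) :
    UnifSymbol Z fun i t => star (A i t) :=
  hA.clm ((starL' ℝ : R ≃L[ℝ] R) : R →L[ℝ] R)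

theorem comp {κ : Type*} {A : ι → ℝ → E} (f : κ → ι) (hA : UnifSymbol Z A) :
    UnifSymbol Z fun j => A (f j) :=
  unifCb_of_iteratedDeriv (fun j => hA.contDiff (f j))
    (fun k => (hA.iteratedDeriv_bdd k).imp fun _ hC j => hC.2 (f j))
    fun j _ ht _ hk => hA.iteratedDeriv_eq_zero (f j) ht hk

end UnifSymbol

theorem IsSymbol.unifSymbol {A : ℝ → E} (h : IsSymbol A)
    (hZ : ∀ t ∈ Z, ∀ k, 1 ≤ k → iteratedDeriv k A t = 0) :
    UnifSymbol Z fun _ : ι => A :=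
  unifCb_of_iteratedDeriv (fun _ => h.smooth) (fun k => (h.bounded k).imp fun _ hC _ => hC)
    fun _ => hZ

end UniformSymbols

/-! ### Asymptotic expansions in a small parameter -/

section Expansions

variable {ι : Type*} {E F : Type*} [NormedAddCommGroup E] [NormedSpace ℝ E]
  [NormedAddCommGroup F] [NormedSpace ℝ F] {Z : Set ℝ} {n : ℕ} {e : ι → ℝ}

/-- A bounded family of positive numbers that accumulates at zero. -/
structure IsSmallParameter (e : ι → ℝ) : Prop where
  pos : ∀ i, 0 < e i
  bdd : ∃ C : ℝ, ∀ i, |e i| ≤ C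
  small : ∀ δ > 0, ∃ i, e i < δ

theorem IsSmallParameter.pow_bdd (he : IsSmallParameter e) (m : ℕ) : ∃ C : ℝ, ∀ i, |e i ^ m| ≤ C := by
  obtain ⟨C, hC⟩ := he.bdd
  exact ⟨C ^ m, fun i => by rw [abs_pow]; exact pow_le_pow_left₀ (abs_nonneg _) (hC i) m⟩

omit [NormedSpace ℝ E] in
theorem IsSmallParameter.eq_zero_of_norm_le (he : IsSmallParameter e) {x : E} {C : ℝ}
    (h : ∀ i, ‖x‖ ≤ C * e i) : x = 0 := by
  by_contra hx
  have hx' : 0 < ‖x‖ := norm_pos_iff.2 hx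
  obtain ⟨i, hi⟩ := he.small (‖x‖ / (|C| + 1)) (by positivity)
  rw [lt_div_iff₀ (by positivity)] at hi
  have h1 := h i
  have h2 : C * e i ≤ |C| * e i := mul_le_mul_of_nonneg_right (le_abs_self C) (he.pos i).le
  nlinarith [he.pos i]

/-- Letting `e i` tend to zero isolates the leading coefficient of an identity that holds along the
whole family. -/
theorem IsSmallParameter.eq_zero_of_add_smul (he : IsSmallParameter e) {x : E} {y : ι → E} {C : ℝ}
    (hy : ∀ i, ‖y i‖ ≤ C) (h : ∀ i, x + e i • y i = 0) : x = 0 := by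
  refine he.eq_zero_of_norm_le (C := C) fun i => ?_
  rw [eq_neg_of_add_eq_zero_left (h i), norm_neg, norm_smul, Real.norm_eq_abs,
    abs_of_pos (he.pos i), mul_comm]
  exact mul_le_mul_of_nonneg_right (hy i) (he.pos i).le

/-- `A = ∑_{j < n} e^j a_j + O(e^n)` in the sense of uniform symbols. -/
def Expands (e : ι → ℝ) (Z : Set ℝ) : ℕ → (ι → ℝ → E) → (ℕ → ℝ → E) → Prop
  | 0, A, _ => UnifSymbol Z A
  | n + 1, A, a => UnifSymbol Z (fun _ : ι => a 0) ∧ ∃ A₁ : ι → ℝ → E,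
      (∀ i t, A i t = a 0 t + e i • A₁ i t) ∧ Expands e Z n A₁ fun j => a (j + 1)

namespace Expands

theorem unifSymbol (he : IsSmallParameter e) {A : ι → ℝ → E} {a : ℕ → ℝ → E}
    (h : Expands e Z n A a) : UnifSymbol Z A := by
  induction n generalizing A a with
  | zero => exact h
  | succ n ih =>
    obtain ⟨h0, A₁, hA, h1⟩ := h
    obtain rfl : A = fun i t => a 0 t + e i • A₁ i t := funext₂ hA
    exact h0.add ((ih h1).smul_family e he.bdd)

theorem pred (he : IsSmallParameter e) {A : ι → ℝ → E} {a : ℕ → ℝ → E}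
    (h : Expands e Z (n + 1) A a) : Expands e Z n A a := by
  induction n generalizing A a with
  | zero => exact h.unifSymbol he
  | succ n ih =>
    obtain ⟨h0, A₁, hA, h1⟩ := h
    exact ⟨h0, A₁, hA, ih h1⟩

theorem mono (he : IsSmallParameter e) {A : ι → ℝ → E} {a : ℕ → ℝ → E} {m : ℕ} (hmn : m ≤ n)
    (h : Expands e Z n A a) : Expands e Z m A a := by
  induction n, hmn using Nat.le_induction with
  | base => exact h
  | succ n _ ih => exact ih (h.pred he)

theorem congr_coeff {A : ι → ℝ → E} {a b : ℕ → ℝ → E} (hab : ∀ j < n, a j = b j)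
    (h : Expands e Z n A a) : Expands e Z n A b := by
  induction n generalizing A a b with
  | zero => exact h
  | succ n ih =>
    obtain ⟨h0, A₁, hA, h1⟩ := h
    refine ⟨hab 0 n.succ_pos ▸ h0, A₁, hab 0 n.succ_pos ▸ hA, ih (fun j hj => ?_) h1⟩
    exact hab (j + 1) (by omega)

/-- The leading coefficients differ by `e` times a bounded family, hence agree; dividing the rest by
`e i ≠ 0` identifies the tails, and the argument repeats. -/
theorem unique (he : IsSmallParameter e) {A : ι → ℝ → E} {a b : ℕ → ℝ → E}
    (h : Expands e Z n A a) (h' : Expands e Z n A b) : ∀ j < n, a j = b j := by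
  induction n generalizing A a b with
  | zero => exact fun _ hj => absurd hj (Nat.not_lt_zero _)
  | succ n ih =>
    obtain ⟨-, A₁, hA, h1⟩ := h
    obtain ⟨-, B₁, hB, h1'⟩ := h'
    have h0 : a 0 = b 0 := by
      obtain ⟨C, -, hC⟩ := ((h1.unifSymbol he).sub (h1'.unifSymbol he)).bdd
      funext t
      refine sub_eq_zero.1 (he.eq_zero_of_add_smul (y := fun i => A₁ i t - B₁ i t)
        (fun i => hC i t) fun i => ?_)
      have := (hA i t).symm.trans (hB i t)
      rw [smul_sub, ← sub_eq_zero.2 this]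
      abel
    obtain rfl : A₁ = B₁ := by
      funext i t
      have := (hA i t).symm.trans (hB i t)
      rw [h0, add_right_inj] at this
      exact smul_right_injective E (he.pos i).ne' this
    intro j hj
    cases j with
    | zero => exact h0
    | succ j => exact ih h1 h1' j (by omega)

theorem remainder {A : ι → ℝ → E} {a : ℕ → ℝ → E} (h : Expands e Z n A a) :
    (∀ j < n, UnifSymbol Z fun _ : ι => a j) ∧ ∃ R : ι → ℝ → E, UnifSymbol Z R ∧
      ∀ i t, A i t = ∑ j ∈ Finset.range n, e i ^ j • a j t + e i ^ n • R i t := by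
  induction n generalizing A a with
  | zero => exact ⟨fun _ hj => absurd hj (Nat.not_lt_zero _), A, h, fun i t => by simp⟩
  | succ n ih =>
    obtain ⟨h0, A₁, hA, h1⟩ := h
    obtain ⟨hs, R, hR, hAR⟩ := ih h1
    refine ⟨fun j hj => ?_, R, hR, fun i t => ?_⟩
    · cases j with
      | zero => exact h0
      | succ j => exact hs j (by omega)
    · rw [hA, hAR, Finset.sum_range_succ', smul_add, Finset.smul_sum]
      simp only [smul_smul, pow_succ', pow_zero, one_smul]
      abel

theorem add {A B : ι → ℝ → E} {a b : ℕ → ℝ → E} (hA : Expands e Z n A a)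
    (hB : Expands e Z n B b) :
    Expands e Z n (fun i t => A i t + B i t) fun j t => a j t + b j t := by
  induction n generalizing A B a b with
  | zero => exact UnifSymbol.add hA hB
  | succ n ih =>
    obtain ⟨ha, A₁, hA, hA₁⟩ := hA
    obtain ⟨hb, B₁, hB, hB₁⟩ := hB
    refine ⟨ha.add hb, _, fun i t => ?_, ih hA₁ hB₁⟩
    simp only [hA, hB, smul_add]
    abel

theorem clm {A : ι → ℝ → E} {a : ℕ → ℝ → E} (L : E →L[ℝ] F) (hA : Expands e Z n A a) :
    Expands e Z n (fun i t => L (A i t)) fun j t => L (a j t) := by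
  induction n generalizing A a with
  | zero => exact UnifSymbol.clm L hA
  | succ n ih =>
    obtain ⟨ha, A₁, hA, hA₁⟩ := hA
    refine ⟨ha.clm L, _, fun i t => ?_, ih hA₁⟩
    simp only [hA, map_add, map_smul]

theorem symbol {A : ℝ → E} (hA : UnifSymbol Z fun _ : ι => A) :
    Expands e Z n (fun _ => A) fun j t => if j = 0 then A t else 0 := by
  induction n generalizing A with
  | zero => exact hA
  | succ n ih =>
    refine ⟨by simpa using hA, fun _ _ => 0, fun i t => by simp, ?_⟩
    have := ih (A := fun _ => 0) (UnifSymbol.const 0)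
    simpa using this

theorem deriv (he : IsSmallParameter e) {A : ι → ℝ → E} {a : ℕ → ℝ → E}
    (hA : Expands e Z n A a) :
    Expands e Z n (fun i => deriv (A i)) fun j => deriv (a j) := by
  induction n generalizing A a with
  | zero => exact UnifSymbol.deriv hA
  | succ n ih =>
    obtain ⟨ha, A₁, hA, hA₁⟩ := hA
    refine ⟨ha.deriv, _, fun i t => ?_, ih hA₁⟩
    beta_reduce
    rw [show A i = fun t => a 0 t + e i • A₁ i t from funext (hA i)]
    exact ((ha.hasDerivAt i t).add
      (((hA₁.unifSymbol he).hasDerivAt i t).const_smul (e i))).deriv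

theorem smul_param {A : ι → ℝ → E} {a : ℕ → ℝ → E} (hA : Expands e Z n A a) :
    Expands e Z (n + 1) (fun i t => e i • A i t)
      fun j t => match j with
        | 0 => 0
        | j + 1 => a j t :=
  ⟨UnifSymbol.const 0, A, fun i t => by simp, hA⟩

/-- Errors of order `e^n` are absorbed by the remainder and leave the first `n` coefficients
unchanged. -/
theorem add_pow_smul {A D : ι → ℝ → E} {a : ℕ → ℝ → E} (hA : Expands e Z n A a)
    (hD : UnifSymbol Z D) : Expands e Z n (fun i t => A i t + e i ^ n • D i t) a := by
  induction n generalizing A a with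
  | zero => simpa [Expands] using UnifSymbol.add hA hD
  | succ n ih =>
    obtain ⟨ha, A₁, hA, hA₁⟩ := hA
    refine ⟨ha, _, fun i t => ?_, ih hA₁⟩
    simp only [hA, smul_add, smul_smul, pow_succ', add_assoc]

theorem of_remainder (he : IsSmallParameter e) {A : ι → ℝ → E} {a : ℕ → ℝ → E}
    (ha : ∀ j, UnifSymbol Z fun _ : ι => a j)
    (hR : ∀ m, UnifSymbol Z fun i t =>
      (e i ^ m)⁻¹ • (A i t - ∑ j ∈ Finset.range m, e i ^ j • a j t)) (n : ℕ) :
    Expands e Z n A a := by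
  -- The recursion passes to tails, so the claim is generalized to all rescaled remainders: the
  -- `m`-th one expands with the coefficients shifted by `m`.
  have key : ∀ n m, Expands e Z n (fun i t =>
      (e i ^ m)⁻¹ • (A i t - ∑ j ∈ Finset.range m, e i ^ j • a j t)) fun j => a (m + j) := by
    intro n
    induction n with
    | zero => exact hR
    | succ n ih =>
      intro m
      refine ⟨ha m, fun i t =>
        (e i ^ (m + 1))⁻¹ • (A i t - ∑ j ∈ Finset.range (m + 1), e i ^ j • a j t),
        fun i t => ?_, ?_⟩
      · have h := (he.pos i).ne'
        have h1 : e i * (e i ^ (m + 1))⁻¹ = (e i ^ m)⁻¹ := by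
          rw [pow_succ', mul_inv, mul_inv_cancel_left₀ h]
        rw [smul_smul, h1, Finset.sum_range_succ, ← sub_sub, smul_sub,
          smul_smul, inv_mul_cancel₀ (pow_ne_zero m h), one_smul]
        simp
      · have := ih (m + 1)
        simp only [add_assoc, add_comm 1] at this
        exact this
  simpa using key n 0

/-- The tail is determined by `A` and `a 0` because `e i ≠ 0`, so one and the same tail serves the
expansions of all orders. -/
theorem exists_tail (he : IsSmallParameter e) {A : ι → ℝ → E} {a : ℕ → ℝ → E}
    (h : ∀ n, Expands e Z n A a) : ∃ A₁ : ι → ℝ → E,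
      (∀ i t, A i t = a 0 t + e i • A₁ i t) ∧ ∀ n, Expands e Z n A₁ fun j => a (j + 1) := by
  obtain ⟨-, A₁, hA₁, -⟩ := h 1
  refine ⟨A₁, hA₁, fun n => ?_⟩
  obtain ⟨-, B₁, hB₁, hn⟩ := h (n + 1)
  obtain rfl : A₁ = B₁ := by
    funext i t
    have := (hA₁ i t).symm.trans (hB₁ i t)
    rw [add_right_inj] at this
    exact smul_right_injective E (he.pos i).ne' this
  exact hn

section Ring

variable {R : Type*} [NormedRing R] [NormedAlgebra ℝ R]

theorem symbol_mul {c : ℝ → R} (hc : UnifSymbol Z fun _ : ι => c) {A : ι → ℝ → R}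
    {a : ℕ → ℝ → R} (hA : Expands e Z n A a) :
    Expands e Z n (fun i t => c t * A i t) fun j t => c t * a j t := by
  induction n generalizing A a with
  | zero => exact UnifSymbol.mul hc hA
  | succ n ih =>
    obtain ⟨ha, A₁, hA, hA₁⟩ := hA
    refine ⟨hc.mul ha, _, fun i t => ?_, ih hA₁⟩
    simp only [hA, mul_add, mul_smul_comm]

theorem mul (he : IsSmallParameter e) {A B : ι → ℝ → R} {a b : ℕ → ℝ → R}
    (hA : Expands e Z n A a) (hB : Expands e Z n B b) :
    Expands e Z n (fun i t => A i t * B i t)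
      fun j t => ∑ p ∈ Finset.HasAntidiagonal.antidiagonal j, a p.1 t * b p.2 t := by
  induction n generalizing A B a b with
  | zero => exact UnifSymbol.mul hA hB
  | succ n ih =>
    have hB' := hB.pred he
    obtain ⟨ha, A₁, hA, hA₁⟩ := hA
    obtain ⟨hb, B₁, hB, hB₁⟩ := hB
    -- The splitting is `A B = a₀ b₀ + e (A₁ B + a₀ B₁)`: the tail needs `B` only to order `n`.
    refine ⟨by simpa using ha.mul hb, _, fun i t => ?_,
      ((ih hA₁ hB').add (symbol_mul ha hB₁)).congr_coeff fun j _ => ?_⟩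
    · simp only [Finset.Nat.antidiagonal_zero, Finset.sum_singleton]
      rw [smul_add, ← mul_smul_comm (e i) (a 0 t), ← smul_mul_assoc, add_left_comm, ← mul_add,
        ← hB, hA, add_mul, add_comm]
    · funext t
      exact (add_comm _ _).trans (Finset.Nat.sum_antidiagonal_succ (f := fun p => a p.1 t * b p.2 t)).symm

theorem star [StarRing R] [NormedStarGroup R] [StarModule ℝ R] {A : ι → ℝ → R} {a : ℕ → ℝ → R}
    (hA : Expands e Z n A a) : Expands e Z n (fun i t => star (A i t)) fun j t => star (a j t) :=
  hA.clm ((starL' ℝ : R ≃L[ℝ] R) : R →L[ℝ] R)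

end Ring

end Expands

/-- Coefficients of finite expansions of all orders are coherent. -/
theorem exists_expands_of_forall (he : IsSmallParameter e) {A : ι → ℝ → E}
    (h : ∀ n, ∃ a, Expands e Z n A a) : ∃ a, ∀ n, Expands e Z n A a := by
  choose c hc using h
  refine ⟨fun j => c (j + 1) j, fun n => (hc n).congr_coeff fun j hj => ?_⟩
  exact ((hc n).mono he (Nat.succ_le_of_lt hj)).unique he (hc (j + 1)) j j.lt_succ_self

/-- Semiclassical symbols, with coefficients left implicit. -/
def IsExpandable (e : ι → ℝ) (Z : Set ℝ) (A : ι → ℝ → E) : Prop := ∀ n, ∃ a, Expands e Z n A a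

namespace IsExpandable

theorem unifSymbol {A : ι → ℝ → E} (hA : IsExpandable e Z A) : UnifSymbol Z A :=
  (hA 0).choose_spec

theorem of_symbol {A : ℝ → E} (hA : UnifSymbol Z fun _ : ι => A) :
    IsExpandable e Z fun _ : ι => A := fun _ => ⟨_, Expands.symbol hA⟩

theorem add {A B : ι → ℝ → E} (hA : IsExpandable e Z A) (hB : IsExpandable e Z B) :
    IsExpandable e Z fun i t => A i t + B i t := fun n =>
  ⟨_, (hA n).choose_spec.add (hB n).choose_spec⟩

theorem clm {A : ι → ℝ → E} (L : E →L[ℝ] F) (hA : IsExpandable e Z A) :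
    IsExpandable e Z fun i t => L (A i t) := fun n => ⟨_, (hA n).choose_spec.clm L⟩

theorem const_smul {A : ι → ℝ → E} (c : ℝ) (hA : IsExpandable e Z A) :
    IsExpandable e Z fun i t => c • A i t := hA.clm (c • ContinuousLinearMap.id ℝ E)

theorem neg {A : ι → ℝ → E} (hA : IsExpandable e Z A) : IsExpandable e Z fun i t => -A i t := by
  simpa using hA.const_smul (-1)

theorem sub {A B : ι → ℝ → E} (hA : IsExpandable e Z A) (hB : IsExpandable e Z B) :
    IsExpandable e Z fun i t => A i t - B i t := by
  simpa only [sub_eq_add_neg] using hA.add hB.neg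

theorem deriv (he : IsSmallParameter e) {A : ι → ℝ → E} (hA : IsExpandable e Z A) :
    IsExpandable e Z fun i => deriv (A i) := fun n => ⟨_, (hA n).choose_spec.deriv he⟩

theorem smul_param (he : IsSmallParameter e) {A : ι → ℝ → E} (hA : IsExpandable e Z A) :
    IsExpandable e Z fun i t => e i • A i t := fun n =>
  ⟨_, ((hA n).choose_spec.smul_param).pred he⟩

theorem smul_param_pow (he : IsSmallParameter e) {A : ι → ℝ → E} (hA : IsExpandable e Z A)
    (m : ℕ) : IsExpandable e Z fun i t => e i ^ m • A i t := by
  induction m with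
  | zero => simpa using hA
  | succ m ih => simpa only [pow_succ', mul_smul] using ih.smul_param he

theorem mul {R : Type*} [NormedRing R] [NormedAlgebra ℝ R] (he : IsSmallParameter e)
    {A B : ι → ℝ → R} (hA : IsExpandable e Z A) (hB : IsExpandable e Z B) :
    IsExpandable e Z fun i t => A i t * B i t := fun n =>
  ⟨_, (hA n).choose_spec.mul he (hB n).choose_spec⟩

theorem star {R : Type*} [NormedRing R] [NormedAlgebra ℝ R] [StarRing R] [NormedStarGroup R]
    [StarModule ℝ R] {A : ι → ℝ → R} (hA : IsExpandable e Z A) :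
    IsExpandable e Z fun i t => star (A i t) := fun n => ⟨_, (hA n).choose_spec.star⟩

/-- The first two terms of an expansion. -/
theorem exists_eq_add_smul (he : IsSmallParameter e) {A : ι → ℝ → E} (hA : IsExpandable e Z A) :
    ∃ (a : ℝ → E) (A₁ : ι → ℝ → E), UnifSymbol Z (fun _ : ι => a) ∧ IsExpandable e Z A₁ ∧
      ∀ i t, A i t = a t + e i • A₁ i t := by
  obtain ⟨a, ha⟩ := exists_expands_of_forall he hA
  obtain ⟨A₁, hA₁, h⟩ := Expands.exists_tail he ha
  exact ⟨a 0, A₁, (ha 1).1, fun n => ⟨_, h n⟩, hA₁⟩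

/-- If `A = c + e B A` with symbols `c` and `B`, and `A` is a uniform symbol, then `A` has an
expansion to all orders. -/
theorem of_eq_add_smul_mul {R : Type*} [NormedRing R] [NormedAlgebra ℝ R]
    (he : IsSmallParameter e) {A B : ι → ℝ → R} {c : ℝ → R} (hA : UnifSymbol Z A)
    (hc : UnifSymbol Z fun _ : ι => c) (hB : IsExpandable e Z B)
    (h : ∀ i t, A i t = c t + e i • (B i t * A i t)) : IsExpandable e Z A := by
  intro n
  induction n with
  | zero => exact ⟨fun _ _ => 0, hA⟩
  | succ n ih =>
    obtain ⟨b, hb⟩ := hB n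
    obtain ⟨a, ha⟩ := ih
    exact ⟨fun j => Nat.casesOn j c fun j t =>
      ∑ p ∈ Finset.HasAntidiagonal.antidiagonal j, b p.1 t * a p.2 t, hc, _, h, hb.mul he ha⟩

/-- Borel type criterion: a family that is approximated to all orders by expandable families is
expandable. -/
theorem of_approx {A : ι → ℝ → E} (h : ∀ n, ∃ B D : ι → ℝ → E, IsExpandable e Z B ∧
    UnifSymbol Z D ∧ ∀ i t, A i t = B i t + e i ^ n • D i t) : IsExpandable e Z A := by
  intro n
  obtain ⟨B, D, hB, hD, hA⟩ := h n
  obtain ⟨b, hb⟩ := hB n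
  obtain rfl : A = fun i t => B i t + e i ^ n • D i t := funext₂ hA
  exact ⟨b, hb.add_pow_smul hD⟩

end IsExpandable

end Expansions

/-! ### Borel summation -/

section Borel

variable {ι : Type*} {E : Type*} [NormedAddCommGroup E] [NormedSpace ℝ E] {Z : Set ℝ} {e : ι → ℝ}

/-- In the telescoping sum from `m` to `n` the first increment has order `e^(m+1)`; the later ones
carry additional powers of `e`, which are bounded. -/
theorem UnifSymbol.telescope (he : IsSmallParameter e) {F : ℕ → ι → ℝ → E}
    (hF : ∀ m, ∃ Y : ι → ℝ → E, UnifSymbol Z Y ∧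
      ∀ i t, F (m + 1) i t = F m i t + e i ^ (m + 1) • Y i t) {m n : ℕ} (hmn : m ≤ n) :
    ∃ D : ι → ℝ → E, UnifSymbol Z D ∧ ∀ i t, F n i t = F m i t + e i ^ (m + 1) • D i t := by
  induction n, hmn using Nat.le_induction with
  | base => exact ⟨fun _ _ => 0, UnifSymbol.const 0, fun i t => by simp⟩
  | succ n hmn ih =>
    obtain ⟨D, hD, h⟩ := ih
    obtain ⟨Y, hY, h'⟩ := hF n
    refine ⟨_, hD.add (hY.smul_family (fun i => e i ^ (n - m)) (he.pow_bdd _)), fun i t => ?_⟩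
    rw [h', h, smul_add, smul_smul, ← pow_add, show m + 1 + (n - m) = n + 1 by omega, add_assoc]

/-- **Borel's lemma** for a sequence of uniform symbols: choosing the index of the sequence as a
suitable function of the small parameter, one obtains a family that is asymptotic to all members
of the sequence. -/
theorem exists_borel_index (he : IsSmallParameter e) {F : ℕ → ι → ℝ → E}
    (hs : ∀ m, UnifSymbol Z (F m))
    (hF : ∀ m, ∃ Y : ι → ℝ → E, UnifSymbol Z Y ∧
      ∀ i t, F (m + 1) i t = F m i t + e i ^ (m + 1) • Y i t) :
    ∃ N : ι → ℕ, ∀ m, ∃ D : ι → ℝ → E, UnifSymbol Z D ∧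
      ∀ i t, F (N i) i t = F m i t + e i ^ m • D i t := by
  classical
  have tel : ∀ m n, ∃ D : ι → ℝ → E, UnifSymbol Z D ∧
      (m ≤ n → ∀ i t, F n i t = F m i t + e i ^ (m + 1) • D i t) := fun m n => by
    by_cases hmn : m ≤ n
    · obtain ⟨D, hD, h⟩ := UnifSymbol.telescope he hF hmn
      exact ⟨D, hD, fun _ => h⟩
    · exact ⟨fun _ _ => 0, UnifSymbol.const 0, fun h => absurd h hmn⟩
  choose D hD hFD using tel
  choose C hC0 hC using fun m n k => (hD m n).iteratedDeriv_bdd k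
  -- The index `n` is admissible at `i` if the small factor `e i` compensates all constants in the
  -- comparison of `F n` with earlier members, for derivatives up to order `n`. `N i` is the largest
  -- admissible index up to `1 / e i`; zero is admissible vacuously.
  let Good : ι → ℕ → Prop := fun i n => ∀ m < n, ∀ k ≤ n, C m n k * e i ≤ 1
  let N : ι → ℕ := fun i => Nat.findGreatest (Good i) ⌊(e i)⁻¹⌋₊
  have hN : ∀ i, Good i (N i) := fun i =>
    Nat.findGreatest_spec (P := Good i) (Nat.zero_le _) fun m hm => absurd hm (Nat.not_lt_zero m)
  -- The index `N i` grows without bound as `e i → 0`: a given `L` is admissible once `e i` is below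
  -- the reciprocal of a finite sum of constants.
  have hlarge : ∀ L : ℕ, ∃ δ > 0, ∀ i, e i < δ → L ≤ N i := by
    intro L
    set S : ℝ := ∑ m ∈ Finset.range L, ∑ k ∈ Finset.range (L + 1), C m L k with hS
    have hS0 : 0 ≤ S := Finset.sum_nonneg fun m _ => Finset.sum_nonneg fun k _ => hC0 m L k
    refine ⟨(S + L + 1)⁻¹, by positivity, fun i hi => ?_⟩
    have hi' : S + L + 1 < (e i)⁻¹ := (lt_inv_comm₀ (he.pos i) (by positivity)).1 hi
    refine Nat.le_findGreatest (Nat.le_floor (by linarith)) fun m hm k hk => ?_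
    have h1 : C m L k ≤ S :=
      (Finset.single_le_sum (f := fun k => C m L k) (fun k _ => hC0 m L k)
        (Finset.mem_range.2 (Nat.lt_succ_of_le hk))).trans
      (Finset.single_le_sum (f := fun m => ∑ k ∈ Finset.range (L + 1), C m L k)
        (fun m _ => Finset.sum_nonneg fun k _ => hC0 m L k) (Finset.mem_range.2 hm))
    rw [← le_div_iff₀ (he.pos i), one_div]
    have : (0 : ℝ) ≤ L := Nat.cast_nonneg L
    linarith
  refine ⟨N, fun m => ⟨fun i t => (e i ^ m)⁻¹ • (F (N i) i t - F m i t), ?_, fun i t => ?_⟩⟩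
  swap
  · rw [smul_smul, mul_inv_cancel₀ (pow_ne_zero m (he.pos i).ne'), one_smul, add_sub_cancel]
  have hcd : ∀ i, ContDiff ℝ ∞ fun t => F (N i) i t - F m i t := fun i =>
    ((hs (N i)).contDiff i).sub ((hs m).contDiff i)
  have hit : ∀ i k t, iteratedDeriv k (fun t => (e i ^ m)⁻¹ • (F (N i) i t - F m i t)) t =
      (e i ^ m)⁻¹ • (iteratedDeriv k (F (N i) i) t - iteratedDeriv k (F m i) t) := by
    intro i k t
    rw [iteratedDeriv_fun_const_smul_field, iteratedDeriv_fun_sub]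
    · exact (((hs (N i)).contDiff i).of_le (by exact_mod_cast le_top)).contDiffAt
    · exact (((hs m).contDiff i).of_le (by exact_mod_cast le_top)).contDiffAt
  refine unifCb_of_iteratedDeriv (fun i => (hcd i).const_smul _) (fun k => ?_) fun i t ht k hk => ?_
  swap
  · rw [hit, (hs (N i)).iteratedDeriv_eq_zero i ht hk, (hs m).iteratedDeriv_eq_zero i ht hk,
      sub_zero, smul_zero]
  obtain ⟨δ, hδ, hlarge⟩ := hlarge (max m k + 1)
  choose B hB0 hB using fun n => (hs n).iteratedDeriv_bdd k
  set T : ℝ := ∑ n ∈ Finset.range (max m k + 1), B n with hT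
  have hT0 : 0 ≤ T := Finset.sum_nonneg fun n _ => hB0 n
  refine ⟨max 1 ((δ ^ m)⁻¹ * (T + B m)), fun i t => ?_⟩
  have hem : 0 < e i ^ m := pow_pos (he.pos i) m
  -- If `N i` is large, the spare factor `e i` in `e^(m+1)` and admissibility bound the quotient by
  -- one. Otherwise `e i ≥ δ`, and only finitely many members of the sequence occur.
  by_cases hi : max m k + 1 ≤ N i
  · refine le_max_of_le_left ?_
    have hm : m < N i := by omega
    have hk : k ≤ N i := by omega
    have h1 : (fun t => (e i ^ m)⁻¹ • (F (N i) i t - F m i t)) = fun t => e i • D m (N i) i t := by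
      funext t
      rw [hFD m (N i) hm.le, add_sub_cancel_left, smul_smul, pow_succ,
        inv_mul_cancel_left₀ hem.ne']
    rw [h1, iteratedDeriv_fun_const_smul_field, norm_smul, Real.norm_eq_abs,
      abs_of_pos (he.pos i), mul_comm]
    exact (mul_le_mul_of_nonneg_right (hC m (N i) k i t) (he.pos i).le).trans (hN i m hm k hk)
  · refine le_max_of_le_right ?_
    have hδi : δ ≤ e i := not_lt.1 fun h => hi (hlarge i h)
    rw [hit, norm_smul, norm_inv, Real.norm_of_nonneg hem.le]
    refine mul_le_mul (inv_anti₀ (by positivity) (pow_le_pow_left₀ hδ.le hδi m))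
      ((norm_sub_le _ _).trans (add_le_add ((hB (N i) i t).trans ?_) (hB m i t)))
      (norm_nonneg _) (by positivity)
    exact Finset.single_le_sum (f := B) (fun n _ => hB0 n) (Finset.mem_range.2 (by omega))

end Borel

/-! ### The Sylvester equation across a gap -/

section Sylvester

variable {𝔸 : Type*} [CStarAlgebra 𝔸]

/-- The part of `x` that is diagonal with respect to the projection `p`, as an operator. -/
noncomputable def diagOp (p : 𝔸) : 𝔸 →L[ℝ] 𝔸 :=
  ContinuousLinearMap.mul ℝ 𝔸 p * (ContinuousLinearMap.mul ℝ 𝔸).flip p +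
    ContinuousLinearMap.mul ℝ 𝔸 (1 - p) * (ContinuousLinearMap.mul ℝ 𝔸).flip (1 - p)

/-- The part of `x` that is off-diagonal with respect to the projection `p`, as an operator. -/
noncomputable def offDiagOp (p : 𝔸) : 𝔸 →L[ℝ] 𝔸 :=
  ContinuousLinearMap.mul ℝ 𝔸 p * (ContinuousLinearMap.mul ℝ 𝔸).flip (1 - p) +
    ContinuousLinearMap.mul ℝ 𝔸 (1 - p) * (ContinuousLinearMap.mul ℝ 𝔸).flip p

/-- The commutator with `h` on off-diagonal elements, and the identity on diagonal ones. -/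
noncomputable def sylvesterOp (h p : 𝔸) : 𝔸 →L[ℝ] 𝔸 :=
  (ContinuousLinearMap.mul ℝ 𝔸 h - (ContinuousLinearMap.mul ℝ 𝔸).flip h) * offDiagOp p + diagOp p

theorem diagOp_apply (p x : 𝔸) : diagOp p x = p * (x * p) + (1 - p) * (x * (1 - p)) := rfl

theorem offDiagOp_apply (p x : 𝔸) : offDiagOp p x = p * (x * (1 - p)) + (1 - p) * (x * p) := rfl

theorem sylvesterOp_apply (h p x : 𝔸) :
    sylvesterOp h p x = h * offDiagOp p x - offDiagOp p x * h + diagOp p x := rfl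

theorem diagOp_add_offDiagOp (p x : 𝔸) : diagOp p x + offDiagOp p x = x := by
  rw [diagOp_apply, offDiagOp_apply]
  noncomm_ring

/-- The part of `h₁` in the range of `p₁` is separated by a gap of size `g` from the part of `h₂`
in the range of `1 - p₂`: the former lies in a ball around some point `c`, the latter outside of a
ball whose radius is larger by `g`. -/
def GapBound (g : ℝ) (h₁ p₁ h₂ p₂ : 𝔸) : Prop :=
  ∃ (c r : ℝ) (b : 𝔸), 0 ≤ r ∧ ‖(h₁ - algebraMap ℝ 𝔸 c) * p₁‖ ≤ r ∧
    (h₂ - algebraMap ℝ 𝔸 c) * b = 1 - p₂ ∧ b * (h₂ - algebraMap ℝ 𝔸 c) = 1 - p₂ ∧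
    b * (1 - p₂) = b ∧ (1 - p₂) * b = b ∧ ‖b‖ ≤ (r + g)⁻¹

/-- With `a = (h₁ - c) p₁` and `y = h₁ x - x h₂` one has `x = (a x - y) b`, hence `‖x‖ ≤ (r ‖x‖ +
‖y‖) / (r + g)`, which is solved for `‖x‖`. -/
theorem GapBound.norm_le {g : ℝ} (hg : 0 < g) {h₁ p₁ h₂ p₂ x : 𝔸}
    (hgap : GapBound g h₁ p₁ h₂ p₂) (hx₁ : p₁ * x = x) (hx₂ : x * (1 - p₂) = x) :
    ‖x‖ ≤ g⁻¹ * ‖h₁ * x - x * h₂‖ := by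
  obtain ⟨c, r, b, hr, ha, hb, -, -, -, hbn⟩ := hgap
  set a := (h₁ - algebraMap ℝ 𝔸 c) * p₁
  set y := h₁ * x - x * h₂
  have hy : y = a * x - x * (h₂ - algebraMap ℝ 𝔸 c) := by
    rw [mul_assoc, hx₁, sub_mul, mul_sub, Algebra.commutes c x, sub_sub_sub_cancel_right]
  have hx : x = (a * x - y) * b := by
    rw [hy, sub_sub_cancel, mul_assoc, hb, hx₂]
  have h1 : ‖x‖ ≤ (r * ‖x‖ + ‖y‖) * (r + g)⁻¹ := by
    calc ‖x‖ = ‖(a * x - y) * b‖ := by rw [← hx]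
      _ ≤ ‖a * x - y‖ * ‖b‖ := norm_mul_le _ _
      _ ≤ _ := by
        gcongr
        exact (norm_sub_le _ _).trans (add_le_add_left ((norm_mul_le _ _).trans
          (mul_le_mul_of_nonneg_right ha (norm_nonneg _))) _)
  rw [← div_eq_mul_inv, le_div_iff₀ (by positivity)] at h1
  rw [inv_mul_eq_div, le_div_iff₀ hg]
  linarith

/-- With `k = h - c` the equation reads `x = k x b - y b`. The map `x ↦ k p x b` has norm at most `r
/ (r + g) < 1`, so a Neumann series applies. -/
theorem GapBound.exists_solution {g : ℝ} (hg : 0 < g) {h p y : 𝔸} (hp : IsStarProjection p)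
    (hhp : Commute h p) (hgap : GapBound g h p h p) (hy₁ : p * y = y) (hy₂ : y * (1 - p) = y) :
    ∃ x : 𝔸, p * x = x ∧ x * (1 - p) = x ∧ h * x - x * h = y := by
  obtain ⟨c, r, b, hr, ha, hb₁, hb₂, hbp, hpb, hbn⟩ := hgap
  set k := h - algebraMap ℝ 𝔸 c with hk
  have hkp : k * p = p * k := ((Commute.sub_left hhp (Algebra.commutes c p)) : _)
  have hpp : p * p = p := hp.isIdempotentElem
  have hqq : (1 - p) * (1 - p) = 1 - p := hp.one_sub.isIdempotentElem
  set M : 𝔸 →L[ℝ] 𝔸 := ContinuousLinearMap.mul ℝ 𝔸 (k * p) * (ContinuousLinearMap.mul ℝ 𝔸).flip b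
    with hM
  have hMx : ∀ x, M x = k * p * (x * b) := fun _ => rfl
  have hMn : ‖M‖ < 1 := by
    have h1 : ‖M‖ ≤ r * (r + g)⁻¹ := by
      refine ContinuousLinearMap.opNorm_le_bound _ (by positivity) fun x => ?_
      rw [hMx]
      calc ‖k * p * (x * b)‖ ≤ ‖k * p‖ * (‖x‖ * ‖b‖) :=
            (norm_mul_le _ _).trans (mul_le_mul_of_nonneg_left (norm_mul_le _ _) (norm_nonneg _))
        _ ≤ r * (‖x‖ * (r + g)⁻¹) := by gcongr
        _ = _ := by ring
    refine h1.trans_lt ?_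
    rw [← div_eq_mul_inv, div_lt_one (by positivity)]
    linarith
  obtain ⟨u, hu⟩ := isUnit_one_sub_of_norm_lt_one hMn
  set z : 𝔸 := (↑u⁻¹ : 𝔸 →L[ℝ] 𝔸) (-(y * b)) with hz
  have hz' : z - k * p * (z * b) = -(y * b) := by
    have : (↑u : 𝔸 →L[ℝ] 𝔸) z = -(y * b) := by
      rw [hz, ← mul_apply_eq_comp, Units.mul_inv, one_apply_eq_self]
    rw [hu] at this
    exact this
  -- The Neumann solution need not lie in the corner `p · (1 - p)`; its compression does, and solves
  -- the same fixed point equation.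
  set x := p * z * (1 - p) with hx
  have hx₁ : p * x = x := by rw [hx, ← mul_assoc, ← mul_assoc, hpp]
  have hx₂ : x * (1 - p) = x := by rw [hx, mul_assoc, hqq]
  have hxe : x = k * x * b - y * b := by
    have h1 : p * (z - k * p * (z * b)) * (1 - p) = p * (-(y * b)) * (1 - p) := by rw [hz']
    have h2 : p * (k * p * (z * b)) * (1 - p) = k * x * b := by
      have e1 : p * (k * p * (z * b)) * (1 - p) = p * k * (p * z * (b * (1 - p))) := by noncomm_ring
      have e2 : k * x * b = k * (p * z * ((1 - p) * b)) := by rw [hx]; noncomm_ring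
      rw [e1, e2, hbp, hpb, ← hkp, mul_assoc, ← mul_assoc p, ← mul_assoc p, hpp]
    have h3 : p * (-(y * b)) * (1 - p) = -(y * b) := by
      have : p * (-(y * b)) * (1 - p) = -(p * y * (b * (1 - p))) := by noncomm_ring
      rw [this, hy₁, hbp]
    rw [mul_sub p z, sub_mul _ _ (1 - p), h2, h3] at h1
    rw [← hx, sub_eq_iff_eq_add] at h1
    exact h1.trans (by abel)
  refine ⟨x, hx₁, hx₂, ?_⟩
  have h1 : x * k = k * x - y := by
    have : x * k = k * x * (b * k) - y * (b * k) := by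
      rw [← mul_assoc _ b, ← mul_assoc _ b, ← sub_mul _ _ k, ← hxe]
    rw [this, hb₂, hy₂, mul_assoc, hx₂]
  have h2 : h * x - x * h = k * x - x * k := by
    rw [hk, sub_mul, mul_sub, Algebra.commutes c x, sub_sub_sub_cancel_right]
  rw [h2, h1, sub_sub_cancel]

theorem norm_mul_mul_le {p q : 𝔸} (hp : ‖p‖ ≤ 1) (hq : ‖q‖ ≤ 1) (x : 𝔸) : ‖p * (x * q)‖ ≤ ‖x‖ := by
  calc ‖p * (x * q)‖ ≤ ‖p‖ * (‖x‖ * ‖q‖) :=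
        (norm_mul_le _ _).trans (mul_le_mul_of_nonneg_left (norm_mul_le _ _) (norm_nonneg _))
    _ ≤ 1 * (‖x‖ * 1) := by gcongr
    _ = ‖x‖ := by ring

section Compressions

variable {h p q x y : 𝔸}

theorem sylvester_identities (hpq : p + q = 1) (hp : p * p = p) (hhp : Commute h p) :
    (∀ z, p * (p * z) = p * z) ∧ (∀ z, p * (q * z) = 0) ∧ (∀ z, q * (p * z) = 0) ∧
      (∀ z, q * (q * z) = q * z) ∧ q * q = q ∧ p * q = 0 ∧ q * p = 0 ∧
      h * p = p * h ∧ h * q = q * h ∧ (∀ z, h * (p * z) = p * (h * z)) ∧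
      ∀ z, h * (q * z) = q * (h * z) := by
  obtain rfl : q = 1 - p := by rw [← hpq, add_sub_cancel_left]
  have h1 : h * p = p * h := hhp
  have h2 : h * (1 - p) = (1 - p) * h := by rw [mul_sub, sub_mul, h1, mul_one, one_mul]
  have h3 : p * (1 - p) = 0 := by rw [mul_sub, hp, mul_one, sub_self]
  have h4 : (1 - p) * p = 0 := by rw [sub_mul, hp, one_mul, sub_self]
  have h5 : (1 - p) * (1 - p) = 1 - p := by rw [mul_sub, h4, mul_one, sub_zero]
  simp only [← mul_assoc, hp, h1, h2, h3, h4, h5, zero_mul, implies_true, and_self]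

variable (hp : p * p = p) (hhp : Commute h p)
include hp hhp

/-- Since `h` commutes with `p`, the operator respects the four blocks defined by `p`; the bound and
the surjectivity can therefore be checked block by block. -/
theorem sylvesterOp_compress (x : 𝔸) :
    diagOp p (sylvesterOp h p x) = diagOp p x ∧
    p * (sylvesterOp h p x * (1 - p)) = h * (p * (x * (1 - p))) - p * (x * (1 - p)) * h ∧
    (1 - p) * (sylvesterOp h p x * p) = h * ((1 - p) * (x * p)) - (1 - p) * (x * p) * h ∧
    offDiagOp p (h * x - x * h) = h * offDiagOp p x - offDiagOp p x * h := by
  obtain ⟨e1, e2, e3, e4, e5, e6, e7, e8, e9, e10, e11⟩ :=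
    sylvester_identities (add_sub_cancel p 1) hp hhp
  simp only [sylvesterOp_apply, diagOp_apply, offDiagOp_apply]
  generalize 1 - p = q at *
  refine ⟨?_, ?_, ?_, ?_⟩ <;>
  simp only [mul_add, add_mul, mul_sub, sub_mul, mul_assoc, e1, e2, e3, e4, e5, e6, e7, e8, e9,
    e10, e11, hp, mul_zero, add_zero, zero_add, sub_self]
  abel

theorem sylvesterOp_of_compress {y v w : 𝔸}
    (hv : h * (p * (v * (1 - p))) - p * (v * (1 - p)) * h = p * (y * (1 - p)))
    (hw : h * ((1 - p) * (w * p)) - (1 - p) * (w * p) * h = (1 - p) * (y * p)) :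
    sylvesterOp h p (diagOp p y + p * (v * (1 - p)) + (1 - p) * (w * p)) = y := by
  obtain ⟨e1, e2, e3, e4, e5, e6, e7, e8, e9, e10, e11⟩ :=
    sylvester_identities (add_sub_cancel p 1) hp hhp
  have hy := diagOp_add_offDiagOp p y
  rw [offDiagOp_apply, ← hv, ← hw] at hy
  refine Eq.trans ?_ hy
  simp only [sylvesterOp_apply, diagOp_apply, offDiagOp_apply]
  generalize 1 - p = q at *
  simp only [mul_add, add_mul, mul_assoc, e1, e2, e3, e4, e5, e6, e7, e10, e11, hp, mul_zero,
    add_zero, zero_add]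
  abel

end Compressions

variable {g : ℝ} {h p : 𝔸}

theorem norm_le_of_sylvesterOp (hg : 0 < g) (hh : IsSelfAdjoint h) (hp : IsStarProjection p)
    (hhp : Commute h p) (hgap : GapBound g h p h p) (x : 𝔸) :
    ‖x‖ ≤ (2 + 2 * g⁻¹) * ‖sylvesterOp h p x‖ := by
  have hpp : p * p = p := hp.isIdempotentElem
  have hqq : (1 - p) * (1 - p) = 1 - p := hp.one_sub.isIdempotentElem
  obtain ⟨h1, h2, h3, -⟩ := sylvesterOp_compress hpp hhp x
  set y := sylvesterOp h p x
  have hpn := hp.norm_le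
  have hqn := hp.one_sub.norm_le
  have b1 : ‖diagOp p x‖ ≤ 2 * ‖y‖ := by
    rw [← h1, diagOp_apply, two_mul]
    exact (norm_add_le _ _).trans (add_le_add (norm_mul_mul_le hpn hpn y)
      (norm_mul_mul_le hqn hqn y))
  have b2 : ‖p * (x * (1 - p))‖ ≤ g⁻¹ * ‖y‖ := by
    refine (hgap.norm_le hg (by rw [← mul_assoc, hpp]) (by
      rw [mul_assoc, mul_assoc, hqq])).trans ?_
    rw [← h2]
    gcongr
    exact norm_mul_mul_le hpn hqn y
  -- The adjoint exchanges the two off-diagonal corners, so the one-sided gap bound covers this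
  -- corner as well.
  have b3 : ‖(1 - p) * (x * p)‖ ≤ g⁻¹ * ‖y‖ := by
    have hs : star ((1 - p) * (x * p)) = p * (star x * (1 - p)) := by
      rw [star_mul, star_mul, hp.isSelfAdjoint.star_eq, hp.one_sub.isSelfAdjoint.star_eq, mul_assoc]
    have hn : ‖h * star ((1 - p) * (x * p)) - star ((1 - p) * (x * p)) * h‖ =
        ‖h * ((1 - p) * (x * p)) - (1 - p) * (x * p) * h‖ := by
      rw [← norm_star (h * ((1 - p) * (x * p)) - _), star_sub, star_mul h, star_mul _ h,
        hh.star_eq, norm_sub_rev]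
    rw [← norm_star]
    refine (hgap.norm_le hg (by rw [hs, ← mul_assoc, hpp]) (by
      rw [hs, mul_assoc, mul_assoc, hqq])).trans ?_
    rw [hn, ← h3]
    gcongr
    exact norm_mul_mul_le hqn hpn y
  calc ‖x‖ = ‖diagOp p x + (p * (x * (1 - p)) + (1 - p) * (x * p))‖ := by
        rw [← offDiagOp_apply, diagOp_add_offDiagOp]
    _ ≤ 2 * ‖y‖ + (g⁻¹ * ‖y‖ + g⁻¹ * ‖y‖) :=
        (norm_add_le _ _).trans (add_le_add b1 ((norm_add_le _ _).trans (add_le_add b2 b3)))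
    _ = _ := by ring

theorem sylvesterOp_surjective (hg : 0 < g) (hh : IsSelfAdjoint h) (hp : IsStarProjection p)
    (hhp : Commute h p) (hgap : GapBound g h p h p) : Function.Surjective (sylvesterOp h p) := by
  intro y
  have hpp : p * p = p := hp.isIdempotentElem
  have hqq : (1 - p) * (1 - p) = 1 - p := hp.one_sub.isIdempotentElem
  obtain ⟨v, hv₁, hv₂, hv⟩ := hgap.exists_solution hg hp hhp (y := p * (y * (1 - p)))
    (by rw [← mul_assoc, hpp]) (by rw [mul_assoc, mul_assoc, hqq])
  -- The other corner is solved for the adjoint right hand side. Taking adjoints reverses the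
  -- commutator, whence the sign in `-star w` below.
  obtain ⟨w, hw₁, hw₂, hw⟩ := hgap.exists_solution hg hp hhp (y := p * (star y * (1 - p)))
    (by rw [← mul_assoc, hpp]) (by rw [mul_assoc, mul_assoc, hqq])
  refine ⟨_, sylvesterOp_of_compress hpp hhp (v := v) (w := -star w) ?_ ?_⟩
  · rw [hv₂, hv₁, hv]
  · have hs : (1 - p) * (-star w * p) = -star w := by
      have := congrArg star hw₁
      rw [star_mul, hp.isSelfAdjoint.star_eq] at this
      have h2 := congrArg star hw₂
      rw [star_mul, hp.one_sub.isSelfAdjoint.star_eq] at h2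
      rw [neg_mul, this, mul_neg, h2]
    rw [hs]
    have := congrArg star hw
    rw [star_sub, star_mul, star_mul, star_mul, star_mul, star_star, hh.star_eq,
      hp.isSelfAdjoint.star_eq, hp.one_sub.isSelfAdjoint.star_eq, mul_assoc (1 - p) y p] at this
    rw [← this]
    noncomm_ring

theorem exists_sylvesterOp_inverse (hg : 0 < g) (hh : IsSelfAdjoint h) (hp : IsStarProjection p)
    (hhp : Commute h p) (hgap : GapBound g h p h p) :
    ∃ N : 𝔸 →L[ℝ] 𝔸, sylvesterOp h p * N = 1 ∧ N * sylvesterOp h p = 1 ∧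
      ‖N‖ ≤ 2 + 2 * g⁻¹ := by
  have hb := norm_le_of_sylvesterOp hg hh hp hhp hgap
  have hinj : Function.Injective (sylvesterOp h p) := by
    refine (injective_iff_map_eq_zero _).2 fun x hx => ?_
    have := hb x
    rw [hx, norm_zero, mul_zero] at this
    exact norm_le_zero_iff.1 this
  let f : 𝔸 ≃ₗ[ℝ] 𝔸 := LinearEquiv.ofBijective (sylvesterOp h p : 𝔸 →ₗ[ℝ] 𝔸)
    ⟨hinj, sylvesterOp_surjective hg hh hp hhp hgap⟩
  have hf : ∀ x, sylvesterOp h p (f.symm x) = x := fun x => f.apply_symm_apply x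
  have hN : ∀ x, ‖f.symm x‖ ≤ (2 + 2 * g⁻¹) * ‖x‖ := fun x => by
    have := hb (f.symm x)
    rwa [hf] at this
  refine ⟨f.symm.toLinearMap.mkContinuous _ hN, ?_, ?_, ?_⟩
  · ext x
    exact hf x
  · ext x
    exact f.symm_apply_apply x
  · exact LinearMap.mkContinuous_norm_le _ (by positivity) _

end Sylvester

/-! ### Regularity of projections separated by a gap -/

section GappedFamilies

variable {𝔸 : Type*} [CStarAlgebra 𝔸] {ι : Type*} {Z : Set ℝ} {n : ℕ}

theorem UnifCb.diagOp {p : ι → ℝ → 𝔸} (hp : UnifCb Z n p) :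
    UnifCb Z n fun i t => diagOp (p i t) := by
  have hq : UnifCb Z n fun i t => 1 - p i t := (UnifCb.const 1).sub hp
  exact ((hp.clm _).mul (hp.clm _)).add ((hq.clm _).mul (hq.clm _))

theorem UnifCb.offDiagOp {p : ι → ℝ → 𝔸} (hp : UnifCb Z n p) :
    UnifCb Z n fun i t => offDiagOp (p i t) := by
  have hq : UnifCb Z n fun i t => 1 - p i t := (UnifCb.const 1).sub hp
  exact ((hp.clm _).mul (hq.clm _)).add ((hq.clm _).mul (hp.clm _))

theorem UnifCb.sylvesterOp {h p : ι → ℝ → 𝔸} (hh : UnifCb Z n h) (hp : UnifCb Z n p) :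
    UnifCb Z n fun i t => sylvesterOp (h i t) (p i t) :=
  (((hh.clm _).sub (hh.clm _)).mul hp.offDiagOp).add hp.diagOp

theorem UnifCb.clm_apply {E F : Type*} [NormedAddCommGroup E] [NormedSpace ℝ E]
    [NormedAddCommGroup F] [NormedSpace ℝ F] {N : ι → ℝ → E →L[ℝ] F} {x : ι → ℝ → E}
    (hN : UnifCb Z n N) (hx : UnifCb Z n x) : UnifCb Z n fun i t => N i t (x i t) :=
  hN.bilin (ContinuousLinearMap.id ℝ (E →L[ℝ] F)) hx

/-- Projections `p t` commuting with self-adjoint `h t` such that the corresponding parts of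
`h` are separated by a gap, uniformly and locally across different times. -/
structure GappedFamily (Z : Set ℝ) (g : ℝ) (h p : ℝ → 𝔸) : Prop where
  pos : 0 < g
  symbol : UnifSymbol Z fun _ : Unit => h
  isSelfAdjoint : ∀ t, IsSelfAdjoint (h t)
  proj : ∀ t, IsStarProjection (p t)
  comm : ∀ t, Commute (h t) (p t)
  cross : ∀ s, ∀ᶠ t in 𝓝 s, GapBound g (h t) (p t) (h s) (p s) ∧ GapBound g (h s) (p s) (h t) (p t)

/-- The corner `x = p₁ (1 - p₂)` satisfies `h₁ x - x h₂ = p₁ (h₁ - h₂) (1 - p₂)`, which the gap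
bound turns into an estimate. The difference `p₁ - p₂` is made of two such corners, one of them
through its adjoint. -/
theorem norm_projection_sub_le {g : ℝ} (hg : 0 < g) {h₁ p₁ h₂ p₂ : 𝔸} (hp₁ : IsStarProjection p₁)
    (hp₂ : IsStarProjection p₂) (hc₁ : Commute h₁ p₁) (hc₂ : Commute h₂ p₂)
    (h₁₂ : GapBound g h₁ p₁ h₂ p₂) (h₂₁ : GapBound g h₂ p₂ h₁ p₁) :
    ‖p₁ - p₂‖ ≤ 2 * g⁻¹ * ‖h₁ - h₂‖ := by
  have key : ∀ {h₁ p₁ h₂ p₂ : 𝔸}, IsStarProjection p₁ → IsStarProjection p₂ → Commute h₁ p₁ →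
      Commute h₂ p₂ → GapBound g h₁ p₁ h₂ p₂ → ‖p₁ * (1 - p₂)‖ ≤ g⁻¹ * ‖h₁ - h₂‖ := by
    intro h₁ p₁ h₂ p₂ hp₁ hp₂ hc₁ hc₂ hgap
    have e1 : p₁ * p₁ = p₁ := hp₁.isIdempotentElem
    have e2 : (1 - p₂) * (1 - p₂) = 1 - p₂ := hp₂.one_sub.isIdempotentElem
    refine (hgap.norm_le hg (by rw [← mul_assoc, e1]) (by rw [mul_assoc, e2])).trans ?_
    have e3 : (1 - p₂) * h₂ = h₂ * (1 - p₂) := by rw [sub_mul, mul_sub, hc₂.eq, one_mul, mul_one]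
    have e4 : h₁ * (p₁ * (1 - p₂)) - p₁ * (1 - p₂) * h₂ = p₁ * ((h₁ - h₂) * (1 - p₂)) := by
      rw [mul_assoc, e3, ← mul_assoc, hc₁.eq, mul_assoc, ← mul_sub, ← sub_mul]
    rw [e4]
    have := hg.le
    gcongr
    exact norm_mul_mul_le hp₁.norm_le hp₂.one_sub.norm_le _
  have h1 := key hp₁ hp₂ hc₁ hc₂ h₁₂
  have h2 := key hp₂ hp₁ hc₂ hc₁ h₂₁
  have h3 : ‖(1 - p₁) * p₂‖ ≤ g⁻¹ * ‖h₁ - h₂‖ := by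
    rw [← norm_star, star_mul, hp₂.isSelfAdjoint.star_eq, hp₁.one_sub.isSelfAdjoint.star_eq,
      norm_sub_rev h₁]
    exact h2
  calc ‖p₁ - p₂‖ = ‖p₁ * (1 - p₂) - (1 - p₁) * p₂‖ := by congr 1; noncomm_ring
    _ ≤ g⁻¹ * ‖h₁ - h₂‖ + g⁻¹ * ‖h₁ - h₂‖ := (norm_sub_le _ _).trans (add_le_add h1 h3)
    _ = _ := by ring

namespace GappedFamily

variable {g : ℝ} {h p : ℝ → 𝔸} (hf : GappedFamily Z g h p)
include hf

theorem gap (t : ℝ) : GapBound g (h t) (p t) (h t) (p t) := (hf.cross t).self_of_nhds.1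

theorem exists_inverse : ∃ N : ℝ → 𝔸 →L[ℝ] 𝔸, (∀ t, sylvesterOp (h t) (p t) * N t = 1) ∧
    (∀ t, N t * sylvesterOp (h t) (p t) = 1) ∧ ∀ t, ‖N t‖ ≤ 2 + 2 * g⁻¹ := by
  choose N h1 h2 h3 using fun t => exists_sylvesterOp_inverse hf.pos (hf.isSelfAdjoint t)
    (hf.proj t) (hf.comm t) (hf.gap t)
  exact ⟨N, h1, h2, h3⟩

theorem lipschitz_h : ∃ C : ℝ, 0 ≤ C ∧ ∀ s t, ‖h t - h s‖ ≤ C * |t - s| := by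
  obtain ⟨C, hC0, hC⟩ := hf.symbol.deriv.bdd
  exact ⟨C, hC0, fun s t => Convex.norm_image_sub_le_of_norm_deriv_le
    (fun x _ => hf.symbol.differentiable () x) (fun x _ => hC () x) convex_univ (Set.mem_univ s)
    (Set.mem_univ t)⟩

theorem lipschitz_p : ∃ C : ℝ, 0 ≤ C ∧ ∀ s, ∀ᶠ t in 𝓝 s, ‖p t - p s‖ ≤ C * |t - s| := by
  obtain ⟨C, hC0, hC⟩ := hf.lipschitz_h
  have hg := hf.pos
  refine ⟨2 * g⁻¹ * C, by positivity, fun s => ?_⟩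
  filter_upwards [hf.cross s] with t ht
  refine (norm_projection_sub_le hg (hf.proj t) (hf.proj s) (hf.comm t) (hf.comm s) ht.1
    ht.2).trans ?_
  rw [mul_assoc (2 * g⁻¹)]
  exact mul_le_mul_of_nonneg_left (hC s t) (by positivity)

/-- Since `h t` commutes with `p t`, the commutator of `h s` with `p t - p s` is linear in `h t - h
s`; since both are idempotent, the diagonal part of `p t - p s` is quadratic in that difference. -/
theorem sylvesterOp_sub (s t : ℝ) : sylvesterOp (h s) (p s) (p t - p s) =
    offDiagOp (p s) (p t * (h t - h s) - (h t - h s) * p t) +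
      ((1 - p s) * (((p t - p s) * (p t - p s)) * (1 - p s)) -
        p s * (((p t - p s) * (p t - p s)) * p s)) := by
  have ht : p t * p t = p t := (hf.proj t).isIdempotentElem
  have hs : p s * p s = p s := (hf.proj s).isIdempotentElem
  rw [sylvesterOp_apply, ← (sylvesterOp_compress hs (hf.comm s) _).2.2.2]
  congr 1
  · congr 1
    rw [mul_sub, sub_mul, (hf.comm s).eq, mul_sub, sub_mul, (hf.comm t).eq]
    abel
  · have e2 : ∀ x, p s * (p s * x) = p s * x := fun x => by rw [← mul_assoc, hs]
    rw [diagOp_apply]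
    simp only [mul_sub, sub_mul, mul_one, one_mul, mul_assoc, ht, hs, e2]
    abel

/-- In the preceding identity the quadratic terms have zero derivative at `s` by the Lipschitz
bounds. Applying the inverse `N s` to the rest gives the derivative, without presupposing
differentiability of `p`. -/
theorem hasDerivAt_p {N : ℝ → 𝔸 →L[ℝ] 𝔸} (hN : ∀ t, N t * sylvesterOp (h t) (p t) = 1) (s : ℝ) :
    HasDerivAt p (N s (offDiagOp (p s) (p s * deriv h s - deriv h s * p s))) s := by
  obtain ⟨C, hC0, hC⟩ := hf.lipschitz_h
  obtain ⟨D, hD0, hD⟩ := hf.lipschitz_p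
  have small : ∀ u v : ℝ → 𝔸, (∃ C, 0 ≤ C ∧ ∀ᶠ t in 𝓝 s, ‖u t‖ ≤ C * |t - s|) →
      (∃ C, ∀ᶠ t in 𝓝 s, ‖v t‖ ≤ C * |t - s|) → HasDerivAt (fun t => u t * v t) 0 s := by
    rintro u v ⟨C, hC0, hu⟩ ⟨D, hv⟩
    have : (fun t => u t * v t) =O[𝓝 s] fun t => ‖t - s‖ ^ 2 := by
      refine Asymptotics.IsBigO.of_bound (C * D) ?_
      filter_upwards [hu, hv] with t hu hv
      rw [norm_pow, norm_norm, Real.norm_eq_abs]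
      calc ‖u t * v t‖ ≤ C * |t - s| * (D * |t - s|) := (norm_mul_le _ _).trans
            (mul_le_mul hu hv (norm_nonneg _) (by positivity))
        _ = _ := by ring
    simpa using (this.hasFDerivAt (𝕜 := ℝ) one_lt_two).hasDerivAt
  have hpd : HasDerivAt (fun t => (p t - p s) * (p t - p s)) 0 s :=
    small _ _ ⟨D, hD0, hD s⟩ ⟨D, hD s⟩
  have hh := (hf.symbol.hasDerivAt () s).sub_const (h s)
  have h1 : HasDerivAt (fun t => (h t - h s) * p t) (deriv h s * p s) s := by
    have := (hh.mul_const (p s)).add (small _ _ ⟨C, hC0, Eventually.of_forall (hC s)⟩ ⟨D, hD s⟩)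
    rw [add_zero] at this
    refine this.congr_of_eventuallyEq (Eventually.of_forall fun t => ?_)
    simp [mul_sub]
  have h2 : HasDerivAt (fun t => p t * (h t - h s)) (p s * deriv h s) s := by
    have := (hh.const_mul (p s)).add (small _ _ ⟨D, hD0, hD s⟩ ⟨C, Eventually.of_forall (hC s)⟩)
    rw [add_zero] at this
    refine this.congr_of_eventuallyEq (Eventually.of_forall fun t => ?_)
    simp [sub_mul]
  have h3 := ((offDiagOp (p s)).hasFDerivAt.comp_hasDerivAt s (h2.sub h1)).add
    (((hpd.mul_const (1 - p s)).const_mul (1 - p s)).sub ((hpd.mul_const (p s)).const_mul (p s)))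
  simp only [zero_mul, mul_zero, sub_zero, add_zero] at h3
  have h4 := ((N s).hasFDerivAt.comp_hasDerivAt s h3).add_const (p s)
  refine h4.congr_of_eventuallyEq (Eventually.of_forall fun t => ?_)
  have h5 := congrArg (N s) (hf.sylvesterOp_sub s t)
  rw [← mul_apply_eq_comp, hN s, one_apply_eq_self] at h5
  exact sub_eq_iff_eq_add.1 h5

/-- Bootstrap: regularity of `p` to order `n` gives that of the inverse `N`, and the formula for
`p'` in terms of `p`, `h'` and `N` then yields order `n + 1`. On `Z` that formula vanishes with
`h'`. -/
theorem unifSymbol_inverse {N : ℝ → 𝔸 →L[ℝ] 𝔸}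
    (hN₁ : ∀ t, sylvesterOp (h t) (p t) * N t = 1) (hN₂ : ∀ t, N t * sylvesterOp (h t) (p t) = 1)
    (hN₃ : ∀ t, ‖N t‖ ≤ 2 + 2 * g⁻¹) (n : ℕ) :
    UnifCb Z n (fun _ : Unit => p) ∧ UnifCb Z n fun _ : Unit => N := by
  have hinv : ∀ {n}, UnifCb Z n (fun _ : Unit => p) → UnifCb Z n fun _ : Unit => N := fun hp =>
    (UnifCb.sylvesterOp (hf.symbol _) hp).inverse (fun _ => hN₁) (fun _ => hN₂)
      ⟨_, fun _ => hN₃⟩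
  have hb : ∃ C : ℝ, ∀ (_ : Unit) t, ‖p t‖ ≤ C := ⟨1, fun _ t => (hf.proj t).norm_le⟩
  suffices hp : UnifCb Z n (fun _ : Unit => p) from ⟨hp, hinv hp⟩
  induction n with
  | zero => exact hb
  | succ n ih =>
    have hd := hf.symbol.deriv n
    refine UnifCb.of_deriv hb (fun _ => hf.hasDerivAt_p hN₂) (fun i t ht => ?_)
      ((hinv ih).clm_apply (ih.offDiagOp.clm_apply ((ih.mul hd).sub (hd.mul ih))))
    rw [hf.symbol.deriv_eq_zero () ht]
    simp

theorem unifSymbol : UnifSymbol Z fun _ : ι => p := by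
  obtain ⟨N, h1, h2, h3⟩ := hf.exists_inverse
  exact UnifSymbol.comp (fun _ => ()) fun n => (hf.unifSymbol_inverse h1 h2 h3 n).1

/-- The commutator equation with self-adjoint, off-diagonal right hand side. -/
theorem exists_commutator_eq {d : ℝ → 𝔸} (hd : UnifSymbol Z fun _ : ι => d)
    (hds : ∀ t, star (d t) = d t) (hdo : ∀ t, diagOp (p t) (d t) = 0) :
    ∃ T : ℝ → 𝔸, UnifSymbol Z (fun _ : ι => T) ∧ (∀ t, star (T t) = -T t) ∧
      (∀ t, h t * T t - T t * h t = d t) ∧ ∀ t, d t = 0 → T t = 0 := by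
  obtain ⟨N, h1, h2, h3⟩ := hf.exists_inverse
  have hNu : UnifSymbol Z fun _ : ι => N :=
    UnifSymbol.comp (fun _ => ()) fun n => (hf.unifSymbol_inverse h1 h2 h3 n).2
  have hLN : ∀ t x, sylvesterOp (h t) (p t) (N t x) = x := fun t x => by
    rw [← mul_apply_eq_comp, h1, one_apply_eq_self]
  have hNL : ∀ t x, N t (sylvesterOp (h t) (p t) x) = x := fun t x => by
    rw [← mul_apply_eq_comp, h2, one_apply_eq_self]
  have hpp : ∀ t, p t * p t = p t := fun t => (hf.proj t).isIdempotentElem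
  have hdiag : ∀ t, diagOp (p t) (N t (d t)) = 0 := fun t => by
    rw [← (sylvesterOp_compress (hpp t) (hf.comm t) _).1, hLN, hdo]
  have hoff : ∀ t, offDiagOp (p t) (N t (d t)) = N t (d t) := fun t => by
    have := diagOp_add_offDiagOp (p t) (N t (d t))
    rwa [hdiag, zero_add] at this
  have hcomm : ∀ t, h t * N t (d t) - N t (d t) * h t = d t := fun t => by
    have := hLN t (d t)
    rwa [sylvesterOp_apply, hoff, hdiag, add_zero] at this
  have hstar : ∀ t x, diagOp (p t) (star x) = star (diagOp (p t) x) ∧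
      offDiagOp (p t) (star x) = star (offDiagOp (p t) x) := fun t x => by
    constructor <;> simp only [diagOp_apply, offDiagOp_apply, star_add, star_mul,
      (hf.proj t).isSelfAdjoint.star_eq, (hf.proj t).one_sub.isSelfAdjoint.star_eq, mul_assoc]
    abel
  refine ⟨fun t => N t (d t), fun n => (hNu n).clm_apply (hd n), fun t => ?_, hcomm, fun t ht => ?_⟩
  -- As `h` and `d` are self-adjoint, `-T*` solves the same equation as `T`, and the solution is
  -- unique.
  · have h5 : sylvesterOp (h t) (p t) (-star (N t (d t))) = d t := by
      rw [map_neg, sylvesterOp_apply, (hstar t _).1, (hstar t _).2, hoff, hdiag, star_zero, add_zero,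
        neg_sub]
      have := congrArg star (hcomm t)
      rwa [star_sub, star_mul, star_mul, (hf.isSelfAdjoint t).star_eq, hds] at this
    have h6 := hNL t (-star (N t (d t)))
    rw [h5] at h6
    beta_reduce
    exact (neg_eq_iff_eq_neg.2 h6).symm
  · simp only [ht, map_zero]

end GappedFamily

end GappedFamilies

/-! ### From the spectral gap to gapped families, by functional calculus -/

section SpectralGap

variable {𝔸 : Type*} [CStarAlgebra 𝔸]

/-- Within distance `g` of a point of `σ`, the rest of `σ` lies on the same side of the separation,
so the indicator is locally either `f` or zero. -/
theorem continuousOn_indicator_of_separated {σ S : Set ℝ} {f : ℝ → ℝ} {g : ℝ} (hg : 0 < g)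
    (hsep : ∀ x ∈ σ ∩ S, ∀ y ∈ σ \ S, g ≤ |x - y|) (hf : ContinuousOn f (σ ∩ S)) :
    ContinuousOn (S.indicator f) σ := by
  intro x hx
  rw [← continuousWithinAt_inter (Metric.ball_mem_nhds x hg)]
  by_cases hxS : x ∈ S
  · have hsub : σ ∩ Metric.ball x g ⊆ σ ∩ S := fun y hy => ⟨hy.1, by
      by_contra hyS
      have h1 := hsep x ⟨hx, hxS⟩ y ⟨hy.1, hyS⟩
      have h2 := Metric.mem_ball'.1 hy.2
      rw [Real.dist_eq] at h2
      exact absurd h1 (not_le.2 h2)⟩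
    exact ((hf x ⟨hx, hxS⟩).mono hsub).congr (fun y hy => Set.indicator_of_mem (hsub hy).2 f)
      (Set.indicator_of_mem hxS f)
  · have hsub : ∀ y ∈ σ ∩ Metric.ball x g, y ∉ S := fun y hy hyS => by
      have h1 := hsep y ⟨hy.1, hyS⟩ x ⟨hx, hxS⟩
      have h2 := Metric.mem_ball.1 hy.2
      rw [Real.dist_eq] at h2
      exact absurd h1 (not_le.2 h2)
    exact (continuousWithinAt_const (b := (0 : ℝ))).congr
      (fun y hy => Set.indicator_of_notMem (hsub y hy) f) (Set.indicator_of_notMem hxS f)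

/-- `S` is at distance at least `g` from the rest of the spectrum of the self-adjoint `h`. -/
structure SpectrumSeparated (g : ℝ) (h : 𝔸) (S : Set ℝ) : Prop where
  pos : 0 < g
  isSelfAdjoint : IsSelfAdjoint h
  sep : ∀ x ∈ spectrum ℝ h ∩ S, ∀ y ∈ spectrum ℝ h \ S, g ≤ |x - y|

namespace SpectrumSeparated

variable {g : ℝ} {h : 𝔸} {S : Set ℝ} (hS : SpectrumSeparated g h S)
include hS

theorem compl : SpectrumSeparated g h Sᶜ where
  pos := hS.pos
  isSelfAdjoint := hS.isSelfAdjoint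
  sep x hx y hy := by
    rw [abs_sub_comm]
    exact hS.sep y ⟨hy.1, not_not.1 hy.2⟩ x ⟨hx.1, hx.2⟩

theorem continuousOn {f : ℝ → ℝ} (hf : ContinuousOn f (spectrum ℝ h ∩ S)) :
    ContinuousOn (S.indicator f) (spectrum ℝ h) :=
  continuousOn_indicator_of_separated hS.pos hS.sep hf

theorem isStarProjection : IsStarProjection (cfc (S.indicator fun _ => (1 : ℝ)) h) := by
  have hc : ContinuousOn (S.indicator fun _ => (1 : ℝ)) (spectrum ℝ h) :=
    hS.continuousOn continuousOn_const
  refine ⟨?_, cfc_predicate _ _⟩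
  rw [IsIdempotentElem, ← cfc_mul _ _ h hc hc]
  congr 1
  funext x
  by_cases hx : x ∈ S <;> simp [hx]

theorem commute : Commute h (cfc (S.indicator fun _ => (1 : ℝ)) h) := by
  have := hS.isSelfAdjoint
  have h1 := cfc_commute_cfc (fun x : ℝ => x) (S.indicator fun _ => (1 : ℝ)) h
  rwa [cfc_id' ℝ h] at h1

theorem cfc_sub_const (c : ℝ) : cfc (fun x => x - c) h = h - algebraMap ℝ 𝔸 c := by
  have := hS.isSelfAdjoint
  rw [cfc_sub (fun x => x) (fun _ => c) h, cfc_id' ℝ h, cfc_const c h]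

theorem one_sub : 1 - cfc (S.indicator fun _ => (1 : ℝ)) h =
    cfc (Sᶜ.indicator fun _ => (1 : ℝ)) h := by
  have := hS.isSelfAdjoint
  have hc : ContinuousOn (S.indicator fun _ => (1 : ℝ)) (spectrum ℝ h) :=
    hS.continuousOn continuousOn_const
  rw [← cfc_const_one ℝ h, ← cfc_sub (fun _ => 1) _ h continuousOn_const hc]
  congr 1
  funext x
  by_cases hx : x ∈ S <;> simp [hx]

theorem norm_mul_le {c r : ℝ} (hr : 0 ≤ r) (h₁ : ∀ x ∈ spectrum ℝ h ∩ S, |x - c| ≤ r) :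
    ‖(h - algebraMap ℝ 𝔸 c) * cfc (S.indicator fun _ => (1 : ℝ)) h‖ ≤ r := by
  rw [← hS.cfc_sub_const, ← cfc_mul _ _ h (by fun_prop) (hS.continuousOn continuousOn_const)]
  refine norm_cfc_le hr fun x hx => ?_
  by_cases hxS : x ∈ S
  · simpa [hxS] using h₁ x ⟨hx, hxS⟩
  · simpa [hxS] using hr

/-- The function that is `1 / (x - c)` off `S` and zero on `S` is continuous on the spectrum and
bounded by `1 / R` there. -/
theorem exists_inverse {c R : ℝ} (hR : 0 < R) (h₁ : ∀ x ∈ spectrum ℝ h \ S, R ≤ |x - c|) :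
    ∃ b : 𝔸, (h - algebraMap ℝ 𝔸 c) * b = 1 - cfc (S.indicator fun _ => (1 : ℝ)) h ∧
      b * (h - algebraMap ℝ 𝔸 c) = 1 - cfc (S.indicator fun _ => (1 : ℝ)) h ∧
      b * (1 - cfc (S.indicator fun _ => (1 : ℝ)) h) = b ∧
      (1 - cfc (S.indicator fun _ => (1 : ℝ)) h) * b = b ∧ ‖b‖ ≤ R⁻¹ := by
  have hne : ∀ x ∈ spectrum ℝ h, x ∉ S → x - c ≠ 0 := fun x hx hxS h0 => by
    have := h₁ x ⟨hx, hxS⟩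
    rw [h0, abs_zero] at this
    exact absurd this (not_le.2 hR)
  have hb : ContinuousOn (Sᶜ.indicator fun x => (x - c)⁻¹) (spectrum ℝ h) :=
    hS.compl.continuousOn ((by fun_prop : Continuous fun x => x - c).continuousOn.inv₀
      fun x hx => hne x hx.1 hx.2)
  have hq : ContinuousOn (Sᶜ.indicator fun _ => (1 : ℝ)) (spectrum ℝ h) :=
    hS.compl.continuousOn continuousOn_const
  have hk : ContinuousOn (fun x => x - c) (spectrum ℝ h) := by fun_prop
  refine ⟨cfc (Sᶜ.indicator fun x => (x - c)⁻¹) h, ?_⟩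
  rw [hS.one_sub, ← hS.cfc_sub_const, ← cfc_mul _ _ h hk hb, ← cfc_mul _ _ h hb hk,
    ← cfc_mul _ _ h hb hq, ← cfc_mul _ _ h hq hb]
  refine ⟨cfc_congr fun x hx => ?_, cfc_congr fun x hx => ?_, cfc_congr fun x _ => ?_,
    cfc_congr fun x _ => ?_, norm_cfc_le (inv_nonneg.2 hR.le) fun x hx => ?_⟩
  · by_cases hxS : x ∈ S
    · simp [hxS]
    · simp [hxS, mul_inv_cancel₀ (hne x hx hxS)]
  · by_cases hxS : x ∈ S
    · simp [hxS]
    · simp [hxS, inv_mul_cancel₀ (hne x hx hxS)]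
  · by_cases hxS : x ∈ S <;> simp [hxS]
  · by_cases hxS : x ∈ S <;> simp [hxS]
  · by_cases hxS : x ∈ S
    · simpa [hxS] using hR.le
    · simpa [hxS] using inv_anti₀ hR (h₁ x ⟨hx, hxS⟩)

end SpectrumSeparated

theorem gapBound_of_separated {g g₁ g₂ c r : ℝ} (hg : 0 < g) (hr : 0 ≤ r) {h₁ h₂ : 𝔸} {S₁ S₂ : Set ℝ}
    (hS₁ : SpectrumSeparated g₁ h₁ S₁) (hS₂ : SpectrumSeparated g₂ h₂ S₂)
    (hin : ∀ x ∈ spectrum ℝ h₁ ∩ S₁, |x - c| ≤ r) (hout : ∀ x ∈ spectrum ℝ h₂ \ S₂, r + g ≤ |x - c|) :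
    GapBound g h₁ (cfc (S₁.indicator fun _ => (1 : ℝ)) h₁) h₂
      (cfc (S₂.indicator fun _ => (1 : ℝ)) h₂) := by
  obtain ⟨b, hb⟩ := hS₂.exists_inverse (by positivity) hout
  exact ⟨c, r, b, hr, hS₁.norm_mul_le hr hin, hb⟩

theorem le_abs_sub_midpoint {a b g x : ℝ} (hab : a ≤ b) (hg : 0 < g)
    (h : ∀ y ∈ Set.Icc a b, g ≤ |x - y|) : (b - a) / 2 + g ≤ |x - (a + b) / 2| := by
  have ha := h a ⟨le_rfl, hab⟩
  have hb := h b ⟨hab, le_rfl⟩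
  by_cases hx : x ∈ Set.Icc a b
  · have := h x hx
    rw [sub_self, abs_zero] at this
    linarith
  · rw [Set.mem_Icc, not_and_or, not_le, not_le] at hx
    rcases hx with hx | hx
    · rw [abs_of_neg (by linarith)] at ha ⊢
      linarith
    · rw [abs_of_pos (by linarith)] at hb ⊢
      linarith

/-- A uniform spectral gap yields a gapped family of spectral projections. -/
theorem gappedFamily_of_gap {Z : Set ℝ} {h : ℝ → 𝔸} {S : ℝ → Set ℝ} {γm γp : ℝ → ℝ} {g : ℝ}
    (hg : 0 < g) (hsym : UnifSymbol Z fun _ : Unit => h) (hh : ∀ t, IsSelfAdjoint (h t))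
    (hm : Continuous γm) (hp : Continuous γp) (hmp : ∀ t, γm t ≤ γp t)
    (hin : ∀ t, S t ⊆ Set.Icc (γm t) (γp t))
    (hout : ∀ t, ∀ x ∈ spectrum ℝ (h t) \ S t, ∀ y ∈ Set.Icc (γm t) (γp t), g ≤ |x - y|) :
    GappedFamily Z (g / 2) h fun t => cfc ((S t).indicator fun _ => (1 : ℝ)) (h t) := by
  have hS : ∀ t, SpectrumSeparated g (h t) (S t) := fun t => ⟨hg, hh t, fun x hx y hy => by
    rw [abs_sub_comm]
    exact hout t y hy x (hin t hx.2)⟩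
  -- The ball is centred at the midpoint of the interval at time `t`. While the end points move by
  -- less than `g / 2`, the spectrum outside `S s` keeps distance `g / 2` from that interval; this
  -- is where half of the gap is spent.
  have key : ∀ s t, |γm t - γm s| < g / 2 → |γp t - γp s| < g / 2 →
      GapBound (g / 2) (h t) (cfc ((S t).indicator fun _ => (1 : ℝ)) (h t)) (h s)
        (cfc ((S s).indicator fun _ => (1 : ℝ)) (h s)) := by
    intro s t h1 h2
    rw [abs_lt] at h1 h2
    refine gapBound_of_separated (c := (γm t + γp t) / 2) (r := (γp t - γm t) / 2) (half_pos hg)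
      (by linarith [hmp t]) (hS t) (hS s) (fun x hx => ?_) fun x hx => ?_
    · have := hin t hx.2
      rw [abs_le]
      constructor <;> linarith [this.1, this.2]
    · refine le_abs_sub_midpoint (hmp t) (half_pos hg) fun y hy => ?_
      -- The witness is the point of the interval at time `s` nearest to `y`.
      obtain ⟨z, hz, hyz⟩ : ∃ z ∈ Set.Icc (γm s) (γp s), |y - z| ≤ g / 2 := by
        refine ⟨max (γm s) (min y (γp s)), ⟨le_max_left _ _, max_le (hmp s) (min_le_right _ _)⟩, ?_⟩
        rw [abs_le]
        have hms := hmp s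
        rcases le_total y (γp s) with h3 | h3
        · rw [min_eq_left h3]
          rcases le_total (γm s) y with h4 | h4
          · rw [max_eq_right h4]; constructor <;> linarith
          · rw [max_eq_left h4]; constructor <;> linarith [hy.1]
        · rw [min_eq_right h3, max_eq_right hms]
          constructor <;> linarith [hy.2]
      have h3 := hout s x hx z hz
      have h4 := abs_sub_le x y z
      linarith
  refine ⟨half_pos hg, hsym, hh, fun t => (hS t).isStarProjection, fun t => (hS t).commute,
    fun s => ?_⟩
  have e1 := (Metric.continuous_iff'.1 hm s) (g / 2) (half_pos hg)
  have e2 := (Metric.continuous_iff'.1 hp s) (g / 2) (half_pos hg)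
  filter_upwards [e1, e2] with t h1 h2
  rw [Real.dist_eq] at h1 h2
  exact ⟨key s t h1 h2, key t s (by rwa [abs_sub_comm]) (by rwa [abs_sub_comm])⟩

end SpectralGap

/-! ### Linear evolution equations and parallel transport -/

section LinearODE

/-- Global solutions of linear differential equations with bounded continuous coefficients. -/
theorem exists_linear_ode_solution {R : Type*} [NormedRing R] [NormedAlgebra ℝ R] [CompleteSpace R]
    {G : ℝ → R} (hG : Continuous G) {M : ℝ} (hM : ∀ t, ‖G t‖ ≤ M) :
    ∃ Φ : ℝ → R, Φ 0 = 1 ∧ ∀ t, HasDerivAt Φ (G t * Φ t) t := by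
  have hM0 : 0 ≤ M := (norm_nonneg _).trans (hM 0)
  -- The solution is sought as `cosh(l t) Y(t)` with `Y` bounded. This weight makes the integral
  -- equation a contraction on the whole line: the integral of `cosh(l s)` is `sinh(l t) / l`, and
  -- `M / l ≤ 1 / 2`.
  set l : ℝ := 2 * (M + 1) with hl
  have hl0 : 0 < l := by positivity
  have hcosh : ∀ t, 0 < Real.cosh (l * t) := fun t => Real.cosh_pos _
  have hcont : ∀ Y : BoundedContinuousFunction ℝ R,
      Continuous fun s => Real.cosh (l * s) • (G s * Y s) := fun Y => by
    have := Y.continuous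
    fun_prop
  have hint : ∀ t, ∫ s in (0 : ℝ)..t, Real.cosh (l * s) = Real.sinh (l * t) / l := by
    intro t
    have hd : ∀ s ∈ Set.uIcc 0 t, HasDerivAt (fun s => Real.sinh (l * s) / l) (Real.cosh (l * s)) s := by
      intro s _
      have h1 : HasDerivAt (fun s => l * s) l s := by simpa using (hasDerivAt_id s).const_mul l
      have := h1.sinh.div_const l
      rwa [mul_div_cancel_right₀ _ hl0.ne'] at this
    rw [intervalIntegral.integral_eq_sub_of_hasDerivAt hd
      (Continuous.intervalIntegrable (by fun_prop) _ _)]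
    simp
  have hbound : ∀ (f : ℝ → R) (C : ℝ), 0 ≤ C → (∀ s, ‖f s‖ ≤ C * Real.cosh (l * s)) → ∀ t,
      ‖(Real.cosh (l * t))⁻¹ • ∫ s in (0 : ℝ)..t, f s‖ ≤ C / l := by
    intro f C hC hf t
    have h1 : ‖∫ s in (0 : ℝ)..t, f s‖ ≤ |∫ s in (0 : ℝ)..t, C * Real.cosh (l * s)| :=
      intervalIntegral.norm_integral_le_abs_of_norm_le (Eventually.of_forall hf)
        (Continuous.intervalIntegrable (by fun_prop) _ _)
    rw [intervalIntegral.integral_const_mul, hint, abs_mul, abs_of_nonneg hC, abs_div,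
      abs_of_pos hl0] at h1
    have h2 : |Real.sinh (l * t)| ≤ Real.cosh (l * t) := by
      rw [Real.abs_sinh, ← Real.cosh_abs]
      exact (Real.sinh_lt_cosh _).le
    rw [norm_smul, norm_inv, Real.norm_of_nonneg (hcosh t).le, inv_mul_le_iff₀ (hcosh t)]
    refine h1.trans ?_
    rw [mul_div_left_comm]
    exact mul_le_mul_of_nonneg_right h2 (by positivity)
  have hcontI : ∀ Y : BoundedContinuousFunction ℝ R, Continuous fun t =>
      (Real.cosh (l * t))⁻¹ • (1 + ∫ s in (0 : ℝ)..t, Real.cosh (l * s) • (G s * Y s)) := by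
    intro Y
    have h1 : Continuous fun t => ∫ s in (0 : ℝ)..t, Real.cosh (l * s) • (G s * Y s) :=
      intervalIntegral.continuous_primitive (fun a b => (hcont Y).intervalIntegrable a b) 0
    have h2 : Continuous fun t => (Real.cosh (l * t))⁻¹ :=
      Continuous.inv₀ (by fun_prop) fun t => (hcosh t).ne'
    exact h2.smul (continuous_const.add h1)
  have hmul : ∀ (s : ℝ) (x : R) (C : ℝ), ‖x‖ ≤ C →
      ‖Real.cosh (l * s) • (G s * x)‖ ≤ M * C * Real.cosh (l * s) := by
    intro s x C hx
    rw [norm_smul, Real.norm_of_nonneg (hcosh s).le, mul_comm]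
    exact mul_le_mul_of_nonneg_right ((norm_mul_le _ _).trans
      (mul_le_mul (hM s) hx (norm_nonneg _) hM0)) (hcosh s).le
  have hT : ∀ Y : BoundedContinuousFunction ℝ R, ∀ t, ‖(Real.cosh (l * t))⁻¹ •
      ((1 : R) + ∫ s in (0 : ℝ)..t, Real.cosh (l * s) • (G s * Y s))‖ ≤ ‖(1 : R)‖ + M * ‖Y‖ / l := by
    intro Y t
    rw [smul_add]
    refine (norm_add_le _ _).trans (add_le_add ?_ (hbound _ _ (by positivity)
      (fun s => hmul s _ _ (Y.norm_coe_le_norm s)) t))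
    rw [norm_smul, norm_inv, Real.norm_of_nonneg (hcosh t).le]
    exact mul_le_of_le_one_left (norm_nonneg _) (inv_le_one_of_one_le₀ (Real.one_le_cosh _))
  let T : BoundedContinuousFunction ℝ R → BoundedContinuousFunction ℝ R := fun Y =>
    BoundedContinuousFunction.ofNormedAddCommGroup _ (hcontI Y) _ (hT Y)
  have hTapp : ∀ Y t, T Y t =
      (Real.cosh (l * t))⁻¹ • (1 + ∫ s in (0 : ℝ)..t, Real.cosh (l * s) • (G s * Y s)) :=
    fun _ _ => rfl
  have hcontr : ContractingWith (1 / 2) T := by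
    refine ⟨by norm_num, LipschitzWith.of_dist_le_mul fun Y Y' => ?_⟩
    refine (BoundedContinuousFunction.dist_le (by positivity)).2 fun t => ?_
    have h1 : T Y t - T Y' t = (Real.cosh (l * t))⁻¹ •
        ∫ s in (0 : ℝ)..t, Real.cosh (l * s) • (G s * (Y s - Y' s)) := by
      rw [hTapp, hTapp, ← smul_sub, add_sub_add_left_eq_sub, ← intervalIntegral.integral_sub
        ((hcont Y).intervalIntegrable _ _) ((hcont Y').intervalIntegrable _ _)]
      simp only [mul_sub, smul_sub]
    rw [dist_eq_norm, h1]
    refine (hbound _ (M * dist Y Y') (by positivity) (fun s => hmul s _ _ ?_) t).trans ?_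
    · rw [← dist_eq_norm]
      exact BoundedContinuousFunction.dist_coe_le_dist s
    · rw [div_le_iff₀ hl0, hl]
      push_cast
      nlinarith [dist_nonneg (x := Y) (y := Y')]
  have hfix : ∀ t, Real.cosh (l * t) • (ContractingWith.fixedPoint T hcontr) t =
      1 + ∫ s in (0 : ℝ)..t, Real.cosh (l * s) • (G s * (ContractingWith.fixedPoint T hcontr) s) := by
    intro t
    have := hTapp (ContractingWith.fixedPoint T hcontr) t
    rw [hcontr.fixedPoint_isFixedPt] at this
    rw [this, smul_smul, mul_inv_cancel₀ (hcosh t).ne', one_smul]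
  set Y := ContractingWith.fixedPoint T hcontr
  refine ⟨fun t => Real.cosh (l * t) • Y t, ?_, fun t => ?_⟩
  · simpa using hfix 0
  · have h1 : HasDerivAt (fun t => (1 : R) + ∫ s in (0 : ℝ)..t, Real.cosh (l * s) • (G s * Y s))
        (Real.cosh (l * t) • (G t * Y t)) t :=
      ((hcont Y).integral_hasStrictDerivAt 0 t).hasDerivAt.const_add 1
    simp only [← hfix] at h1
    rwa [← mul_smul_comm] at h1

variable {𝔸 : Type*} [CStarAlgebra 𝔸]

/-- The evolution generated by skew-adjoint operators is unitary. -/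
theorem exists_unitary_evolution {G : ℝ → 𝔸} (hG : Continuous G) {M : ℝ} (hM : ∀ t, ‖G t‖ ≤ M)
    (hskew : ∀ t, star (G t) = -G t) :
    ∃ Φ : ℝ → 𝔸, Φ 0 = 1 ∧ (∀ t, Φ t ∈ unitary 𝔸) ∧ ∀ t, HasDerivAt Φ (G t * Φ t) t := by
  obtain ⟨Φ, h0, hΦ⟩ := exists_linear_ode_solution hG hM
  have hM0 : 0 ≤ M := (norm_nonneg _).trans (hM 0)
  have hs : ∀ t, HasDerivAt (fun t => star (Φ t)) (-(star (Φ t) * G t)) t := fun t => by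
    have := (hΦ t).star
    rwa [star_mul, hskew, mul_neg] at this
  refine ⟨Φ, h0, fun t => Unitary.mem_iff.2 ⟨?_, ?_⟩, hΦ⟩
  · have hd : ∀ t, HasDerivAt (fun t => star (Φ t) * Φ t) 0 t := fun t => by
      have := (hs t).mul (hΦ t)
      rwa [neg_mul, mul_assoc, neg_add_cancel] at this
    have := is_const_of_deriv_eq_zero (fun t => (hd t).differentiableAt) (fun t => (hd t).deriv) t 0
    simpa [h0] using this
  -- An isometry need not be unitary, so `Φ Φ*` is treated separately: it solves `X' = G X - X G`
  -- with initial value `1`, as does the constant `1`.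
  · have hd : ∀ t, HasDerivAt (fun t => Φ t * star (Φ t))
        (G t * (Φ t * star (Φ t)) - Φ t * star (Φ t) * G t) t := fun t => by
      have := (hΦ t).mul (hs t)
      rwa [mul_neg, ← sub_eq_add_neg, mul_assoc, ← mul_assoc (Φ t)] at this
    have hlip : ∀ t, LipschitzOnWith (Real.toNNReal (2 * M)) (fun x : 𝔸 => G t * x - x * G t)
        Set.univ := fun t => by
      refine LipschitzOnWith.of_dist_le_mul fun x _ y _ => ?_
      rw [dist_eq_norm, dist_eq_norm, Real.coe_toNNReal _ (by positivity)]
      calc ‖G t * x - x * G t - (G t * y - y * G t)‖ = ‖G t * (x - y) - (x - y) * G t‖ := by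
            congr 1; noncomm_ring
        _ ≤ M * ‖x - y‖ + ‖x - y‖ * M := (norm_sub_le _ _).trans (add_le_add
            ((norm_mul_le _ _).trans (mul_le_mul_of_nonneg_right (hM t) (norm_nonneg _)))
            ((norm_mul_le _ _).trans (mul_le_mul_of_nonneg_left (hM t) (norm_nonneg _))))
        _ = _ := by ring
    have := ODE_solution_unique_univ (t₀ := 0) hlip (fun t => ⟨hd t, Set.mem_univ _⟩)
      (g := fun _ => (1 : 𝔸)) (fun t => ⟨by simpa using hasDerivAt_const t (1 : 𝔸), Set.mem_univ _⟩)
      (by simp [h0])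
    exact congrFun this t

/-- Parallel transport along a gapped family of projections (Kato). -/
theorem exists_parallel_transport {Z : Set ℝ} {p : ℝ → 𝔸} (hp : UnifSymbol Z fun _ : Unit => p)
    (hproj : ∀ t, IsStarProjection (p t)) :
    ∃ u : ℝ → 𝔸, (∀ t, u t ∈ unitary 𝔸) ∧ UnifSymbol Z (fun _ : Unit => u) ∧
      (∀ t, HasDerivAt u (u t * (p t * deriv p t - deriv p t * p t)) t) ∧
      ∀ t, u t * p t * star (u t) = p 0 := by
  have hG : UnifSymbol Z fun (_ : Unit) t => p t * deriv p t - deriv p t * p t :=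
    (hp.mul hp.deriv).sub (hp.deriv.mul hp)
  have hpp : ∀ t, p t * p t = p t := fun t => (hproj t).isIdempotentElem
  have hd := hp.hasDerivAt ()
  have hds : ∀ t, star (deriv p t) = deriv p t := fun t => by
    have h1 := (hd t).star
    have h2 : (fun t => star (p t)) = p := funext fun t => (hproj t).isSelfAdjoint.star_eq
    rw [h2] at h1
    exact h1.unique (hd t)
  have hdp : ∀ t, deriv p t = deriv p t * p t + p t * deriv p t := fun t => by
    have h1 := (hd t).mul (hd t)
    have h2 : p * p = p := funext hpp
    rw [h2] at h1
    exact (hd t).unique h1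
  have hpdp : ∀ t, p t * (deriv p t * p t) = 0 := fun t => by
    have := congrArg (fun x => p t * x) (hdp t)
    simp only [mul_add, ← mul_assoc, hpp] at this
    simpa [mul_assoc] using this
  set G : ℝ → 𝔸 := fun t => p t * deriv p t - deriv p t * p t with hGdef
  have hskew : ∀ t, star (G t) = -G t := fun t => by
    rw [hGdef]
    simp only [star_sub, star_mul, hds, (hproj t).isSelfAdjoint.star_eq, neg_sub]
  obtain ⟨C, -, hC⟩ := hG.bdd
  -- The generator has to stand on the right, `u' = u G`; since `G` is skew-adjoint, the adjoint of
  -- the solution of `Φ' = -G Φ` has this property.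
  obtain ⟨Φ, h0, hΦu, hΦ⟩ := exists_unitary_evolution (G := fun t => -G t) (hG.continuous ()).neg
    (M := C) (fun t => by rw [norm_neg]; exact hC () t) (fun t => by rw [star_neg, hskew])
  have hu : ∀ t, HasDerivAt (fun t => star (Φ t)) (star (Φ t) * G t) t := fun t => by
    have := (hΦ t).star
    rwa [star_mul, star_neg, hskew, neg_neg] at this
  have hb : ∃ C : ℝ, ∀ (_ : Unit) t, ‖star (Φ t)‖ ≤ C := ⟨‖(1 : 𝔸)‖ + 1, fun _ t => by
    have h1 := CStarRing.norm_self_mul_star (x := Φ t)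
    rw [(Unitary.mem_iff.1 (hΦu t)).2] at h1
    rw [norm_star]
    nlinarith [norm_nonneg (Φ t), norm_nonneg (1 : 𝔸)]⟩
  refine ⟨fun t => star (Φ t), fun t => Unitary.star_mem (hΦu t), fun n => ?_, hu, fun t => ?_⟩
  · induction n with
    | zero => exact hb
    | succ n ih =>
      refine UnifCb.of_deriv hb (fun _ => hu) (fun i t ht => ?_) (ih.mul (hG n))
      simp [hGdef, hp.deriv_eq_zero () ht]
  · have hconst : ∀ t, HasDerivAt (fun t => star (Φ t) * p t * Φ t) 0 t := fun t => by
      have h1 := ((hu t).mul (hd t)).mul (hΦ t)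
      refine h1.congr_deriv ?_
      -- This is `[G, p] = -p'`, which follows from `p' = p' p + p p'` and `p p' p = 0`; it makes `u
      -- p u*` constant.
      have h2 : G t * p t + deriv p t - p t * G t = 0 := by
        rw [hGdef]
        simp only [sub_mul, mul_sub, mul_assoc, hpp, hpdp, ← mul_assoc (p t) (p t)]
        nth_rewrite 2 [hdp t]
        abel
      have h3 : (star (Φ t) * G t * p t + star (Φ t) * deriv p t) * Φ t +
          star (Φ t) * p t * (-G t * Φ t) =
          star (Φ t) * (G t * p t + deriv p t - p t * G t) * Φ t := by noncomm_ring
      exact h3.trans (by rw [h2, mul_zero, zero_mul])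
    have := is_const_of_deriv_eq_zero (fun t => (hconst t).differentiableAt)
      (fun t => (hconst t).deriv) t 0
    simpa [h0] using this

end LinearODE

/-! ### Cayley transforms as exactly unitary corrections -/

section Cayley

variable {𝔸 : Type*} [CStarAlgebra 𝔸] {ι : Type*} {Z : Set ℝ} {e : ι → ℝ}

/-- Writing `x = i y` with `y` self-adjoint, the spectrum of `y` is real and `|1 - i z| ≥ 1` on it,
whatever the size of `x`. -/
theorem exists_inverse_one_sub_of_skew {x : 𝔸} (hx : star x = -x) :
    ∃ G : 𝔸, (1 - x) * G = 1 ∧ G * (1 - x) = 1 ∧ ‖G‖ ≤ 1 := by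
  set y : 𝔸 := -(Complex.I • x) with hy
  have hxy : x = Complex.I • y := by
    rw [hy, smul_neg, smul_smul, Complex.I_mul_I, neg_smul, one_smul, neg_neg]
  have hsa : IsSelfAdjoint y := by
    rw [isSelfAdjoint_iff, hy, star_neg, star_smul, hx, Complex.star_def, Complex.conj_I, neg_smul,
      smul_neg, neg_neg]
  have hn : IsStarNormal y := hsa.isStarNormal
  have hre : ∀ z ∈ spectrum ℂ y, 1 ≤ ‖1 - Complex.I * z‖ := fun z hz => by
    have h1 : z = z.re := hsa.mem_spectrum_eq_re hz
    have h2 : (1 - Complex.I * z).re = 1 := by rw [h1]; simp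
    calc (1 : ℝ) = |(1 - Complex.I * z).re| := by rw [h2, abs_one]
      _ ≤ _ := Complex.abs_re_le_norm _
  have hne : ∀ z ∈ spectrum ℂ y, 1 - Complex.I * z ≠ 0 := fun z hz h0 => by
    have := hre z hz
    rw [h0, norm_zero] at this
    exact absurd this (by norm_num)
  have hf : ContinuousOn (fun z : ℂ => 1 - Complex.I * z) (spectrum ℂ y) := by fun_prop
  have hg : ContinuousOn (fun z : ℂ => (1 - Complex.I * z)⁻¹) (spectrum ℂ y) := hf.inv₀ hne
  have h1 : 1 - x = cfc (fun z : ℂ => 1 - Complex.I * z) y := by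
    rw [cfc_sub (fun _ => 1) (fun z => Complex.I * z) y, cfc_const_one ℂ y,
      cfc_const_mul Complex.I (fun z => z) y, cfc_id' ℂ y, hxy]
  refine ⟨cfc (fun z : ℂ => (1 - Complex.I * z)⁻¹) y, ?_, ?_, norm_cfc_le zero_le_one fun z hz => ?_⟩
  · rw [h1, ← cfc_mul _ _ y hf hg, ← cfc_const_one ℂ y]
    exact cfc_congr fun z hz => mul_inv_cancel₀ (hne z hz)
  · rw [h1, ← cfc_mul _ _ y hg hf, ← cfc_const_one ℂ y]
    exact cfc_congr fun z hz => inv_mul_cancel₀ (hne z hz)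
  · rw [norm_inv]
    exact inv_le_one_of_one_le₀ (hre z hz)

theorem cayley_mem_unitary {x G : 𝔸} (hx : star x = -x) (h₁ : (1 - x) * G = 1)
    (h₂ : G * (1 - x) = 1) : (1 + x) * G ∈ unitary 𝔸 := by
  have hs₁ : star G * (1 + x) = 1 := by
    have := congrArg star h₁
    rwa [star_mul, star_sub, star_one, hx, sub_neg_eq_add] at this
  have hs₂ : (1 + x) * star G = 1 := by
    have := congrArg star h₂
    rwa [star_mul, star_sub, star_one, hx, sub_neg_eq_add] at this
  have hc : (1 + x) * G = G * (1 + x) := by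
    have e1 : (1 + x) * G = 2 * G - (1 - x) * G := by noncomm_ring
    have e2 : G * (1 + x) = 2 * G - G * (1 - x) := by noncomm_ring
    rw [e1, e2, h₁, h₂]
  have hst : star ((1 + x) * G) = star G * (1 - x) := by
    rw [star_mul, star_add, star_one, hx, ← sub_eq_add_neg]
  refine Unitary.mem_iff.2 ⟨?_, ?_⟩
  · have : (1 - x) * (1 + x) = (1 + x) * (1 - x) := by noncomm_ring
    rw [hst, mul_assoc, ← mul_assoc (1 - x), this, mul_assoc, h₁, mul_one, hs₁]
  · rw [hst, hc, mul_assoc, ← mul_assoc (1 + x), hs₂, one_mul, h₂]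

/-- For `x = e^(m+1) T` and `G = (1 - x)⁻¹` the Cayley transform is `(1 + x) G = 1 + 2 x + 2 x² G`.
It is unitary for every value of the parameter, and its expansion only requires one for `G`. -/
theorem exists_cayley (he : IsSmallParameter e) {T : ℝ → 𝔸} (hT : UnifSymbol Z fun _ : ι => T)
    (hskew : ∀ t, star (T t) = -T t) (m : ℕ) :
    ∃ V Y : ι → ℝ → 𝔸, (∀ i t, V i t ∈ unitary 𝔸) ∧ IsExpandable e Z Y ∧
      (∀ i t, V i t = 1 + e i ^ (m + 1) • ((2 : ℝ) • T t + e i • Y i t)) ∧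
      ∀ i t, T t = 0 → V i t = 1 := by
  have hsk : ∀ i t, star (e i ^ (m + 1) • T t) = -(e i ^ (m + 1) • T t) := fun i t => by
    rw [star_smul, hskew, smul_neg, star_trivial]
  choose G h₁ h₂ h₃ using fun i t => exists_inverse_one_sub_of_skew (hsk i t)
  have hTe : IsExpandable e Z fun _ : ι => T := IsExpandable.of_symbol hT
  have hGu : UnifSymbol Z G := by
    refine UnifSymbol.inverse h₁ h₂ ⟨1, h₃⟩ ((UnifSymbol.const 1).sub ?_)
    exact hT.smul_family (fun i => e i ^ (m + 1)) (he.pow_bdd _)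
  have hG1 : ∀ i t, G i t = 1 + e i ^ (m + 1) • (T t * G i t) := fun i t => by
    have := h₁ i t
    rw [sub_mul, one_mul, sub_eq_iff_eq_add, smul_mul_assoc] at this
    exact this
  have hG : IsExpandable e Z G := by
    -- The resolvent identity `G = 1 + e (e^m T G)` generates the expansion of `G`.
    refine IsExpandable.of_eq_add_smul_mul he (c := fun _ => 1)
      (B := fun i t => e i ^ m • T t) hGu (UnifSymbol.const 1) (hTe.smul_param_pow he m)
      fun i t => ?_
    rw [smul_mul_assoc, smul_smul, ← pow_succ']
    exact hG1 i t
  refine ⟨fun i t => (1 + e i ^ (m + 1) • T t) * G i t,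
    fun i t => (2 : ℝ) • (e i ^ m • (T t * (T t * G i t))),
    fun i t => cayley_mem_unitary (hsk i t) (h₁ i t) (h₂ i t),
    (((hTe.mul he (hTe.mul he hG)).smul_param_pow he m).const_smul 2), fun i t => ?_,
    fun i t h0 => ?_⟩
  · have e1 : (1 + e i ^ (m + 1) • T t) * G i t = G i t + e i ^ (m + 1) • (T t * G i t) := by
      rw [add_mul, one_mul, smul_mul_assoc]
    have e2 : T t * G i t = T t + e i ^ (m + 1) • (T t * (T t * G i t)) := by
      nth_rewrite 1 [hG1 i t]
      rw [mul_add, mul_one, mul_smul_comm]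
    beta_reduce
    rw [e1]
    nth_rewrite 1 [hG1 i t]
    nth_rewrite 1 2 [e2]
    module
  · have := h₁ i t
    rw [h0, smul_zero, sub_zero, one_mul] at this
    simp [h0, this]

end Cayley

/-! ### The Hamiltonian in a moving frame -/

section Adapted

variable {𝔸 : Type*} [CStarAlgebra 𝔸] {ι : Type*} {Z : Set ℝ} {e : ι → ℝ}

theorem UnifSymbol.csmul (c : ℂ) {A : ι → ℝ → 𝔸} (hA : UnifSymbol Z A) :
    UnifSymbol Z fun i t => c • A i t := hA.clm (c • ContinuousLinearMap.id ℝ 𝔸)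

theorem IsExpandable.csmul (c : ℂ) {A : ι → ℝ → 𝔸} (hA : IsExpandable e Z A) :
    IsExpandable e Z fun i t => c • A i t := hA.clm (c • ContinuousLinearMap.id ℝ 𝔸)

/-- The Hamiltonian `H` in the frame given by unitaries `W`, on top of a frame with connection
form `a`. -/
noncomputable def frameHamiltonian (e : ι → ℝ) (H : ι → ℝ → 𝔸) (a : ℝ → 𝔸) (W : ι → ℝ → 𝔸) (i : ι)
    (t : ℝ) : 𝔸 :=
  W i t * H i t * star (W i t) + e i • Complex.I • (a t + deriv (W i) t * star (W i t))

theorem deriv_mul_star_of_unitary {W : ℝ → 𝔸} (hW : ∀ t, W t ∈ unitary 𝔸)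
    (hd : Differentiable ℝ W) (t : ℝ) : W t * star (deriv W t) = -(deriv W t * star (W t)) := by
  have h1 := (hd t).hasDerivAt.mul (hd t).hasDerivAt.star
  have h2 : (W * fun t => star (W t)) = fun _ => 1 := funext fun t => (Unitary.mem_iff.1 (hW t)).2
  rw [h2] at h1
  exact (neg_eq_of_add_eq_zero_right ((hasDerivAt_const t (1 : 𝔸)).unique h1).symm).symm

theorem star_frameHamiltonian {H : ι → ℝ → 𝔸} {a : ℝ → 𝔸} {W : ι → ℝ → 𝔸}
    (hH : ∀ i t, star (H i t) = H i t) (ha : ∀ t, star (a t) = -a t)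
    (hW : ∀ i t, W i t ∈ unitary 𝔸) (hd : ∀ i, Differentiable ℝ (W i)) (i : ι) (t : ℝ) :
    star (frameHamiltonian e H a W i t) = frameHamiltonian e H a W i t := by
  rw [frameHamiltonian, star_add, star_mul, star_mul, star_star, hH, mul_assoc, star_smul, star_smul,
    star_add, ha, star_mul, star_star, deriv_mul_star_of_unitary (hW i) (hd i), Complex.star_def,
    Complex.conj_I, star_trivial (e i), ← neg_add, smul_neg, neg_smul, neg_neg]

/-- The double commutator with a projection extracts the off-diagonal part, and `[k, p]` is already
off-diagonal. -/
theorem commutator_commutator_self {p : 𝔸} (hp : p * p = p) (k : 𝔸) :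
    ((k * p - p * k) * p - p * (k * p - p * k)) * p -
      p * ((k * p - p * k) * p - p * (k * p - p * k)) = k * p - p * k := by
  have h : ∀ x, p * (p * x) = p * x := fun x => by rw [← mul_assoc, hp]
  simp only [sub_mul, mul_sub, mul_assoc, hp, h]
  abel

theorem diagOp_commutator {p : 𝔸} (hp : p * p = p) (k : 𝔸) : diagOp p (k * p - p * k) = 0 := by
  have h : ∀ x, p * (p * x) = p * x := fun x => by rw [← mul_assoc, hp]
  rw [diagOp_apply]
  simp only [sub_mul, mul_sub, mul_assoc, hp, h, mul_one, one_mul]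
  abel

/-- The effect of a further change of frame by `v = 1 + s ^ (m + 1) y`, `y = 2 T + s y₂`. -/
theorem frame_change_identity {s : ℝ} {m : ℕ} {a h₀ H Q₁ T d w w' v v' y y' y₂ : 𝔸}
    (hw : w * star w = 1) (hv : v = 1 + s ^ (m + 1) • y) (hv' : v' = s ^ (m + 1) • y')
    (hy : y = (2 : ℝ) • T + s • y₂) (hT : star T = -T) (hTd : h₀ * T - T * h₀ = (1 / 2 : ℝ) • d)
    (hQ : w * H * star w + s • Complex.I • (w' * star w) = h₀ + s • Q₁) :
    v * w * H * star (v * w) + s • Complex.I • (a + (v' * w + v * w') * star (v * w)) =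
      w * H * star w + s • Complex.I • (a + w' * star w) - s ^ (m + 1) • d +
        s ^ (m + 2) • ((2 : ℝ) • (T * Q₁) + y₂ * (h₀ + s • Q₁) - (2 : ℝ) • (Q₁ * T) +
          (h₀ + s • Q₁) * star y₂ + s ^ m • (y * (h₀ + s • Q₁) * star y) +
          Complex.I • (y' * star v)) := by
  have e1 : v * w * H * star (v * w) + s • Complex.I • (a + (v' * w + v * w') * star (v * w)) =
      v * (w * H * star w + s • Complex.I • (w' * star w)) * star v + s • Complex.I • a +
        s • Complex.I • (v' * (w * star w) * star v) := by
    rw [star_mul]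
    simp only [mul_add, add_mul, mul_smul_comm, smul_mul_assoc, smul_add, mul_assoc]
    abel
  have e2 : w * H * star w + s • Complex.I • (a + w' * star w) =
      h₀ + s • Q₁ + s • Complex.I • a := by
    rw [← hQ, smul_add, smul_add]
    abel
  have e3 : d = (2 : ℝ) • (h₀ * T - T * h₀) := by
    rw [hTd, smul_smul]
    norm_num
  rw [e1, e2, hQ, hw, mul_one, hv', e3]
  have e4 : star v = 1 + s ^ (m + 1) • star y := by
    rw [hv, star_add, star_one, star_smul, star_trivial]
  have e5 : v * (h₀ + s • Q₁) * star v = h₀ + s • Q₁ + s ^ (m + 1) • (y * (h₀ + s • Q₁) +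
      (h₀ + s • Q₁) * star y) + (s ^ (m + 2) * s ^ m) • (y * (h₀ + s • Q₁) * star y) := by
    have : (s ^ (m + 2) * s ^ m : ℝ) = s ^ (m + 1) * s ^ (m + 1) := by ring
    rw [e4, hv, this]
    generalize h₀ + s • Q₁ = q
    simp only [mul_add, add_mul, mul_one, one_mul, smul_mul_assoc, mul_smul_comm]
    module
  -- Since `T` is skew-adjoint, the leading term of the conjugation is `-2 [h₀, T] = -d`; this
  -- cancels the unwanted term.
  have e6 : y * (h₀ + s • Q₁) + (h₀ + s • Q₁) * star y = -((2 : ℝ) • (h₀ * T - T * h₀)) +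
      s • ((2 : ℝ) • (T * Q₁) + y₂ * (h₀ + s • Q₁) - (2 : ℝ) • (Q₁ * T) +
        (h₀ + s • Q₁) * star y₂) := by
    rw [hy, star_add, star_smul, star_smul, hT, star_trivial, star_trivial]
    simp only [mul_add, add_mul, smul_mul_assoc, mul_smul_comm, mul_neg, smul_neg]
    module
  rw [e5, e6]
  generalize y * (h₀ + s • Q₁) * star y = q₁
  generalize y₂ * (h₀ + s • Q₁) = q₂
  generalize (h₀ + s • Q₁) * star y₂ = q₃
  rw [smul_mul_assoc, smul_comm Complex.I (s ^ (m + 1))]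
  generalize Complex.I • (y' * star v) = q₄
  generalize Complex.I • a = q₅
  module

end Adapted

/-! ### Decoupling to all orders -/

section Adiabatic

variable {𝔸 : Type*} [CStarAlgebra 𝔸] {ι : Type*} {Z : Set ℝ} {e : ι → ℝ}

/-- The connection form of the parallel transport along `p`. -/
noncomputable def katoForm (p : ℝ → 𝔸) (t : ℝ) : 𝔸 := p t * deriv p t - deriv p t * p t

/-- A self-adjoint semiclassical symbol `H` whose principal part has a gapped family of
projections, and commutes with the projections at the times in `Z`. -/
structure AdiabaticData (e : ι → ℝ) (Z : Set ℝ) (g : ℝ) (H : ι → ℝ → 𝔸) (h p : ℝ → 𝔸) : Prop where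
  small : IsSmallParameter e
  gapped : GappedFamily Z g h p
  star_eq : ∀ i t, star (H i t) = H i t
  expandable : IsExpandable e Z H
  principal : ∃ H₁, IsExpandable e Z H₁ ∧ ∀ i t, H i t = h t + e i • H₁ i t
  commute : ∀ i, ∀ t ∈ Z, Commute (H i t) (p t)

/-- Unitary frames in which `H` commutes with `p` up to order `m`. -/
structure IsAdaptedFrame (e : ι → ℝ) (Z : Set ℝ) (H : ι → ℝ → 𝔸) (p : ℝ → 𝔸) (m : ℕ)
    (W : ι → ℝ → 𝔸) : Prop where
  mem_unitary : ∀ i t, W i t ∈ unitary 𝔸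
  eq_one : ∀ i, ∀ t ∈ Z, W i t = 1
  near_one : ∃ Y, IsExpandable e Z Y ∧ ∀ i t, W i t = 1 + e i • Y i t
  commutator : ∃ B, IsExpandable e Z B ∧ ∀ i t,
    frameHamiltonian e H (katoForm p) W i t * p t - p t * frameHamiltonian e H (katoForm p) W i t =
      e i ^ (m + 1) • B i t

theorem IsAdaptedFrame.expandable (he : IsSmallParameter e) {H : ι → ℝ → 𝔸} {p : ℝ → 𝔸} {m : ℕ}
    {W : ι → ℝ → 𝔸} (hW : IsAdaptedFrame e Z H p m W) : IsExpandable e Z W := by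
  obtain ⟨Y, hY, hWY⟩ := hW.near_one
  obtain rfl : W = fun i t => 1 + e i • Y i t := funext₂ hWY
  exact (IsExpandable.of_symbol (UnifSymbol.const 1)).add (hY.smul_param he)

namespace AdiabaticData

variable {g : ℝ} {H : ι → ℝ → 𝔸} {h p : ℝ → 𝔸} (hD : AdiabaticData e Z g H h p)
include hD

theorem symbol_p : UnifSymbol Z fun _ : ι => p := hD.gapped.unifSymbol

theorem expandable_h : IsExpandable e Z fun _ : ι => h :=
  IsExpandable.of_symbol (hD.gapped.symbol.comp fun _ => ())

theorem expandable_p : IsExpandable e Z fun _ : ι => p := IsExpandable.of_symbol hD.symbol_p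

theorem mul_self (t : ℝ) : p t * p t = p t := (hD.gapped.proj t).isIdempotentElem

theorem hasDerivAt_p (t : ℝ) : HasDerivAt p (deriv p t) t :=
  (hD.gapped.unifSymbol (ι := Unit)).hasDerivAt () t

theorem deriv_p_eq_zero {t : ℝ} (ht : t ∈ Z) : deriv p t = 0 :=
  (hD.gapped.unifSymbol (ι := Unit)).deriv_eq_zero () ht

theorem symbol_katoForm : UnifSymbol Z fun _ : ι => katoForm p :=
  (hD.symbol_p.mul hD.symbol_p.deriv).sub (hD.symbol_p.deriv.mul hD.symbol_p)

theorem star_katoForm (t : ℝ) : star (katoForm p t) = -katoForm p t := by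
  have h1 := (hD.hasDerivAt_p t).star
  have h2 : (fun t => star (p t)) = p := funext fun t => (hD.gapped.proj t).isSelfAdjoint.star_eq
  rw [h2] at h1
  have h3 := h1.unique (hD.hasDerivAt_p t)
  rw [katoForm, star_sub, star_mul, star_mul, h3, (hD.gapped.proj t).isSelfAdjoint.star_eq, neg_sub]

theorem frameHamiltonian_of_mem {W : ι → ℝ → 𝔸} (hW : UnifSymbol Z W)
    (h1 : ∀ i, ∀ t ∈ Z, W i t = 1) (i : ι) {t : ℝ} (ht : t ∈ Z) :
    frameHamiltonian e H (katoForm p) W i t = H i t := by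
  rw [frameHamiltonian, katoForm, hD.deriv_p_eq_zero ht, hW.deriv_eq_zero i ht, h1 i t ht]
  simp

/-- The induction starts at order one because `[h, p] = 0`; the connection form enters `K` with a
factor `e`. -/
theorem isAdaptedFrame_one : IsAdaptedFrame e Z H p 0 fun _ _ => (1 : 𝔸) := by
  obtain ⟨H₁, hH₁, hH⟩ := hD.principal
  have hX : IsExpandable e Z fun i t => H₁ i t + Complex.I • katoForm p t :=
    hH₁.add ((IsExpandable.of_symbol hD.symbol_katoForm).csmul _)
  refine ⟨fun _ _ => one_mem _, fun _ _ _ => rfl, ⟨fun _ _ => 0,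
    IsExpandable.of_symbol (UnifSymbol.const 0), fun i t => by simp⟩, _,
    (hX.mul hD.small hD.expandable_p).sub (hD.expandable_p.mul hD.small hX), fun i t => ?_⟩
  have e1 : frameHamiltonian e H (katoForm p) (fun _ _ => (1 : 𝔸)) i t =
      h t + e i • (H₁ i t + Complex.I • katoForm p t) := by
    rw [frameHamiltonian, hH]
    simp [add_assoc]
  rw [e1, add_mul, mul_add, (hD.gapped.comm t).eq, add_sub_add_left_eq_sub, smul_mul_assoc,
    mul_smul_comm, ← smul_sub, zero_add, pow_one]

theorem exists_next {m : ℕ} {W : ι → ℝ → 𝔸} (hW : IsAdaptedFrame e Z H p m W) :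
    ∃ W', IsAdaptedFrame e Z H p (m + 1) W' ∧ ∃ Y, UnifSymbol Z Y ∧
      ∀ i t, W' i t = W i t + e i ^ (m + 1) • Y i t := by
  have he := hD.small
  have hWe := hW.expandable he
  have hpe := hD.expandable_p
  obtain ⟨Y₀, hY₀, hWY₀⟩ := hW.near_one
  obtain ⟨B, hB, hKB⟩ := hW.commutator
  obtain ⟨H₁, hH₁, hHH₁⟩ := hD.principal
  obtain ⟨b, B₁, hb, hB₁, hBb⟩ := hB.exists_eq_add_smul he
  have hne : ∀ i (k : ℕ), e i ^ k ≠ 0 := fun i k => pow_ne_zero k (he.pos i).ne'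
  have hpp := hD.mul_self
  have hps : ∀ t, star (p t) = p t := fun t => (hD.gapped.proj t).isSelfAdjoint.star_eq
  set K := frameHamiltonian e H (katoForm p) W with hK
  have hKs : ∀ i t, star (K i t) = K i t := star_frameHamiltonian hD.star_eq hD.star_katoForm
    hW.mem_unitary fun i => hWe.unifSymbol.differentiable i
  -- the leading part of the off-diagonal part of `K`
  set d : ℝ → 𝔸 := fun t => b t * p t - p t * b t with hd
  set D₁ : ι → ℝ → 𝔸 := fun i t => B₁ i t * p t - p t * B₁ i t with hD₁
  have hdu : UnifSymbol Z fun _ : ι => d := (hb.mul hD.symbol_p).sub (hD.symbol_p.mul hb)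
  have hD₁e : IsExpandable e Z D₁ := (hB₁.mul he hpe).sub (hpe.mul he hB₁)
  have hBd : ∀ i t, B i t * p t - p t * B i t = d t + e i • D₁ i t := fun i t => by
    rw [hBb, hd, hD₁]
    simp only [add_mul, mul_add, smul_mul_assoc, mul_smul_comm, smul_sub]
    abel
  -- The error `B` is recovered from its commutator with `p`, because the triple commutator of `K`
  -- with `p` is the simple one.
  have hBp : ∀ i t, B i t = (d t + e i • D₁ i t) * p t - p t * (d t + e i • D₁ i t) := fun i t => by
    have h1 := commutator_commutator_self (hpp t) (K i t)
    rw [hKB] at h1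
    simp only [smul_mul_assoc, mul_smul_comm, ← smul_sub] at h1
    rw [← hBd]
    exact (smul_right_injective 𝔸 (hne i (m + 1)) h1).symm
  have hds : ∀ t, star (d t) = d t := fun t => by
    obtain ⟨C, -, hC⟩ := (hD₁e.star.sub hD₁e).unifSymbol.bdd
    refine sub_eq_zero.1 (he.eq_zero_of_add_smul (y := fun i => star (D₁ i t) - D₁ i t)
      (fun i => hC i t) fun i => ?_)
    have h1 : star (d t + e i • D₁ i t) = d t + e i • D₁ i t := by
      have h2 : star (e i ^ (m + 1) • (B i t * p t - p t * B i t)) =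
          e i ^ (m + 1) • (B i t * p t - p t * B i t) := by
        rw [smul_sub, ← smul_mul_assoc, ← mul_smul_comm, ← hKB]
        simp only [star_sub, star_mul, hKs, hps, sub_mul, mul_sub, mul_assoc]
        abel
      rw [star_smul, star_trivial (e i ^ (m + 1))] at h2
      rw [← hBd]
      exact smul_right_injective 𝔸 (hne i (m + 1)) h2
    rw [star_add, star_smul, star_trivial (e i), ← sub_eq_zero] at h1
    rw [← h1, smul_sub]
    abel
  -- On `Z` the frame Hamiltonian is `H` itself, which commutes with `p`; hence there is nothing to
  -- correct.
  have hdZ : ∀ t ∈ Z, d t = 0 := fun t ht => by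
    obtain ⟨C, -, hC⟩ := hD₁e.unifSymbol.bdd
    refine he.eq_zero_of_add_smul (y := fun i => D₁ i t) (fun i => hC i t) fun i => ?_
    have h1 := hKB i t
    rw [hK, hD.frameHamiltonian_of_mem hWe.unifSymbol hW.eq_one i ht, (hD.commute i t ht).eq,
      sub_self] at h1
    have h2 : B i t = 0 := (smul_eq_zero.1 h1.symm).resolve_left (hne i (m + 1))
    rw [← hBd, h2, zero_mul, mul_zero, sub_zero]
  -- The factor `1 / 2` matches the leading term `2 T` of the Cayley transform.
  obtain ⟨T, hT, hTs, hTd, hT0⟩ := hD.gapped.exists_commutator_eq (hdu.const_smul (1 / 2))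
    (fun t => by rw [star_smul, hds, star_trivial (1 / 2 : ℝ)])
    (fun t => by rw [map_smul, hd, diagOp_commutator (hpp t), smul_zero])
  obtain ⟨V, Y₂, hVu, hY₂, hV, hV1⟩ := exists_cayley he hT hTs m
  set Y : ι → ℝ → 𝔸 := fun i t => (2 : ℝ) • T t + e i • Y₂ i t with hY
  have hTe : IsExpandable e Z fun _ : ι => T := IsExpandable.of_symbol hT
  have hYe : IsExpandable e Z Y := (hTe.const_smul 2).add (hY₂.smul_param he)
  have hVe : IsExpandable e Z V := by
    rw [show V = fun i t => 1 + e i ^ (m + 1) • Y i t from funext₂ hV]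
    exact (IsExpandable.of_symbol (UnifSymbol.const 1)).add (hYe.smul_param_pow he _)
  -- the part of `K` apart from the connection form
  obtain ⟨Q₁, hQ₁, hQ⟩ : ∃ Q₁, IsExpandable e Z Q₁ ∧ ∀ i t, W i t * H i t * star (W i t) +
      e i • Complex.I • (deriv (W i) t * star (W i t)) = h t + e i • Q₁ i t := by
    refine ⟨fun i t => Y₀ i t * H i t * star (W i t) + H₁ i t * star (W i t) + h t * star (Y₀ i t) +
      Complex.I • (deriv (W i) t * star (W i t)), ?_, fun i t => ?_⟩
    · exact ((((hY₀.mul he hD.expandable).mul he hWe.star).add (hH₁.mul he hWe.star)).add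
        (hD.expandable_h.mul he hY₀.star)).add (((hWe.deriv he).mul he hWe.star).csmul _)
    · have e1 : W i t * H i t * star (W i t) =
          h t + e i • (Y₀ i t * H i t * star (W i t) + H₁ i t * star (W i t) +
            h t * star (Y₀ i t)) := by
        have e2 : star (W i t) = 1 + e i • star (Y₀ i t) := by
          rw [hWY₀, star_add, star_one, star_smul, star_trivial (e i)]
        have e3 : W i t * H i t * star (W i t) = H i t * star (W i t) +
            e i • (Y₀ i t * H i t * star (W i t)) := by
          nth_rewrite 1 [hWY₀]
          rw [add_mul, add_mul, one_mul, smul_mul_assoc, smul_mul_assoc]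
        have e4 : H i t * star (W i t) = h t + e i • (h t * star (Y₀ i t)) +
            e i • (H₁ i t * star (W i t)) := by
          nth_rewrite 1 [hHH₁]
          rw [add_mul, smul_mul_assoc]
          congr 1
          rw [e2, mul_add, mul_one, mul_smul_comm]
        rw [e3, e4]
        module
      rw [e1, smul_add _ _ (Complex.I • _), add_assoc]
  set S : ι → ℝ → 𝔸 := fun i t => (2 : ℝ) • (T t * Q₁ i t) + Y₂ i t * (h t + e i • Q₁ i t) -
    (2 : ℝ) • (Q₁ i t * T t) + (h t + e i • Q₁ i t) * star (Y₂ i t) +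
    e i ^ m • (Y i t * (h t + e i • Q₁ i t) * star (Y i t)) +
    Complex.I • (deriv (Y i) t * star (V i t)) with hS
  have hSe : IsExpandable e Z S := by
    have hQe : IsExpandable e Z fun i t => h t + e i • Q₁ i t :=
      hD.expandable_h.add (hQ₁.smul_param he)
    exact ((((((hTe.mul he hQ₁).const_smul 2).add (hY₂.mul he hQe)).sub
      ((hQ₁.mul he hTe).const_smul 2)).add (hQe.mul he hY₂.star)).add
      (((hYe.mul he hQe).mul he hYe.star).smul_param_pow he m)).add
      (((hYe.deriv he).mul he hVe.star).csmul _)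
  have hK' : ∀ i t, frameHamiltonian e H (katoForm p) (fun i t => V i t * W i t) i t =
      K i t - e i ^ (m + 1) • d t + e i ^ (m + 2) • S i t := fun i t => by
    have hVd : deriv (V i) t = e i ^ (m + 1) • deriv (Y i) t := by
      rw [show V i = fun t => 1 + e i ^ (m + 1) • Y i t from funext (hV i)]
      exact (((hYe.unifSymbol.hasDerivAt i t).const_smul _).const_add 1).deriv
    have hVW : deriv (fun t => V i t * W i t) t = deriv (V i) t * W i t + V i t * deriv (W i) t :=
      ((hVe.unifSymbol.hasDerivAt i t).mul (hWe.unifSymbol.hasDerivAt i t)).deriv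
    rw [frameHamiltonian, hVW]
    exact frame_change_identity (Unitary.mem_iff.1 (hW.mem_unitary i t)).2 (hV i t) hVd rfl (hTs t)
      (hTd t) (hQ i t)
  have hWW' : ∀ i t, V i t * W i t = W i t + e i ^ (m + 1) • (Y i t * W i t) := fun i t => by
    rw [hV, add_mul, one_mul, smul_mul_assoc]
  refine ⟨fun i t => V i t * W i t, ⟨fun i t => mul_mem (hVu i t) (hW.mem_unitary i t),
    fun i t ht => ?_, ?_, ?_⟩, _, (hYe.mul he hWe).unifSymbol, hWW'⟩
  · rw [hW.eq_one i t ht, mul_one]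
    refine hV1 i t (hT0 t ?_)
    rw [hdZ t ht, smul_zero]
  · refine ⟨_, hY₀.add ((hYe.mul he hWe).smul_param_pow he m), fun i t => ?_⟩
    rw [hWW', smul_add, smul_smul, ← pow_succ', ← add_assoc, ← hWY₀]
  -- The terms `e^(m+1) [d, p]` cancel, and what remains is `e^(m+2) [D₁ + S, p]`.
  · have hX := hD₁e.add hSe
    refine ⟨_, (hX.mul he hpe).sub (hpe.mul he hX), fun i t => ?_⟩
    have e1 : K i t * p t - p t * K i t = e i ^ (m + 1) •
        ((d t + e i • D₁ i t) * p t - p t * (d t + e i • D₁ i t)) := by rw [hKB, ← hBp]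
    have e2 : (K i t - e i ^ (m + 1) • d t + e i ^ (m + 2) • S i t) * p t -
        p t * (K i t - e i ^ (m + 1) • d t + e i ^ (m + 2) • S i t) =
        (K i t * p t - p t * K i t) - e i ^ (m + 1) • (d t * p t - p t * d t) +
          e i ^ (m + 2) • (S i t * p t - p t * S i t) := by
      simp only [add_mul, mul_add, sub_mul, mul_sub, smul_mul_assoc, mul_smul_comm, smul_sub]
      abel
    rw [hK', e2, e1]
    simp only [add_mul, mul_add, smul_mul_assoc, mul_smul_comm]
    module

/-- Unitary frames that decouple `p` to all orders. -/
theorem exists_adapted_frame : ∃ W : ι → ℝ → 𝔸, (∀ i t, W i t ∈ unitary 𝔸) ∧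
    (∀ i, ∀ t ∈ Z, W i t = 1) ∧ IsExpandable e Z W ∧
    (∃ Y, UnifSymbol Z Y ∧ ∀ i t, W i t = 1 + e i • Y i t) ∧
    ∀ n, ∃ D, UnifSymbol Z D ∧ ∀ i t, frameHamiltonian e H (katoForm p) W i t * p t -
      p t * frameHamiltonian e H (katoForm p) W i t = e i ^ n • D i t := by
  have he := hD.small
  obtain ⟨F, hF, hFY⟩ : ∃ F : ℕ → ι → ℝ → 𝔸, (∀ m, IsAdaptedFrame e Z H p m (F m)) ∧
      ∀ m, ∃ Y, UnifSymbol Z Y ∧ ∀ i t, F (m + 1) i t = F m i t + e i ^ (m + 1) • Y i t := by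
    choose next hnext hY using fun (m : ℕ) (W : {W // IsAdaptedFrame e Z H p m W}) =>
      hD.exists_next W.2
    let F : ∀ m : ℕ, {W // IsAdaptedFrame e Z H p m W} := fun m =>
      Nat.rec ⟨_, hD.isAdaptedFrame_one⟩ (fun m W => ⟨next m W, hnext m W⟩) m
    exact ⟨fun m => (F m).1, fun m => (F m).2, fun m => hY m (F m)⟩
  have hFe := fun m => (hF m).expandable he
  obtain ⟨N, hN⟩ := exists_borel_index he (fun m => (hFe m).unifSymbol) hFY
  have hWe : IsExpandable e Z fun i => F (N i) i := IsExpandable.of_approx fun n => by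
    obtain ⟨D, hDu, h⟩ := hN n
    exact ⟨F n, D, hFe n, hDu, h⟩
  refine ⟨fun i => F (N i) i, fun i => (hF _).mem_unitary i, fun i => (hF _).eq_one i, hWe, ?_,
    fun n => ?_⟩
  · obtain ⟨D, hDu, h⟩ := hN 1
    obtain ⟨Y, hY, hFY⟩ := (hF 1).near_one
    refine ⟨_, hY.unifSymbol.add hDu, fun i t => ?_⟩
    beta_reduce
    rw [h, hFY, pow_one, smul_add, add_assoc]
  -- Replacing `F n` by the Borel sum changes the frame by `e^n D`. As `D'` is bounded as well, the
  -- frame Hamiltonian changes by `O(e^n)` only.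
  · obtain ⟨D, hDu, h⟩ := hN n
    obtain ⟨B, hB, hKB⟩ := (hF n).commutator
    have hpu := hD.symbol_p
    have hHu := hD.expandable.unifSymbol
    have hFu := (hFe n).unifSymbol
    have hWu := hWe.unifSymbol
    set X : ι → ℝ → 𝔸 := fun i t => D i t * H i t * star (F (N i) i t) +
      F n i t * H i t * star (D i t) + e i • Complex.I • (deriv (D i) t * star (F (N i) i t) +
        deriv (F n i) t * star (D i t)) with hX
    have hXu : UnifSymbol Z X := (((hDu.mul hHu).mul hWu.star).add ((hFu.mul hHu).mul hDu.star)).add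
      ((((hDu.deriv.mul hWu.star).add (hFu.deriv.mul hDu.star)).csmul _).smul_family e he.bdd)
    have hKX : ∀ i t, frameHamiltonian e H (katoForm p) (fun i => F (N i) i) i t =
        frameHamiltonian e H (katoForm p) (F n) i t + e i ^ n • X i t := fun i t => by
      have h1 : deriv (F (N i) i) t = deriv (F n i) t + e i ^ n • deriv (D i) t := by
        rw [show F (N i) i = fun t => F n i t + e i ^ n • D i t from funext (h i)]
        exact ((hFu.hasDerivAt i t).add ((hDu.hasDerivAt i t).const_smul _)).deriv
      have h2 : star (F (N i) i t) = star (F n i t) + e i ^ n • star (D i t) := by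
        rw [h, star_add, star_smul, star_trivial (e i ^ n)]
      have h3 : F (N i) i t * H i t * star (F (N i) i t) = F n i t * H i t * star (F n i t) +
          e i ^ n • (D i t * H i t * star (F (N i) i t) + F n i t * H i t * star (D i t)) := by
        nth_rewrite 1 [h i t]
        rw [add_mul, add_mul]
        nth_rewrite 1 [h2]
        simp only [mul_add, smul_mul_assoc, mul_smul_comm]
        module
      have h4 : deriv (F (N i) i) t * star (F (N i) i t) = deriv (F n i) t * star (F n i t) +
          e i ^ n • (deriv (D i) t * star (F (N i) i t) + deriv (F n i) t * star (D i t)) := by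
        rw [h1, add_mul]
        nth_rewrite 1 [h2]
        simp only [mul_add, smul_mul_assoc, mul_smul_comm]
        module
      rw [frameHamiltonian, frameHamiltonian, h3, h4, hX]
      simp only [smul_add]
      rw [smul_comm Complex.I (e i ^ n), smul_comm Complex.I (e i ^ n), smul_comm (e i) (e i ^ n),
        smul_comm (e i) (e i ^ n)]
      abel
    refine ⟨_, (hB.unifSymbol.smul_family e he.bdd).add ((hXu.mul hpu).sub (hpu.mul hXu)),
      fun i t => ?_⟩
    have h5 := hKB i t
    clear_value X
    rw [sub_eq_iff_eq_add] at h5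
    rw [hKX, add_mul, mul_add, h5, smul_add, smul_smul, ← pow_succ, smul_sub, smul_mul_assoc,
      mul_smul_comm]
    abel

end AdiabaticData

end Adiabatic

/-! ### Passage between the two notions of expansion, and the value at `ε = 0` -/

section SymbolExpansions

variable {E : Type*} [NormedAddCommGroup E] [NormedSpace ℝ E] {ε₀ : ℝ} {Z : Set ℝ}

theorem isSmallParameter_Ioo (hε₀ : 0 < ε₀) :
    IsSmallParameter fun i : Set.Ioo 0 ε₀ => (i : ℝ) where
  pos i := i.2.1
  bdd := ⟨ε₀, fun i => by rw [abs_of_pos i.2.1]; exact i.2.2.le⟩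
  small δ hδ := by
    have h : 0 < min δ ε₀ / 2 := by positivity
    refine ⟨⟨min δ ε₀ / 2, h, ?_⟩, ?_⟩
    · linarith [min_le_right δ ε₀]
    · change min δ ε₀ / 2 < δ
      linarith [min_le_left δ ε₀]

theorem HasSymbolExpansion.zero (hε₀ : 0 < ε₀) {A : ℝ → ℝ → E} {a : ℕ → ℝ → E}
    (h : HasSymbolExpansion ε₀ A a) : A 0 = a 0 := by
  obtain ⟨C, hC⟩ := h.remainder 1 0
  funext t
  have := hC 0 ⟨le_rfl, hε₀⟩ t
  simpa [sub_eq_zero] using this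

theorem HasSymbolExpansion.iteratedDeriv_remainder {A : ℝ → ℝ → E} {a : ℕ → ℝ → E}
    (h : HasSymbolExpansion ε₀ A a) {ε : ℝ} (hε : ε ∈ Set.Ico 0 ε₀) (n k : ℕ) (t : ℝ) :
    iteratedDeriv k (fun τ => A ε τ - ∑ j ∈ Finset.range n, ε ^ j • a j τ) t =
      iteratedDeriv k (A ε) t - ∑ j ∈ Finset.range n, ε ^ j • iteratedDeriv k (a j) t := by
  have hle : ((k : ℕ∞) : WithTop ℕ∞) ≤ ∞ := by exact_mod_cast le_top
  have ha : ∀ j, ContDiffAt ℝ k (fun τ => ε ^ j • a j τ) t := fun j =>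
    (((h.coeff j).smooth.const_smul _).of_le hle).contDiffAt
  rw [iteratedDeriv_fun_sub (((h.symbol ε hε).smooth.of_le hle).contDiffAt)
    (ContDiffAt.sum fun j _ => ha j), iteratedDeriv_fun_sum fun j _ => ha j]
  simp only [iteratedDeriv_fun_const_smul_field]

/-- At times where all derivatives of a symbol vanish, so do those of its coefficients. -/
theorem HasSymbolExpansion.iteratedDeriv_coeff_eq_zero (hε₀ : 0 < ε₀) {A : ℝ → ℝ → E}
    {a : ℕ → ℝ → E} (h : HasSymbolExpansion ε₀ A a) {t : ℝ} {k : ℕ}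
    (hA : ∀ ε ∈ Set.Ico 0 ε₀, iteratedDeriv k (A ε) t = 0) (j : ℕ) :
    iteratedDeriv k (a j) t = 0 := by
  induction j using Nat.strong_induction_on with
  | _ j ih =>
    obtain ⟨C, hC⟩ := h.remainder (j + 1) k
    refine (isSmallParameter_Ioo hε₀).eq_zero_of_norm_le (C := C) fun i => ?_
    have hi : (i : ℝ) ∈ Set.Ico 0 ε₀ := ⟨i.2.1.le, i.2.2⟩
    have h1 := hC i hi t
    rw [h.iteratedDeriv_remainder hi, hA i hi, Finset.sum_range_succ, Finset.sum_eq_zero, zero_add,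
      zero_sub, norm_neg, norm_smul, Real.norm_of_nonneg (pow_nonneg hi.1 j), pow_succ,
      mul_left_comm] at h1
    · exact le_of_mul_le_mul_left h1 (pow_pos i.2.1 j)
    · intro l hl
      rw [ih l (Finset.mem_range.1 hl), smul_zero]

theorem HasSymbolExpansion.expands (hε₀ : 0 < ε₀) {A : ℝ → ℝ → E} {a : ℕ → ℝ → E}
    (h : HasSymbolExpansion ε₀ A a)
    (hZ : ∀ t ∈ Z, ∀ ε ∈ Set.Ico 0 ε₀, ∀ k, 1 ≤ k → iteratedDeriv k (A ε) t = 0) (n : ℕ) :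
    Expands (fun i : Set.Ioo 0 ε₀ => (i : ℝ)) Z n (fun i => A i) a := by
  have hmem : ∀ i : Set.Ioo 0 ε₀, (i : ℝ) ∈ Set.Ico 0 ε₀ := fun i => ⟨i.2.1.le, i.2.2⟩
  have hZa : ∀ j, ∀ t ∈ Z, ∀ k, 1 ≤ k → iteratedDeriv k (a j) t = 0 := fun j t ht k hk =>
    h.iteratedDeriv_coeff_eq_zero hε₀ (fun ε hε => hZ t ht ε hε k hk) j
  refine Expands.of_remainder (isSmallParameter_Ioo hε₀)
    (fun j => (h.coeff j).unifSymbol (hZa j)) (fun m => ?_) n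
  refine unifCb_of_iteratedDeriv (fun i => ?_) (fun k => ?_) fun i t ht k hk => ?_
  · exact ((h.symbol i (hmem i)).smooth.sub
      (ContDiff.sum fun j _ => (h.coeff j).smooth.const_smul _)).const_smul _
  · obtain ⟨C, hC⟩ := h.remainder m k
    refine ⟨C, fun i t => ?_⟩
    rw [iteratedDeriv_fun_const_smul_field, norm_smul, norm_inv,
      Real.norm_of_nonneg (pow_nonneg (hmem i).1 m), inv_mul_le_iff₀ (pow_pos i.2.1 m), mul_comm]
    exact hC i (hmem i) t
  · rw [iteratedDeriv_fun_const_smul_field, h.iteratedDeriv_remainder (hmem i), hZ t ht i (hmem i) k hk,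
      Finset.sum_eq_zero fun j _ => by rw [hZa j t ht k hk, smul_zero], sub_zero, smul_zero]

/-- Extension of a family on `(0, ε₀)` by a given value elsewhere. -/
noncomputable def extendIoo {X : Type*} (ε₀ : ℝ) (A : Set.Ioo 0 ε₀ → X) (a : X) (ε : ℝ) : X :=
  open Classical in if h : ε ∈ Set.Ioo 0 ε₀ then A ⟨ε, h⟩ else a

theorem extendIoo_coe {X : Type*} (A : Set.Ioo 0 ε₀ → X) (a : X) (i : Set.Ioo 0 ε₀) :
    extendIoo ε₀ A a i = A i := dif_pos i.2

theorem extendIoo_zero {X : Type*} (A : Set.Ioo 0 ε₀ → X) (a : X) : extendIoo ε₀ A a 0 = a :=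
  dif_neg fun h => lt_irrefl _ h.1

theorem forall_mem_Ico_iff (hε₀ : 0 < ε₀) {P : ℝ → Prop} :
    (∀ ε ∈ Set.Ico 0 ε₀, P ε) ↔ P 0 ∧ ∀ i : Set.Ioo 0 ε₀, P i := by
  refine ⟨fun h => ⟨h 0 ⟨le_rfl, hε₀⟩, fun i => h i ⟨i.2.1.le, i.2.2⟩⟩, fun h ε hε => ?_⟩
  rcases hε.1.eq_or_lt with rfl | hpos
  · exact h.1
  · exact h.2 ⟨ε, hpos, hε.2⟩

theorem hasSymbolExpansion_extendIoo (hε₀ : 0 < ε₀) {A : Set.Ioo 0 ε₀ → ℝ → E} {a : ℕ → ℝ → E}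
    (h : ∀ n, Expands (fun i : Set.Ioo 0 ε₀ => (i : ℝ)) Z n A a) :
    HasSymbolExpansion ε₀ (extendIoo ε₀ A (a 0)) a := by
  have hne : Nonempty (Set.Ioo 0 ε₀) := (Set.nonempty_Ioo.2 hε₀).to_subtype
  have hs : ∀ j, IsSymbol (a j) := fun j =>
    (((h (j + 1)).remainder.1 j j.lt_succ_self).isSymbol hne.some)
  refine ⟨(forall_mem_Ico_iff hε₀).2 ⟨?_, fun i => ?_⟩, hs, fun n k => ?_⟩
  · rw [extendIoo_zero]
    exact hs 0
  · rw [extendIoo_coe]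
    exact UnifSymbol.isSymbol (h 0) i
  · obtain ⟨-, R, hR, hAR⟩ := (h n).remainder
    obtain ⟨C, hC0, hC⟩ := hR.iteratedDeriv_bdd k
    obtain ⟨C₀, hC₀⟩ := (hs 0).bounded k
    -- The constant `C₀` serves the case `ε = 0`, `n = 0`, where `0 ^ 0 = 1` and the leading
    -- coefficient itself must be bounded; for `n ≥ 1` the remainder at `ε = 0` is zero.
    refine ⟨max C C₀, (forall_mem_Ico_iff hε₀).2 ⟨fun t => ?_, fun i t => ?_⟩⟩
    · rw [extendIoo_zero]
      cases n with
      | zero => simpa using Or.inr (hC₀ t)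
      | succ n => simp [Finset.sum_range_succ']
    · rw [extendIoo_coe]
      simp only [hAR, add_sub_cancel_left]
      rw [iteratedDeriv_fun_const_smul_field, norm_smul, Real.norm_of_nonneg (pow_nonneg i.2.1.le n),
        mul_comm]
      exact mul_le_mul_of_nonneg_right ((hC i t).trans (le_max_left _ _)) (pow_nonneg i.2.1.le n)

end SymbolExpansions

/-! ### Propagators and Duhamel's formula -/

section Propagators

variable {𝔸 : Type*} [CStarAlgebra 𝔸]

theorem star_inv_I_mul (ε : ℝ) : star ((Complex.I * (ε : ℂ))⁻¹) = -(Complex.I * (ε : ℂ))⁻¹ := by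
  rw [Complex.star_def, map_inv₀, map_mul, Complex.conj_I, Complex.conj_ofReal, neg_mul, inv_neg]

theorem norm_inv_I_mul {ε : ℝ} (hε : 0 < ε) : ‖(Complex.I * (ε : ℂ))⁻¹‖ = ε⁻¹ := by
  rw [norm_inv, norm_mul, Complex.norm_I, one_mul, Complex.norm_real, Real.norm_of_nonneg hε.le]

/-- **Duhamel's formula**, as an estimate. -/
theorem norm_duhamel_le {X Y A B : ℝ → 𝔸} {ε M : ℝ} (hε : 0 < ε) (hX : ∀ t, X t ∈ unitary 𝔸)
    (hY : ∀ t, Y t ∈ unitary 𝔸) (hA : ∀ t, star (A t) = A t)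
    (hX' : ∀ t, HasDerivAt X ((Complex.I * (ε : ℂ))⁻¹ • (A t * X t)) t)
    (hY' : ∀ t, HasDerivAt Y ((Complex.I * (ε : ℂ))⁻¹ • (B t * Y t)) t) (R : 𝔸)
    (hM : ∀ t, ‖R * B t - A t * R‖ ≤ M) (t s : ℝ) :
    ‖star (X t) * R * Y t - star (X s) * R * Y s‖ ≤ ε⁻¹ * M * |t - s| := by
  have hd : ∀ t, HasDerivAt (fun t => star (X t) * R * Y t)
      ((Complex.I * (ε : ℂ))⁻¹ • (star (X t) * ((R * B t - A t * R) * Y t))) t := fun t => by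
    have h1 := ((hX' t).star.mul_const R).mul (hY' t)
    refine h1.congr_deriv ?_
    rw [star_smul, star_mul, hA, star_inv_I_mul]
    simp only [neg_smul, smul_mul_assoc, mul_smul_comm, sub_mul, mul_sub, smul_sub, mul_assoc,
      neg_mul]
    abel
  refine Convex.norm_image_sub_le_of_norm_deriv_le (fun x _ => (hd x).differentiableAt)
    (fun x _ => ?_) convex_univ (Set.mem_univ s) (Set.mem_univ t)
  rw [(hd x).deriv, norm_smul, norm_inv_I_mul hε,
    CStarRing.norm_mem_unitary_mul _ (Unitary.star_mem (hX x)),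
    CStarRing.norm_mul_mem_unitary _ (hY x)]
  exact mul_le_mul_of_nonneg_left (hM x) (inv_nonneg.2 hε.le)

variable {𝓗 : Type*} [NormedAddCommGroup 𝓗] [InnerProductSpace ℂ 𝓗] [CompleteSpace 𝓗]

theorem exists_propagator {ε M : ℝ} {A : ℝ → 𝓗 →L[ℂ] 𝓗} (hA : Continuous A)
    (hM : ∀ t, ‖A t‖ ≤ M) (hsa : ∀ t, star (A t) = A t) :
    ∃ U : ℝ → ℝ → 𝓗 →L[ℂ] 𝓗, IsPropagatorOf ε A U ∧ ∀ s t,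
      HasDerivAt (fun τ => U τ s) ((Complex.I * (ε : ℂ))⁻¹ • (A t * U t s)) t := by
  set c : ℂ := (Complex.I * (ε : ℂ))⁻¹ with hc
  obtain ⟨Φ, h0, hu, hd⟩ := exists_unitary_evolution (G := fun t => c • A t) (hA.const_smul c)
    (M := ‖c‖ * M) (fun t => (norm_smul_le _ _).trans
      (mul_le_mul_of_nonneg_left (hM t) (norm_nonneg c)))
    (fun t => by rw [star_smul, hsa, hc, star_inv_I_mul, neg_smul])
  have hΦc : Continuous Φ := continuous_iff_continuousAt.2 fun t => (hd t).continuousAt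
  have hud : ∀ s t, HasDerivAt (fun τ => Φ τ * star (Φ s)) (c • (A t * (Φ t * star (Φ s)))) t :=
    fun s t => by
      have := (hd t).mul_const (star (Φ s))
      rwa [smul_mul_assoc, smul_mul_assoc, mul_assoc] at this
  have hsol : ∀ s t (ψ : 𝓗), HasDerivAt (fun τ => (Φ τ * star (Φ s)) ψ)
      (c • A t ((Φ t * star (Φ s)) ψ)) t := fun s t ψ => by
    have := (((ContinuousLinearMap.apply ℂ 𝓗 ψ).restrictScalars ℝ).hasFDerivAt).comp_hasDerivAt t
      (hud s t)
    exact this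
  have hdiag : ∀ s, Φ s * star (Φ s) = 1 := fun s => (Unitary.mem_iff.1 (hu s)).2
  refine ⟨fun t s => Φ t * star (Φ s), ⟨⟨fun t s => mul_mem (hu t) (Unitary.star_mem (hu s)),
    fun ψ => ?_, hdiag, fun t r s => ?_⟩, ⟨hdiag, hsol⟩, fun V hV => ?_⟩, hud⟩
  · have : Continuous fun q : ℝ × ℝ => Φ q.1 * star (Φ q.2) :=
      (hΦc.comp continuous_fst).mul (hΦc.comp continuous_snd).star
    exact this.clm_apply continuous_const
  · rw [mul_assoc, ← mul_assoc (star (Φ r)), (Unitary.mem_iff.1 (hu r)).1, one_mul]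
  · funext t s
    ext ψ
    -- A competitor `V` is only a strong solution, so uniqueness is applied to each orbit in `𝓗`.
    have hlip : ∀ t, LipschitzOnWith (Real.toNNReal (‖c‖ * M)) (fun x : 𝓗 => c • A t x) Set.univ :=
      fun t => by
        refine LipschitzOnWith.of_dist_le_mul fun x _ y _ => ?_
        have hM0 : 0 ≤ M := (norm_nonneg _).trans (hM t)
        rw [dist_eq_norm, dist_eq_norm, Real.coe_toNNReal _ (by positivity), ← smul_sub, ← map_sub,
          norm_smul, mul_assoc]
        exact mul_le_mul_of_nonneg_left (((A t).le_opNorm _).trans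
          (mul_le_mul_of_nonneg_right (hM t) (norm_nonneg _))) (norm_nonneg c)
    have := ODE_solution_unique_univ (t₀ := s) hlip (f := fun τ => V τ s ψ)
      (g := fun τ => (Φ τ * star (Φ s)) ψ) (fun t => ⟨hV.2 s t ψ, Set.mem_univ _⟩)
      (fun t => ⟨hsol s t ψ, Set.mem_univ _⟩) (by rw [hV.1, hdiag])
    exact congrFun this t

end Propagators

/-! ### Expansion of the effective Hamiltonian -/

section EffectiveHamiltonian

variable {𝓗 : Type*} [NormedAddCommGroup 𝓗] [InnerProductSpace ℂ 𝓗] [CompleteSpace 𝓗]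
  {ι : Type*} {Z : Set ℝ} {e : ι → ℝ}

/-- The Hamiltonian in the frame given by `V`, in symmetrized form. -/
noncomputable def movingHamiltonian (e : ι → ℝ) (H V : ι → ℝ → 𝓗 →L[ℂ] 𝓗) (i : ι) (t : ℝ) :
    𝓗 →L[ℂ] 𝓗 :=
  V i t * (H i t * star (V i t)) + e i • (Complex.I / 2) •
    (deriv (V i) t * star (V i t) - V i t * deriv (fun τ => star (V i τ)) t)

theorem Expands.sub {E : Type*} [NormedAddCommGroup E] [NormedSpace ℝ E] {n : ℕ} {A B : ι → ℝ → E}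
    {a b : ℕ → ℝ → E} (hA : Expands e Z n A a) (hB : Expands e Z n B b) :
    Expands e Z n (fun i t => A i t - B i t) fun j t => a j t - b j t := by
  simpa [sub_eq_add_neg] using hA.add (hB.clm (-ContinuousLinearMap.id ℝ E))

theorem expands_movingHamiltonian (he : IsSmallParameter e) {H V : ι → ℝ → 𝓗 →L[ℂ] 𝓗}
    {Hc uc : ℕ → ℝ → 𝓗 →L[ℂ] 𝓗} {n : ℕ} (hH : Expands e Z n H Hc) (hV : Expands e Z n V uc) :
    Expands e Z n (movingHamiltonian e H V) (effectiveCoeff Hc uc) := by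
  have h1 := hV.mul he (hH.mul he hV.star)
  have h2 := (((hV.deriv he).mul he hV.star).sub (hV.mul he (hV.star.deriv he))).clm
    ((Complex.I / 2) • ContinuousLinearMap.id ℝ (𝓗 →L[ℂ] 𝓗))
  refine (h1.add (h2.smul_param.pred he)).congr_coeff fun j _ => funext fun t => ?_
  rw [effectiveCoeff]
  refine congrArg₂ (· + ·) ?_ ?_
  · simp only [Finset.mul_sum, mul_assoc]
  -- The prefactor `e` shifts the derivative terms by one order: none at order zero, and at order `j
  -- + 1` the pairs with sum `j`.
  · cases j with
    | zero => simp
    | succ j =>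
      have hset : ((Finset.range (j + 1) ×ˢ Finset.range (j + 1)).filter
          fun p => p.1 + p.2 + 1 = j + 1) = Finset.HasAntidiagonal.antidiagonal j := by
        ext p
        simp only [Finset.mem_filter, Finset.mem_product, Finset.mem_range,
          Finset.HasAntidiagonal.mem_antidiagonal]
        omega
      rw [hset, Finset.sum_sub_distrib]
      rfl

end EffectiveHamiltonian

/-! ### Change of frame and diagonal parts -/

section Main

variable {𝓗 : Type*} [NormedAddCommGroup 𝓗] [InnerProductSpace ℂ 𝓗] [CompleteSpace 𝓗]

theorem unitary_conj_identity {R : Type*} [Ring R] [StarRing R] {u p q : R} (hu : u ∈ unitary R)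
    (h : u * p * star u = q) : u * p = q * u ∧ star u * q = p * star u ∧ star u * q * u = p := by
  have h1 := (Unitary.mem_iff.1 hu).1
  refine ⟨?_, ?_, ?_⟩
  · rw [← h, mul_assoc _ (star u), h1, mul_one]
  · rw [← h, ← mul_assoc, ← mul_assoc, h1, one_mul]
  · rw [← h, mul_assoc, mul_assoc _ (star u), h1, mul_one, ← mul_assoc, h1, one_mul]

theorem mul_deriv_star_of_unitary {V : ℝ → 𝓗 →L[ℂ] 𝓗} (hV : ∀ t, V t ∈ unitary (𝓗 →L[ℂ] 𝓗))
    (hd : Differentiable ℝ V) (t : ℝ) :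
    V t * deriv (fun τ => star (V τ)) t = -(deriv V t * star (V t)) := by
  rw [(hd t).hasDerivAt.star.deriv]
  exact deriv_mul_star_of_unitary hV hd t

variable {ι : Type*} {Z : Set ℝ} {e : ι → ℝ} {H V : ι → ℝ → 𝓗 →L[ℂ] 𝓗}

theorem movingHamiltonian_eq (hV : ∀ i t, V i t ∈ unitary (𝓗 →L[ℂ] 𝓗))
    (hd : ∀ i, Differentiable ℝ (V i)) (i : ι) (t : ℝ) :
    movingHamiltonian e H V i t =
      V i t * H i t * star (V i t) + e i • Complex.I • (deriv (V i) t * star (V i t)) := by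
  rw [movingHamiltonian, mul_deriv_star_of_unitary (hV i) (hd i), sub_neg_eq_add, ← two_smul ℂ,
    smul_smul, div_mul_cancel₀ _ two_ne_zero, mul_assoc]

theorem star_movingHamiltonian (hH : ∀ i t, star (H i t) = H i t)
    (hV : ∀ i t, V i t ∈ unitary (𝓗 →L[ℂ] 𝓗)) (hd : ∀ i, Differentiable ℝ (V i)) (i : ι) (t : ℝ) :
    star (movingHamiltonian e H V i t) = movingHamiltonian e H V i t := by
  have h1 := star_frameHamiltonian (e := e) (a := fun _ => 0) hH (fun _ => by simp) hV hd i t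
  rw [movingHamiltonian_eq hV hd]
  simpa only [frameHamiltonian, zero_add] using h1

/-- Composition of frames: because `u' = u a`, the derivative of `u` contributes exactly the
connection form `a`, conjugated by `u`. -/
theorem movingHamiltonian_mul {u a : ℝ → 𝓗 →L[ℂ] 𝓗} {W : ι → ℝ → 𝓗 →L[ℂ] 𝓗}
    (hu : ∀ t, u t ∈ unitary (𝓗 →L[ℂ] 𝓗)) (hu' : ∀ t, HasDerivAt u (u t * a t) t)
    (hW : ∀ i t, W i t ∈ unitary (𝓗 →L[ℂ] 𝓗)) (hd : ∀ i, Differentiable ℝ (W i)) (i : ι) (t : ℝ) :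
    movingHamiltonian e H (fun i t => u t * W i t) i t =
      u t * frameHamiltonian e H a W i t * star (u t) := by
  have hV : ∀ i t, HasDerivAt (fun t => u t * W i t) (u t * a t * W i t + u t * deriv (W i) t) t :=
    fun i t => (hu' t).mul (hd i t).hasDerivAt
  rw [movingHamiltonian_eq (fun i t => mul_mem (hu t) (hW i t))
    fun i t => (hV i t).differentiableAt, (hV i t).deriv, frameHamiltonian]
  have h1 : (u t * a t * W i t + u t * deriv (W i) t) * star (u t * W i t) =
      u t * (a t * (W i t * star (W i t)) + deriv (W i) t * star (W i t)) * star (u t) := by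
    rw [star_mul]
    noncomm_ring
  rw [h1, (Unitary.mem_iff.1 (hW i t)).2, mul_one, star_mul]
  simp only [mul_add, add_mul, mul_smul_comm, smul_mul_assoc, mul_assoc]

theorem hasDerivAt_moving_propagator {ε : ℝ} (hε : ε ≠ 0) {H V U : ℝ → 𝓗 →L[ℂ] 𝓗}
    (hV : ∀ t, V t ∈ unitary (𝓗 →L[ℂ] 𝓗)) (hd : Differentiable ℝ V) (w : 𝓗 →L[ℂ] 𝓗)
    (hU : ∀ t, HasDerivAt U ((Complex.I * (ε : ℂ))⁻¹ • (H t * U t)) t) (t : ℝ) :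
    HasDerivAt (fun t => V t * U t * w) ((Complex.I * (ε : ℂ))⁻¹ •
      ((V t * H t * star (V t) + ε • Complex.I • (deriv V t * star (V t))) * (V t * U t * w))) t := by
  refine (((hd t).hasDerivAt.mul (hU t)).mul_const w).congr_deriv ?_
  have h1 : star (V t) * V t = 1 := (Unitary.mem_iff.1 (hV t)).1
  have h2 : ∀ x : 𝓗 →L[ℂ] 𝓗, star (V t) * (V t * x) = x := fun x => by
    rw [← mul_assoc, h1, one_mul]
  have h3 : (Complex.I * (ε : ℂ))⁻¹ • ε • Complex.I • (deriv V t * U t * w) =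
      deriv V t * U t * w := by
    rw [smul_comm ε, ← Complex.coe_smul ε, smul_smul Complex.I, inv_smul_smul₀]
    exact mul_ne_zero Complex.I_ne_zero (Complex.ofReal_ne_zero.2 hε)
  simp only [add_mul, smul_add, smul_mul_assoc, mul_smul_comm, mul_assoc, h2] at h3 ⊢
  rw [h3, add_comm]

/-- The diagonal part of an operator that almost commutes with a projection. -/
theorem diagOp_eq_add {e : ι → ℝ} {K : ι → ℝ → 𝓗 →L[ℂ] 𝓗} {q : 𝓗 →L[ℂ] 𝓗} (hq : q * q = q) {n : ℕ}
    (hK : ∃ D, UnifSymbol Z D ∧ ∀ i t, K i t * q - q * K i t = e i ^ n • D i t) :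
    ∃ D, UnifSymbol Z D ∧ ∀ i t, diagOp q (K i t) = K i t + e i ^ n • D i t := by
  obtain ⟨D, hD, h⟩ := hK
  have hqu : UnifSymbol Z fun (_ : ι) (_ : ℝ) => q := UnifSymbol.const q
  refine ⟨_, ((hD.mul hqu).sub (hqu.mul hD)).neg, fun i t => ?_⟩
  have h1 : ∀ x : 𝓗 →L[ℂ] 𝓗, q * (q * x) = q * x := fun x => by rw [← mul_assoc, hq]
  have h2 : diagOp q (K i t) = K i t -
      ((K i t * q - q * K i t) * q - q * (K i t * q - q * K i t)) := by
    rw [diagOp_apply]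
    simp only [sub_mul, mul_sub, mul_assoc, hq, h1, mul_one, one_mul]
    abel
  rw [h2, h, smul_neg, smul_sub, smul_mul_assoc, mul_smul_comm, ← sub_eq_add_neg]

theorem commute_diagOp {q : 𝓗 →L[ℂ] 𝓗} (hq : q * q = q) (x : 𝓗 →L[ℂ] 𝓗) : Commute (diagOp q x) q := by
  have h1 : ∀ x : 𝓗 →L[ℂ] 𝓗, q * (q * x) = q * x := fun x => by rw [← mul_assoc, hq]
  rw [Commute, SemiconjBy, diagOp_apply]
  simp only [add_mul, mul_add, sub_mul, mul_sub, mul_assoc, hq, h1, mul_one, one_mul]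
  abel

theorem star_diagOp {q x : 𝓗 →L[ℂ] 𝓗} (hq : star q = q) (hx : star x = x) :
    star (diagOp q x) = diagOp q x := by
  simp only [diagOp_apply, star_add, star_mul, star_sub, star_one, hq, hx, mul_assoc]

end Main

theorem isStarProjection_star_mul_mul {R : Type*} [Ring R] [StarRing R] {v q : R}
    (hv : v ∈ unitary R) (hq : IsStarProjection q) : IsStarProjection (star v * q * v) where
  isIdempotentElem := by
    have h1 := (Unitary.mem_iff.1 hv).2
    have h2 : q * q = q := hq.isIdempotentElem
    calc star v * q * v * (star v * q * v) = star v * q * (v * star v) * q * v := by noncomm_ring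
      _ = star v * q * v := by rw [h1, mul_one, mul_assoc (star v), h2]
  isSelfAdjoint := by
    have h1 : star q = q := hq.isSelfAdjoint
    rw [isSelfAdjoint_iff, star_mul, star_mul, star_star, h1, mul_assoc]

theorem mul_star_mul_mul_star {R : Type*} [Monoid R] [StarMul R] {v : R} (hv : v ∈ unitary R)
    (q : R) : v * (star v * q * v) * star v = q := by
  have h1 := (Unitary.mem_iff.1 hv).2
  rw [mul_assoc, mul_assoc, h1, mul_one, ← mul_assoc, h1, one_mul]

/-! ### The time-adiabatic theorem -/

theorem mainTheorem4 {𝓗 : Type*} [NormedAddCommGroup 𝓗] [InnerProductSpace ℂ 𝓗] [CompleteSpace 𝓗]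
    (ε₀ : ℝ) (hε₀ : 0 < ε₀)
    (H : ℝ → ℝ → 𝓗 →L[ℂ] 𝓗) (Hc : ℕ → ℝ → 𝓗 →L[ℂ] 𝓗)
    (hsa : ∀ ε ∈ Set.Ico 0 ε₀, ∀ t, IsSelfAdjoint (H ε t))
    (hH : HasSymbolExpansion ε₀ H Hc)
    (σr : ℝ → Set ℝ) (hgap : UniformGap (Hc 0) σr)
    (π₀ : ℝ → 𝓗 →L[ℂ] 𝓗) (hπ₀ : ∀ t, π₀ t = spectralProjection (Hc 0 t) (σr t)) :
    ∃ U : ℝ → ℝ → ℝ → 𝓗 →L[ℂ] 𝓗,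
      (∀ ε ∈ Set.Ioo 0 ε₀, IsPropagatorOf ε (H ε) (U ε)) ∧
      -- decoupled subspace
      ∃ P : ℝ → ℝ → 𝓗 →L[ℂ] 𝓗,
        ((∀ ε ∈ Set.Ico 0 ε₀, ∀ t, IsStarProjection (P ε t)) ∧
          IsSemiclassicalSymbol ε₀ P ∧
          IsOrderEps ε₀ (fun ε t => P ε t - π₀ t) ∧
          IsOrderEpsInfty ε₀ (fun ε t s => star (U ε t s) * P ε t * U ε t s - P ε s) ∧
          ∀ t, (∀ ε ∈ Set.Ico 0 ε₀, ∀ α : ℕ, 1 ≤ α → iteratedDeriv α (H ε) t = 0) →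
            (∀ ε ∈ Set.Ico 0 ε₀, Commute (H ε t) (π₀ t)) →
            ∀ ε ∈ Set.Ico 0 ε₀, P ε t = π₀ t) ∧
        -- intertwining unitaries
        ∃ (u₀ : ℝ → 𝓗 →L[ℂ] 𝓗) (W : ℝ → ℝ → 𝓗 →L[ℂ] 𝓗) (uc : ℕ → ℝ → 𝓗 →L[ℂ] 𝓗),
          ((∀ t, u₀ t ∈ unitary (𝓗 →L[ℂ] 𝓗)) ∧
            IsSymbol u₀ ∧
            (∀ t, u₀ t * π₀ t * star (u₀ t) = π₀ 0) ∧
            (∀ ε ∈ Set.Ico 0 ε₀, ∀ t, W ε t ∈ unitary (𝓗 →L[ℂ] 𝓗)) ∧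
            HasSymbolExpansion ε₀ W uc ∧
            (∀ ε ∈ Set.Ico 0 ε₀, ∀ t, W ε t * P ε t * star (W ε t) = π₀ 0) ∧
            IsOrderEps ε₀ (fun ε t => W ε t - u₀ t)) ∧
          -- effective dynamics
          ∃ (h : ℝ → ℝ → 𝓗 →L[ℂ] 𝓗) (Ueff : ℝ → ℝ → ℝ → 𝓗 →L[ℂ] 𝓗),
            (∀ ε ∈ Set.Ico 0 ε₀, ∀ t, IsSelfAdjoint (h ε t)) ∧
            (∀ ε ∈ Set.Ico 0 ε₀, ∀ t, Commute (h ε t) (π₀ 0)) ∧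
            HasSymbolExpansion ε₀ h (effectiveCoeff Hc uc) ∧
            (∀ ε ∈ Set.Ioo 0 ε₀, IsPropagatorOf ε (h ε) (Ueff ε)) ∧
            IsOrderEpsInfty ε₀
              (fun ε t s => U ε t s - star (W ε t) * Ueff ε t s * W ε s) := by
  set Z : Set ℝ := {t | (∀ ε ∈ Set.Ico 0 ε₀, ∀ α : ℕ, 1 ≤ α → iteratedDeriv α (H ε) t = 0) ∧
    ∀ ε ∈ Set.Ico 0 ε₀, Commute (H ε t) (π₀ t)}
  set e : Set.Ioo 0 ε₀ → ℝ := fun i => (i : ℝ)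
  have he : IsSmallParameter e := isSmallParameter_Ioo hε₀
  have hmem : ∀ i : Set.Ioo 0 ε₀, (i : ℝ) ∈ Set.Ico 0 ε₀ := fun i => ⟨i.2.1.le, i.2.2⟩
  have hHE : ∀ n, Expands e Z n (fun i => H i) Hc :=
    hH.expands hε₀ fun t ht ε hε k hk => ht.1 ε hε k hk
  have hH0 : H 0 = Hc 0 := hH.zero hε₀
  have hsa0 : ∀ t, IsSelfAdjoint (Hc 0 t) := fun t => hH0 ▸ hsa 0 ⟨le_rfl, hε₀⟩ t
  obtain ⟨-, γm, γp, hγm, hγp, hγ, hin, ⟨g, hg, hout⟩, -⟩ := hgap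
  have hgapped : GappedFamily Z (g / 2) (Hc 0) π₀ := by
    rw [show π₀ = fun t => cfc ((σr t).indicator fun _ => (1 : ℝ)) (Hc 0 t) from funext hπ₀]
    exact gappedFamily_of_gap hg ((hH.coeff 0).unifSymbol fun t ht k hk =>
      hH.iteratedDeriv_coeff_eq_zero hε₀ (fun ε hε => ht.1 ε hε k hk) 0) hsa0 hγm hγp hγ hin hout
  have hD : AdiabaticData e Z (g / 2) (fun i => H i) (Hc 0) π₀ := by
    obtain ⟨H₁, hH₁, hH₁E⟩ := Expands.exists_tail he hHE
    exact ⟨he, hgapped, fun i t => hsa i (hmem i) t, fun n => ⟨_, hHE n⟩,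
      ⟨H₁, fun n => ⟨_, hH₁E n⟩, hH₁⟩, fun i t ht => ht.2 i (hmem i)⟩
  have hHu := hD.expandable.unifSymbol
  obtain ⟨W, hWu, hW1, hWE, ⟨Y, hY, hWY⟩, hWK⟩ := hD.exists_adapted_frame
  obtain ⟨u, huu, hus, hu', hup⟩ := exists_parallel_transport (Z := Z) hgapped.unifSymbol hgapped.proj
  have hus' : UnifSymbol Z fun _ : Set.Ioo 0 ε₀ => u := hus.comp fun _ => ()
  set q : 𝓗 →L[ℂ] 𝓗 := π₀ 0 with hq
  have hqq : q * q = q := hD.mul_self 0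
  have hqs : star q = q := (hgapped.proj 0).isSelfAdjoint.star_eq
  -- the intertwining unitaries
  set V : Set.Ioo 0 ε₀ → ℝ → 𝓗 →L[ℂ] 𝓗 := fun i t => u t * W i t with hV
  have hVu : ∀ i t, V i t ∈ unitary (𝓗 →L[ℂ] 𝓗) := fun i t => mul_mem (huu t) (hWu i t)
  have hVE : IsExpandable e Z V := (IsExpandable.of_symbol hus').mul he hWE
  have hVs := hVE.unifSymbol
  have hVY : ∀ i t, V i t = u t + e i • (u t * Y i t) := fun i t => by
    rw [hV]
    simp only [hWY, mul_add, mul_one, mul_smul_comm]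
  obtain ⟨uc, huc⟩ := exists_expands_of_forall he hVE
  -- Uniqueness of expansions identifies the leading coefficient, which is also the value prescribed
  -- at `ε = 0`.
  have huc0 : uc 0 = u :=
    (huc 1).unique he (b := fun _ => u) ⟨hus', _, hVY, hus'.mul hY⟩ 0 one_pos
  -- the decoupled subspace
  set P : Set.Ioo 0 ε₀ → ℝ → 𝓗 →L[ℂ] 𝓗 := fun i t => star (V i t) * q * V i t with hP
  have hPW : ∀ i t, P i t = star (W i t) * π₀ t * W i t := fun i t => by
    have h1 := (unitary_conj_identity (huu t) (hup t)).2.2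
    rw [hP, hV]
    simp only [star_mul]
    rw [← h1]
    simp only [mul_assoc]
  have hPE : IsExpandable e Z P :=
    (hVE.star.mul he (IsExpandable.of_symbol (UnifSymbol.const q))).mul he hVE
  obtain ⟨PX, hPX, hPX'⟩ : ∃ X, UnifSymbol Z X ∧ ∀ i t, P i t = π₀ t + e i • X i t := by
    refine ⟨_, (hD.symbol_p.mul hY).add ((hY.star.mul hD.symbol_p).mul hWE.unifSymbol),
      fun i t => ?_⟩
    have h1 : star (W i t) = 1 + e i • star (Y i t) := by
      rw [hWY, star_add, star_one, star_smul, star_trivial (e i)]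
    rw [hPW, h1, add_mul, add_mul, one_mul, smul_mul_assoc, smul_mul_assoc]
    nth_rewrite 1 [hWY]
    rw [mul_add, mul_one, mul_smul_comm, smul_add, add_assoc]
  obtain ⟨pc, hpc⟩ := exists_expands_of_forall he hPE
  have hpc0 : pc 0 = π₀ :=
    (hpc 1).unique he (b := fun _ => π₀) ⟨hD.symbol_p, _, hPX', hPX⟩ 0 one_pos
  -- the Hamiltonian in the moving frame and its diagonal part
  set K := movingHamiltonian e (fun i => H i) V with hK
  have hKs : ∀ i t, star (K i t) = K i t :=
    star_movingHamiltonian hD.star_eq hVu hVs.differentiable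
  -- Conjugation by `u` maps the frame Hamiltonian to `K` and `π₀(t)` to `q`, and hence their
  -- commutator to `[K, q]`.
  have hKcomm : ∀ n, ∃ D, UnifSymbol Z D ∧ ∀ i t, K i t * q - q * K i t = e i ^ n • D i t := by
    intro n
    obtain ⟨D, hDu, hDK⟩ := hWK n
    refine ⟨_, (hus'.mul hDu).mul hus'.star, fun i t => ?_⟩
    obtain ⟨h1, h2, -⟩ := unitary_conj_identity (huu t) (hup t)
    rw [hK, hV, movingHamiltonian_mul huu hu' hWu hWE.unifSymbol.differentiable]
    change u t * frameHamiltonian e (fun i => H i) (katoForm π₀) W i t * star (u t) * q -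
      q * (u t * frameHamiltonian e (fun i => H i) (katoForm π₀) W i t * star (u t)) = _
    rw [mul_assoc, h2, ← mul_assoc q, ← mul_assoc q, ← h1, ← smul_mul_assoc, ← mul_smul_comm, ← hDK]
    noncomm_ring
  have hKE : ∀ n, Expands e Z n K (effectiveCoeff Hc uc) := fun n =>
    expands_movingHamiltonian he (hHE n) (huc n)
  -- Taking the diagonal part makes the commutation with `q` exact. It costs `O(ε^∞)`, so the
  -- expansion of `K` is preserved.
  set h : Set.Ioo 0 ε₀ → ℝ → 𝓗 →L[ℂ] 𝓗 := fun i t => diagOp q (K i t) with hh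
  have hhK := fun n => diagOp_eq_add hqq (hKcomm n)
  have hhE : ∀ n, Expands e Z n h (effectiveCoeff Hc uc) := fun n => by
    obtain ⟨D, hDu, hDK⟩ := hhK n
    rw [show h = fun i t => K i t + e i ^ n • D i t from funext₂ hDK]
    exact (hKE n).add_pow_smul hDu
  have hhu : UnifSymbol Z h := hhE 0
  have hhs : ∀ i t, star (h i t) = h i t := fun i t => star_diagOp hqs (hKs i t)
  have hh0 : ∀ t, effectiveCoeff Hc uc 0 t = u t * Hc 0 t * star (u t) := fun t => by
    simp [effectiveCoeff, huc0]
  -- the propagators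
  obtain ⟨CH, -, hCH⟩ := hHu.bdd
  obtain ⟨Ch, -, hCh⟩ := hhu.bdd
  choose U hU hU' using fun i : Set.Ioo 0 ε₀ => exists_propagator (ε := i) (hHu.continuous i)
    (hCH i) (hD.star_eq i)
  choose Ueff hUeff hUeff' using fun i : Set.Ioo 0 ε₀ => exists_propagator (ε := i)
    (hhu.continuous i) (hCh i) (hhs i)
  -- The factor `V(s)*` on the right normalizes the transformed propagator to `1` at `t = s`.
  have hUt : ∀ i s t, HasDerivAt (fun t => V i t * U i t s * star (V i s))
      ((Complex.I * ((e i : ℝ) : ℂ))⁻¹ • (K i t * (V i t * U i t s * star (V i s)))) t :=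
    fun i s t => by
      rw [hK, movingHamiltonian_eq hVu hVs.differentiable]
      exact hasDerivAt_moving_propagator (he.pos i).ne' (hVu i) (hVs.differentiable i) _ (hU' i s) t
  have hUtu : ∀ i s t, V i t * U i t s * star (V i s) ∈ unitary (𝓗 →L[ℂ] 𝓗) := fun i s t =>
    mul_mem (mul_mem (hVu i t) ((hU i).propagator.isUnitary t s)) (Unitary.star_mem (hVu i s))
  have hUts : ∀ i s, V i s * U i s s * star (V i s) = 1 := fun i s => by
    rw [(hU i).propagator.diag, mul_one, (Unitary.mem_iff.1 (hVu i s)).2]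
  refine ⟨extendIoo ε₀ U 0, fun ε hε => ?_, extendIoo ε₀ P π₀, ⟨?_, ?_, ?_, ?_, ?_⟩, u,
    extendIoo ε₀ V u, uc, ⟨huu, hus.isSymbol (), hup, ?_, ?_, ?_, ?_⟩,
    extendIoo ε₀ h (effectiveCoeff Hc uc 0), extendIoo ε₀ Ueff 0, ?_, ?_,
    hasSymbolExpansion_extendIoo hε₀ hhE, fun ε hε => ?_, ?_⟩
  · rw [extendIoo_coe U 0 ⟨ε, hε⟩]
    exact hU ⟨ε, hε⟩
  · refine (forall_mem_Ico_iff hε₀).2 ⟨?_, fun i => ?_⟩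
    · rw [extendIoo_zero]
      exact hgapped.proj
    · rw [extendIoo_coe]
      exact fun t => isStarProjection_star_mul_mul (hVu i t) ⟨hqq, hqs⟩
  · refine ⟨pc, ?_⟩
    rw [← hpc0]
    exact hasSymbolExpansion_extendIoo hε₀ hpc
  · obtain ⟨C, hC0, hC⟩ := hPX.bdd
    refine ⟨C, (forall_mem_Ico_iff hε₀).2 ⟨fun t => ?_, fun i t => ?_⟩⟩
    · simp [extendIoo_zero]
    · beta_reduce
      rw [extendIoo_coe, hPX', add_sub_cancel_left, norm_smul, Real.norm_of_nonneg (he.pos i).le,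
        mul_comm]
      exact mul_le_mul_of_nonneg_right (hC i t) (he.pos i).le
  · intro n
    -- One extra order compensates the factor `ε⁻¹` in Duhamel's formula.
    obtain ⟨D, hDu, hDK⟩ := hKcomm (n + 1)
    obtain ⟨C, hC0, hC⟩ := hDu.bdd
    refine ⟨C, fun ε hε t s => ?_⟩
    obtain ⟨i, rfl⟩ : ∃ i : Set.Ioo 0 ε₀, (i : ℝ) = ε := ⟨⟨ε, hε⟩, rfl⟩
    beta_reduce
    rw [extendIoo_coe, extendIoo_coe]
    -- Both evolutions are the one generated by `K`, and `R = q`: the error is the commutator `[K,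
    -- q]`.
    have h1 := norm_duhamel_le (he.pos i) (hUtu i s) (hUtu i s) (hKs i) (hUt i s) (hUt i s) q
      (M := e i ^ (n + 1) * C) (fun t => by
        rw [norm_sub_rev, hDK, norm_smul, Real.norm_of_nonneg (pow_nonneg (he.pos i).le _)]
        exact mul_le_mul_of_nonneg_left (hC i t) (pow_nonneg (he.pos i).le _)) t s
    rw [hUts, star_one, one_mul, mul_one] at h1
    have h2 : star (U i t s) * P i t * U i t s - P i s = star (V i s) *
        (star (V i t * U i t s * star (V i s)) * q * (V i t * U i t s * star (V i s)) - q) *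
          V i s := by
      have h3 := (Unitary.mem_iff.1 (hVu i s)).1
      have h4 : star (V i s) * (star (V i t * U i t s * star (V i s)) * q *
          (V i t * U i t s * star (V i s)) - q) * V i s = star (V i s) * V i s *
          (star (U i t s) * (star (V i t) * q * V i t) * U i t s) * (star (V i s) * V i s) -
          star (V i s) * q * V i s := by
        simp only [star_mul, star_star]
        noncomm_ring
      rw [h4, h3, one_mul, mul_one]
    rw [h2, CStarRing.norm_mul_mem_unitary _ (hVu i s),
      CStarRing.norm_mem_unitary_mul _ (Unitary.star_mem (hVu i s))]
    refine h1.trans (le_of_eq ?_)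
    rw [pow_succ', mul_assoc (e i), inv_mul_cancel_left₀ (he.pos i).ne', mul_comm C]
  · intro t ht₁ ht₂
    have ht : t ∈ Z := ⟨ht₁, ht₂⟩
    refine (forall_mem_Ico_iff hε₀).2 ⟨by rw [extendIoo_zero], fun i => ?_⟩
    rw [extendIoo_coe, hPW, hW1 i t ht, star_one, one_mul, mul_one]
  · refine (forall_mem_Ico_iff hε₀).2 ⟨?_, fun i => ?_⟩
    · rw [extendIoo_zero]
      exact huu
    · rw [extendIoo_coe]
      exact hVu i
  · have := hasSymbolExpansion_extendIoo hε₀ huc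
    rwa [huc0] at this
  · refine (forall_mem_Ico_iff hε₀).2 ⟨?_, fun i => ?_⟩
    · rw [extendIoo_zero, extendIoo_zero]
      exact hup
    · rw [extendIoo_coe, extendIoo_coe]
      exact fun t => mul_star_mul_mul_star (hVu i t) q
  · obtain ⟨C, hC0, hC⟩ := (hus'.mul hY).bdd
    refine ⟨C, (forall_mem_Ico_iff hε₀).2 ⟨fun t => ?_, fun i t => ?_⟩⟩
    · simp [extendIoo_zero]
    · beta_reduce
      rw [extendIoo_coe, hVY, add_sub_cancel_left, norm_smul, Real.norm_of_nonneg (he.pos i).le,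
        mul_comm]
      exact mul_le_mul_of_nonneg_right (hC i t) (he.pos i).le
  · refine (forall_mem_Ico_iff hε₀).2 ⟨fun t => ?_, fun i t => ?_⟩
    · rw [extendIoo_zero, hh0]
      exact (hsa0 t).conjugate (u t)
    · rw [extendIoo_coe]
      exact hhs i t
  · refine (forall_mem_Ico_iff hε₀).2 ⟨fun t => ?_, fun i t => ?_⟩
    · rw [extendIoo_zero, hh0]
      obtain ⟨h1, h2, -⟩ := unitary_conj_identity (huu t) (hup t)
      rw [Commute, SemiconjBy, mul_assoc, h2, ← mul_assoc q, ← mul_assoc q, ← h1, mul_assoc (u t),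
        ← mul_assoc _ (π₀ t), (hgapped.comm t).eq]
      simp only [mul_assoc]
    · rw [extendIoo_coe]
      exact commute_diagOp hqq _
  · rw [extendIoo_coe Ueff 0 ⟨ε, hε⟩, extendIoo_coe h _ ⟨ε, hε⟩]
    exact hUeff ⟨ε, hε⟩
  · intro n
    obtain ⟨D, hDu, hDK⟩ := hhK (n + 1)
    obtain ⟨C, hC0, hC⟩ := hDu.bdd
    refine ⟨C, fun ε hε t s => ?_⟩
    obtain ⟨i, rfl⟩ : ∃ i : Set.Ioo 0 ε₀, (i : ℝ) = ε := ⟨⟨ε, hε⟩, rfl⟩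
    beta_reduce
    rw [extendIoo_coe, extendIoo_coe, extendIoo_coe]
    have hUu := (hUeff i).propagator.isUnitary
    -- With `R = 1`, the evolutions generated by `h` and by `K` are compared, and the error is `K -
    -- h`.
    have h1 := norm_duhamel_le (he.pos i) (fun t => hUu t s) (hUtu i s) (hhs i) (hUeff' i s)
      (hUt i s) 1 (M := e i ^ (n + 1) * C) (fun t => by
        rw [one_mul, mul_one, norm_sub_rev, hh]
        beta_reduce
        rw [hDK, add_sub_cancel_left, norm_smul, Real.norm_of_nonneg (pow_nonneg (he.pos i).le _)]
        exact mul_le_mul_of_nonneg_left (hC i t) (pow_nonneg (he.pos i).le _)) t s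
    rw [hUts, (hUeff i).propagator.diag, star_one, mul_one, mul_one, one_mul] at h1
    have h2 : U i t s - star (V i t) * Ueff i t s * V i s = star (V i t) * (Ueff i t s *
        (star (Ueff i t s) * (V i t * U i t s * star (V i s)) - 1)) * V i s := by
      have h3 := (Unitary.mem_iff.1 (hVu i s)).1
      have h3' := (Unitary.mem_iff.1 (hVu i t)).1
      have h3'' := (Unitary.mem_iff.1 (hUu t s)).2
      have h4 : star (V i t) * (Ueff i t s *
          (star (Ueff i t s) * (V i t * U i t s * star (V i s)) - 1)) * V i s =
          star (V i t) * (Ueff i t s * star (Ueff i t s)) * V i t * U i t s *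
            (star (V i s) * V i s) - star (V i t) * Ueff i t s * V i s := by
        noncomm_ring
      rw [h4, h3, h3'', mul_one, mul_one, h3', one_mul]
    rw [h2, CStarRing.norm_mul_mem_unitary _ (hVu i s),
      CStarRing.norm_mem_unitary_mul _ (Unitary.star_mem (hVu i t)),
      CStarRing.norm_mem_unitary_mul _ (hUu t s)]
    refine h1.trans (le_of_eq ?_)
    rw [pow_succ', mul_assoc (e i), inv_mul_cancel_left₀ (he.pos i).ne', mul_comm C]
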